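/- Let $G$ be a compact Lie group acting smoothly and almost freely (i.e. with finite stabilizers $G_p$) on the left of a smooth manifold $M$ (Hausdorff, second countable, without boundary); in particular $G$ may be connected and $M$ compact and oriented. Let $G$ act on $G\times M$ by $g\cdot(h,p)=(ghg^{-1},gp)$, let $T:G\times M\to G\times M$, $T(g,p)=(g,gp)$, and let $\bar I=\{(g,p): gp=p\}$ be the fixed point set of $T$. Orbifold charts of $X$ are maps $\phi:U\to X$ from a disc $U$ about the origin of a Euclidean space, on which a finite group $\Gamma$ acts orthogonally (possibly ineffectively), such that $\phi$ induces a homeomorphism from $\Gamma\backslash U$ onto an open set; $\phi$ is centered at $\phi(0)$. Charts are compatible through smooth open embeddings $\psi:U\to U'$ with $\phi'\circ\psi=\phi$, equivariant with respect to injective homomorphisms $\theta:\Gamma\to\Gamma'$. Different components of an orbifold may have different dimensions. If $G$ acts almost freely on a manifold $P$ whose components may have different dimensions, the charts of $G\backslash P$ are the slice discs $U$ at points $p\in P$, with $\Gamma=G_p$: embedded discs on which $G_p$ acts orthogonally in suitable coordinates and for which $G\times_{G_p}U\to P$, $[g,x]\mapsto gx$, is a diffeomorphism onto an open set. Their embeddings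 are $\psi(x)=f(x)x$ with $f:U\to G$ continuous, and $\theta(\gamma)=f(0)\gamma f(0)^{-1}$. The inertia orbifold of $X$ is $\Lambda X=\{(x,[g]) : x\in X,\ [g]\text{ a conjugacy class of the isotropy group of }x\}$. Its charts are the fixed point sets $U^g\to\Lambda X$, for $\phi:U\to X$ a chart with group $\Gamma$ and $g\in\Gamma$, with the centralizer $Z_\Gamma(g)$ as group; they are glued along the embeddings $U^h\to U'^{\theta(h)}$ induced by the embeddings $(\psi,\theta)$ of charts of $X$. A diffeomorphism of orbifolds is a homeomorphism that near every point is covered by a diffeomorphism between centered charts, equivariant with respect to an isomorphism of their groups. Then $\bar I$ is a $G$-invariant embedded submanifold of $G\times M$ (its components may have different dimensions); $G\backslash M$, $G\backslash\bar I$ and $\Lambda(G\backslash M)$, with the charts above, are orbifolds; and $G\backslash\bar I$ is diffeomorphic, as an orbifold, to $\Lambda(G\backslash M)$. -/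

import Mathlib

open scoped Manifold ContDiff

/-! ### Discs with orthogonal actions -/

/-- The open disc of radius `r` centred at the origin, as an open subset (hence a smooth manifold)
of the Euclidean space `E`. -/
abbrev disc (E : Type) [NormedAddCommGroup E] (r : ℝ) : TopologicalSpace.Opens E :=
  ⟨Metric.ball 0 r, Metric.isOpen_ball⟩

/-- A linear isometry of `E` restricted to the disc. -/
def discMap {E : Type} [NormedAddCommGroup E] [InnerProductSpace ℝ E] {r : ℝ}
    (A : E ≃ₗᵢ[ℝ] E) (x : disc E r) : disc E r :=
  ⟨A x.1, by
    have hx : ‖(x : E)‖ < r := mem_ball_zero_iff.1 x.2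
    exact mem_ball_zero_iff.2 (by rwa [A.norm_map])⟩

/-! ### Orbifold charts and atlases -/

/-- The data of an orbifold chart for `X`: a group `Γ` acting orthogonally on a Euclidean space `E`
(not necessarily effectively) and a map to `X` from an open disc `U` in `E` centred at the origin.
The required properties are in `OrbifoldChart.IsChart`. -/
structure OrbifoldChart.{v, u} (X : Type u) where
  E : Type
  [instNACG : NormedAddCommGroup E]
  [instIPS : InnerProductSpace ℝ E]
  [instFD : FiniteDimensional ℝ E]
  Γ : Type v
  [instGroup : Group Γ]
  rep : Γ →* (E ≃ₗᵢ[ℝ] E)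
  radius : ℝ
  map : disc E radius → X

attribute [instance] OrbifoldChart.instNACG OrbifoldChart.instIPS OrbifoldChart.instFD
  OrbifoldChart.instGroup

namespace OrbifoldChart

universe v u

variable {X : Type u}

/-- The disc on which the chart is defined. -/
abbrev U (c : OrbifoldChart.{v, u} X) : TopologicalSpace.Opens c.E := disc c.E c.radius

/-- The action of the isotropy group on the disc. -/
def act (c : OrbifoldChart.{v, u} X) (γ : c.Γ) (x : c.U) : c.U := discMap (c.rep γ) x

/-- The chart is centred at `p`: it sends the origin to `p`. -/
def IsCenteredAt (c : OrbifoldChart.{v, u} X) (p : X) : Prop :=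
  ∃ x : c.U, (x : c.E) = 0 ∧ c.map x = p

/-- `c` is an orbifold chart: `Γ` is finite, and the map `U → X` is `Γ`-invariant and induces a
homeomorphism from `Γ\U` onto an open subset of `X`. -/
structure IsChart [TopologicalSpace X] (c : OrbifoldChart.{v, u} X) : Prop where
  radius_pos : 0 < c.radius
  finite : Finite c.Γ
  continuous : Continuous c.map
  isOpenMap : IsOpenMap c.map
  fiber : ∀ x y : c.U, c.map x = c.map y ↔ ∃ γ : c.Γ, c.act γ x = y

/-- `(ψ, θ)` is an embedding of the chart `c` into the chart `d`: `ψ` is a smooth open embedding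
covering the identity of `X`, equivariant with respect to the injective homomorphism `θ`. The last
field (automatic if the actions are effective) says that every element of the isotropy group of
`d` that relates two points of the image of `ψ` comes from the isotropy group of `c`. -/
structure IsEmbedding (c d : OrbifoldChart.{v, u} X) (ψ : c.U → d.U) (θ : c.Γ →* d.Γ) :
    Prop where
  injective : Function.Injective ψ
  isLocalDiffeomorph : IsLocalDiffeomorph 𝓘(ℝ, c.E) 𝓘(ℝ, d.E) ∞ ψ
  injective_hom : Function.Injective θ
  equivariant : ∀ (γ : c.Γ) (x : c.U), ψ (c.act γ x) = d.act (θ γ) (ψ x)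
  map_comp : ∀ x : c.U, d.map (ψ x) = c.map x
  full : ∀ (δ : d.Γ) (x y : c.U), d.act δ (ψ x) = ψ y → ∃ γ : c.Γ, θ γ = δ

end OrbifoldChart

/-- The data of an orbifold atlas on `X`: a family of orbifold charts, and for each pair of charts
the embeddings (with the accompanying homomorphisms of isotropy groups) between them. The
embeddings are recorded because the isotropy groups need not act effectively. -/
structure OrbifoldAtlas.{w, v, u} (X : Type u) where
  ι : Type w
  chart : ι → OrbifoldChart.{v, u} X
  emb : ∀ i j : ι, Set (((chart i).U → (chart j).U) × ((chart i).Γ →* (chart j).Γ))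

namespace OrbifoldAtlas

universe w v u

variable {X : Type u}

/-- `X` with the atlas `A` is an orbifold (components may have different dimensions, and isotropy
groups may act ineffectively): there are charts centred at every point, and any two charts are
compatible near every common point. The embeddings form a category containing the isotropy groups
of the charts, and two embeddings between the same charts differ by an element of the isotropy
group of the target. -/
structure IsOrbifold [TopologicalSpace X] (A : OrbifoldAtlas.{w, v, u} X) : Prop where
  t2Space : T2Space X
  secondCountable : SecondCountableTopology X
  isChart : ∀ i, (A.chart i).IsChart
  isEmbedding : ∀ i j, ∀ e ∈ A.emb i j, (A.chart i).IsEmbedding (A.chart j) e.1 e.2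
  exists_centered : ∀ p : X, ∃ i, (A.chart i).IsCenteredAt p
  compatible : ∀ i j, ∀ q ∈ Set.range (A.chart i).map ∩ Set.range (A.chart j).map,
    ∃ k, (A.chart k).IsCenteredAt q ∧ (A.emb k i).Nonempty ∧ (A.emb k j).Nonempty
  act_mem : ∀ i, ∀ γ : (A.chart i).Γ,
    ((A.chart i).act γ, (MulAut.conj γ).toMonoidHom) ∈ A.emb i i
  comp_mem : ∀ i j k, ∀ e ∈ A.emb i j, ∀ e' ∈ A.emb j k,
    (e'.1 ∘ e.1, e'.2.comp e.2) ∈ A.emb i k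
  unique : ∀ i j, ∀ e ∈ A.emb i j, ∀ e' ∈ A.emb i j,
    ∃ γ : (A.chart j).Γ, e' = ((A.chart j).act γ ∘ e.1, (MulAut.conj γ).toMonoidHom.comp e.2)

end OrbifoldAtlas

/-- A homeomorphism `F : X → Y` is a diffeomorphism of orbifolds if near every point it is covered
by a diffeomorphism between centred orbifold charts that is equivariant with respect to an
isomorphism of the isotropy groups. -/
def IsOrbifoldDiffeo.{w, v, u, w', v', u'} {X : Type u} {Y : Type u'} [TopologicalSpace X]
    [TopologicalSpace Y] (A : OrbifoldAtlas.{w, v, u} X) (B : OrbifoldAtlas.{w', v', u'} Y)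
    (F : X ≃ₜ Y) : Prop :=
  ∀ p : X, ∃ (i : A.ι) (j : B.ι),
    (A.chart i).IsCenteredAt p ∧ (B.chart j).IsCenteredAt (F p) ∧
    ∃ (ψ : Diffeomorph 𝓘(ℝ, (A.chart i).E) 𝓘(ℝ, (B.chart j).E) (A.chart i).U (B.chart j).U ∞)
      (θ : (A.chart i).Γ ≃* (B.chart j).Γ),
      (∀ γ x, ψ ((A.chart i).act γ x) = (B.chart j).act (θ γ) (ψ x)) ∧
      ∀ x, F ((A.chart i).map x) = (B.chart j).map (ψ x)

/-- Two orbifolds are diffeomorphic. -/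
def OrbifoldDiffeomorphic.{w, v, u, w', v', u'} {X : Type u} {Y : Type u'} [TopologicalSpace X]
    [TopologicalSpace Y] (A : OrbifoldAtlas.{w, v, u} X) (B : OrbifoldAtlas.{w', v', u'} Y) :
    Prop :=
  ∃ F : X ≃ₜ Y, IsOrbifoldDiffeo A B F

/-! ### The inertia orbifold -/

/-- The subspace of vectors fixed by a linear isometry. -/
def fixedSubspace {E : Type} [NormedAddCommGroup E] [InnerProductSpace ℝ E] (A : E ≃ₗᵢ[ℝ] E) :
    Submodule ℝ E where
  carrier := {x | A x = x}
  add_mem' {a b} ha hb := by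
    simp only [Set.mem_ofPred_eq] at ha hb ⊢
    rw [map_add, ha, hb]
  zero_mem' := by simp
  smul_mem' c x hx := by
    simp only [Set.mem_ofPred_eq] at hx ⊢
    rw [map_smul, hx]

theorem rep_mem_fixedSubspace {E : Type} [NormedAddCommGroup E] [InnerProductSpace ℝ E]
    {Γ : Type*} [Group Γ] (ρ : Γ →* (E ≃ₗᵢ[ℝ] E)) (g : Γ)
    (z : Subgroup.centralizer ({g} : Set Γ)) {x : E} (hx : x ∈ fixedSubspace (ρ g)) :
    ρ z x ∈ fixedSubspace (ρ g) := by
  have hz : g * (z : Γ) = z * g := Subgroup.mem_centralizer_singleton_iff.1 z.2 |>.symm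
  have hx' : ρ g x = x := hx
  change ρ g (ρ z x) = ρ z x
  have h1 : ρ g (ρ z x) = ρ (g * z) x := by rw [map_mul]; rfl
  have h2 : ρ ((z : Γ) * g) x = ρ z (ρ g x) := by rw [map_mul]; rfl
  rw [h1, hz, h2, hx']

/-- The orthogonal action of the centralizer of `g` on the subspace fixed by `g`. -/
def centralizerRep {E : Type} [NormedAddCommGroup E] [InnerProductSpace ℝ E]
    {Γ : Type*} [Group Γ] (ρ : Γ →* (E ≃ₗᵢ[ℝ] E)) (g : Γ) :
    Subgroup.centralizer ({g} : Set Γ) →* (fixedSubspace (ρ g) ≃ₗᵢ[ℝ] fixedSubspace (ρ g)) where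
  toFun z :=
    { toFun := fun x => ⟨ρ z x, rep_mem_fixedSubspace ρ g z x.2⟩
      map_add' := fun x y => Subtype.ext (map_add (ρ z) (x : E) (y : E))
      map_smul' := fun c x => Subtype.ext (map_smul (ρ z) c (x : E))
      invFun := fun x => ⟨ρ (z⁻¹ : Subgroup.centralizer ({g} : Set Γ)) x,
        rep_mem_fixedSubspace ρ g z⁻¹ x.2⟩
      left_inv := fun x => Subtype.ext (by
        change (ρ (z : Γ)⁻¹ * ρ z) (x : E) = x
        rw [← map_mul, inv_mul_cancel, map_one]; rfl)
      right_inv := fun x => Subtype.ext (by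
        change (ρ z * ρ (z : Γ)⁻¹) (x : E) = x
        rw [← map_mul, mul_inv_cancel, map_one]; rfl)
      norm_map' := fun x => (ρ z).norm_map (x : E) }
  map_one' := by
    ext x
    change ρ (1 : Γ) (x : E) = x
    rw [map_one]; rfl
  map_mul' a b := by
    ext x
    change ρ ((a : Γ) * b) (x : E) = ρ a (ρ b x)
    rw [map_mul]; rfl

namespace OrbifoldAtlas

universe w v u

variable {X : Type u} (A : OrbifoldAtlas.{w, v, u} X)

/-- The charts of the inertia orbifold are indexed by a chart `U` of `X` and an element `g` of its
isotropy group. -/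
abbrev InertiaIndex : Type (max w v) := Σ i : A.ι, (A.chart i).Γ

/-- The fixed point set `U^g`: the open disc in the subspace fixed by `g`. -/
abbrev inertiaDisc (k : A.InertiaIndex) :
    TopologicalSpace.Opens (fixedSubspace ((A.chart k.1).rep k.2)) :=
  disc (fixedSubspace ((A.chart k.1).rep k.2)) (A.chart k.1).radius

/-- The inclusion of `U^g` into `U`. -/
def inertiaIncl (k : A.InertiaIndex) (x : A.inertiaDisc k) : (A.chart k.1).U :=
  ⟨(x.1 : (A.chart k.1).E), by
    have hx : ‖x.1‖ < (A.chart k.1).radius := mem_ball_zero_iff.1 x.2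
    exact mem_ball_zero_iff.2 hx⟩

/-- Two points `x ∈ U^h` and `y ∈ U'^g` are identified by an embedding `(ψ, θ)` of `U` into `U'`
if `θ h = g` and `ψ x = y`. -/
def InertiaRel (a b : Σ k : A.InertiaIndex, A.inertiaDisc k) : Prop :=
  ∃ e ∈ A.emb a.1.1 b.1.1,
    e.2 a.1.2 = b.1.2 ∧ e.1 (A.inertiaIncl a.1 a.2) = A.inertiaIncl b.1 b.2

/-- The space underlying the inertia orbifold `ΛX`, with the quotient topology: the disjoint union
of the fixed point sets `U^g` of all charts, glued along the chart embeddings. The class of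
`x ∈ U^g` is the point `(φ(x), [g])`, where `φ : U → X` is the chart and `[g]` is the conjugacy
class of `g` in the isotropy group `{h ∈ Γ | h x = x}` of `φ(x)`; the isotropy groups that
different charts assign to the same point are identified, up to conjugation, by the
embeddings. -/
def Inertia : Type (max w v) := Quot A.InertiaRel

instance : TopologicalSpace A.Inertia :=
  inferInstanceAs (TopologicalSpace (Quot A.InertiaRel))

/-- The chart of `ΛX` given by `U^g` with the action of the centralizer of `g`. -/
noncomputable def inertiaChart (k : A.InertiaIndex) : OrbifoldChart.{v, max w v} A.Inertia where
  E := fixedSubspace ((A.chart k.1).rep k.2)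
  Γ := Subgroup.centralizer ({k.2} : Set (A.chart k.1).Γ)
  rep := centralizerRep (A.chart k.1).rep k.2
  radius := (A.chart k.1).radius
  map := fun x => Quot.mk _ ⟨k, x⟩

/-- The inclusion of the centralizer of `g` into the isotropy group. -/
def inertiaGroupIncl (k : A.InertiaIndex) : (A.inertiaChart k).Γ →* (A.chart k.1).Γ :=
  (Subgroup.centralizer ({k.2} : Set (A.chart k.1).Γ)).subtype

/-- The orbifold structure of the inertia orbifold `ΛX`. The embeddings `U^h → U'^g` are the
restrictions of the embeddings `(ψ, θ)` of `U` into `U'` with `θ h = g`. -/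
noncomputable def inertia : OrbifoldAtlas.{max w v, v, max w v} A.Inertia where
  ι := A.InertiaIndex
  chart := A.inertiaChart
  emb k l := {e | ∃ e₀ ∈ A.emb k.1 l.1, e₀.2 k.2 = l.2 ∧
    (∀ x : A.inertiaDisc k, A.inertiaIncl l (e.1 x) = e₀.1 (A.inertiaIncl k x)) ∧
    ∀ z, A.inertiaGroupIncl l (e.2 z) = e₀.2 (A.inertiaGroupIncl k z)}

end OrbifoldAtlas

/-! ### Quotients by almost free actions -/

section Quotient

variable {EG HG EN HN : Type*} [NormedAddCommGroup EG] [NormedSpace ℝ EG] [TopologicalSpace HG]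
  [NormedAddCommGroup EN] [NormedSpace ℝ EN] [TopologicalSpace HN]
  (IG : ModelWithCorners ℝ EG HG) (IN : ModelWithCorners ℝ EN HN)
  {G N P : Type*} [Group G] [TopologicalSpace G] [ChartedSpace HG G]
  [TopologicalSpace N] [ChartedSpace HN N] [TopologicalSpace P] [MulAction G P]

/-- A subset `S` of a manifold without boundary is an embedded submanifold (possibly with
components of different dimensions): near each of its points there is a smooth chart of the
manifold in which `S` is a linear subspace. -/
def IsEmbeddedSubmanifold (S : Set N) : Prop :=
  ∀ x ∈ S, ∃ e ∈ IsManifold.maximalAtlas IN ∞ N, x ∈ e.source ∧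
    ∃ W : Submodule ℝ EN, ∀ y ∈ e.source, y ∈ S ↔ e.extend IN y - e.extend IN x ∈ W

/-- Let `P` be a space with an action of `G`, given as an embedded submanifold of a manifold `N`
by the inclusion `j : P → N`. A slice disc at a point `p` of `P` is an embedded disc `U` through
`p`, on which the stabilizer `G_p` acts (orthogonally, in suitable coordinates), such that
`G ×_{G_p} U → P`, `[g, x] ↦ g x`, is a diffeomorphism onto an open subset of `P`.
Here `[g, x] = [h, y]` if and only if `(h, y) = (g γ⁻¹, γ x)` for some `γ ∈ G_p`. -/
structure SliceDisc (j : P → N) where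
  pt : P
  E : Type
  [instNACG : NormedAddCommGroup E]
  [instIPS : InnerProductSpace ℝ E]
  [instFD : FiniteDimensional ℝ E]
  rep : MulAction.stabilizer G pt →* (E ≃ₗᵢ[ℝ] E)
  radius : ℝ
  radius_pos : 0 < radius
  slice : disc E radius → P
  slice_zero : slice ⟨0, Metric.mem_ball_self radius_pos⟩ = pt
  slice_equivariant : ∀ (γ : MulAction.stabilizer G pt) (x : disc E radius),
    slice (discMap (rep γ) x) = (γ : G) • slice x
  tube_eq_iff : ∀ (g h : G) (x y : disc E radius), g • slice x = h • slice y ↔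
    ∃ γ : MulAction.stabilizer G pt, h = g * (γ : G)⁻¹ ∧ y = discMap (rep γ) x
  tube_contMDiff : ContMDiff (IG.prod 𝓘(ℝ, E)) IN ∞
    (fun z : G × disc E radius => j (z.1 • slice z.2))
  tube_immersion : ∀ z : G × disc E radius, Function.Injective
    (mfderiv (IG.prod 𝓘(ℝ, E)) IN (fun z : G × disc E radius => j (z.1 • slice z.2)) z)
  tube_isOpenMap : IsOpenMap (fun z : G × disc E radius => z.1 • slice z.2)

attribute [instance] SliceDisc.instNACG SliceDisc.instIPS SliceDisc.instFD

namespace SliceDisc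

variable {IG IN} {j : P → N}

/-- The origin of the disc. -/
def origin (s : SliceDisc (G := G) IG IN j) : disc s.E s.radius :=
  ⟨0, Metric.mem_ball_self s.radius_pos⟩

/-- The orbifold chart for `G\P` given by a slice disc at `p`, with isotropy group `G_p`. -/
def toChart (s : SliceDisc (G := G) IG IN j) :
    OrbifoldChart (MulAction.orbitRel.Quotient G P) where
  E := s.E
  Γ := MulAction.stabilizer G s.pt
  rep := s.rep
  radius := s.radius
  map := fun x => Quotient.mk _ (s.slice x)

/-- The inclusion of the isotropy group of the chart into `G`. -/
def groupIncl (s : SliceDisc (G := G) IG IN j) : s.toChart.Γ →* G :=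
  (MulAction.stabilizer G s.pt).subtype

end SliceDisc

/-- The orbifold structure of the quotient `G\P` by an almost free action: the charts are the slice
discs, and the embeddings between them are `ψ(x) = f(x) x` for continuous `G`-valued functions `f`
on a slice disc, with accompanying homomorphism `θ(γ) = f(0) γ f(0)⁻¹`. -/
def quotientAtlas (j : P → N) : OrbifoldAtlas (MulAction.orbitRel.Quotient G P) where
  ι := SliceDisc (G := G) IG IN j
  chart := SliceDisc.toChart
  emb s t := {e | ∃ f : disc s.E s.radius → G, Continuous f ∧
    (∀ x : disc s.E s.radius, t.slice (e.1 x) = f x • s.slice x) ∧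
    ∀ γ, t.groupIncl (e.2 γ) = f s.origin * s.groupIncl γ * (f s.origin)⁻¹}

end Quotient

/-! ### The fixed point set `Ī` -/

/-- The manifold `G × M`, regarded as carrying the action `g (h, p) = (g h g⁻¹, g p)`. -/
def ConjProd (G M : Type*) : Type _ := G × M

section ConjProd

variable (G M : Type*)

instance [TopologicalSpace G] [TopologicalSpace M] : TopologicalSpace (ConjProd G M) :=
  inferInstanceAs (TopologicalSpace (G × M))

instance {HG HM : Type*} [TopologicalSpace G] [TopologicalSpace M] [TopologicalSpace HG]
    [TopologicalSpace HM] [ChartedSpace HG G] [ChartedSpace HM M] :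
    ChartedSpace (ModelProd HG HM) (ConjProd G M) :=
  inferInstanceAs (ChartedSpace (ModelProd HG HM) (G × M))

instance [Group G] [MulAction G M] : MulAction G (ConjProd G M) where
  smul g x := (g * x.1 * g⁻¹, g • x.2)
  one_smul x := by
    change ((1 * x.1 * 1⁻¹, (1 : G) • x.2) : G × M) = x
    simp only [one_mul, inv_one, mul_one, one_smul]
    rfl
  mul_smul g h x := by
    change ((g * h * x.1 * (g * h)⁻¹, (g * h) • x.2) : G × M) =
      (g * (h * x.1 * h⁻¹) * g⁻¹, g • h • x.2)
    simp [mul_assoc, mul_smul]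

variable [Group G] [MulAction G M]

/-- The map `T(g, p) = (g, g p)` on `G × M`. -/
def inertiaMap (x : ConjProd G M) : ConjProd G M := (x.1, x.1 • x.2)

/-- The fixed point set `Ī` of `T`, as a `G`-invariant subset of `G × M`. -/
def fixedLocus : SubMulAction G (ConjProd G M) where
  carrier := Function.fixedPoints (inertiaMap G M)
  smul_mem' g x hx := by
    have h : x.1 • x.2 = x.2 := congrArg Prod.snd hx
    change ((g * x.1 * g⁻¹, (g * x.1 * g⁻¹) • g • x.2) : G × M) = (g * x.1 * g⁻¹, g • x.2)
    rw [smul_smul, inv_mul_cancel_right, mul_smul, h]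

end ConjProd

/-!
A slice disc of the `G`-manifold `Ī` at a point `(g, p)` is `{g} × U^g`, where `U` is a slice disc
of `M` at `p`, and its group is the stabilizer of `(g, p)` under conjugation, which is the
centralizer of `g` in `G_p`. These are the data of the charts `U^g` of the inertia orbifold of
`G\M`, so the two orbifolds have the same charts, and only the gluing and the manifold structures
have to be compared.

*Slices of `M`.* The orbit map of a point `p` with finite stabilizer is an immersion: a tangent
vector in its kernel extends to a left-invariant vector field whose integral curve through `1`
stays in the discrete set `G_p` (`injective_mfderiv_smul_point`). The family of the translates of
a chart by `G_p` is an equivariant immersion to a permutation representation, and the projection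
to the image of its derivative is an equivariant chart (`exists_equivariant_chart`). There the
orthogonal complement of the tangent space of the orbit is a germ of a slice
(`exists_local_slice`), and compactness of `G` turns a small disc in it into a slice disc
(`exists_sliceDisc`).

*Quotient orbifolds.* As `G_p` is finite, the tube map `G × U → P` is a local homeomorphism
(`SliceDisc.isLocalHomeomorph_tube`), and being an immersion into the ambient manifold it makes
every map `ψ(x) = f(x) x` between slice discs a local diffeomorphism
(`SliceDisc.IsTransition.isLocalDiffeomorph`). The function `x ↦ f(γ x) γ f(x)⁻¹` is continuous
with values in a finite group, so it is constant on the disc, and `ψ` is equivariant with respect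
to `γ ↦ f(0) γ f(0)⁻¹` (`SliceDisc.IsTransition.apply_discMap`). Restricting slice discs to small
discs about other points (`SliceDisc.exists_restrict`) gives compatible charts, and the quotient
is an orbifold (`SliceDisc.quotientAtlas_isOrbifold`). All of this is done for a space `P` with an
inducing map to a manifold, so that it applies to `M` and to `Ī ⊆ G × M` alike.

*The fixed point set.* The tube map of `{g} × U^g` is open in `Ī`: if `k` fixes `a x` and is close
to `g`, with `a` close to `1` and `x ∈ U`, then `a⁻¹ k a` lies in `G_p` and is close to `g`, hence
equal to `g` (`SliceDisc.isOpenMap_inertiaTube`). So `{g} × U^g` is a slice disc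
(`SliceDisc.inertiaSlice`), and the image of an immersion that is open onto its image is a
submanifold (`exists_chart_of_immersion`). Sending the class of `x ∈ U^g` to the orbit of `(g, x)`
is a homeomorphism from the inertia orbifold to the quotient of `Ī`
(`isHomeomorph_inertiaToQuotient`): it is injective because two points in one orbit admit a common
smaller slice disc with transition maps to both (`exists_emb_of_smul_inertiaSliceMap_eq`). Its
inverse is covered by the identity of `U^g` (`orbifoldDiffeomorphic_fixedLocus_inertia`).
-/

open Set Filter Topology Function

/-! ### Inverse function theorem on manifolds without boundary -/

/-- The inverse function theorem for a smooth map between finite-dimensional vector spaces. -/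
theorem exists_partialDiffeomorph_of_hasFDerivAt {E F : Type*} [NormedAddCommGroup E]
    [NormedSpace ℝ E] [CompleteSpace E] [NormedAddCommGroup F] [NormedSpace ℝ F]
    {f : E → F} {s : Set E} (hs : IsOpen s) (hf : ContDiffOn ℝ ∞ f s) {a : E} (ha : a ∈ s)
    {f' : E ≃L[ℝ] F} (hf' : HasFDerivAt f (f' : E →L[ℝ] F) a) :
    ∃ Φ : PartialDiffeomorph 𝓘(ℝ, E) 𝓘(ℝ, F) E F ∞, a ∈ Φ.source ∧ Φ.source ⊆ s ∧
      ∀ x, Φ x = f x := by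
  have h0 : (∞ : WithTop ℕ∞) ≠ 0 := by simp
  have hfa : ContDiffAt ℝ ∞ f a := hf.contDiffAt (hs.mem_nhds ha)
  set e := hfa.toOpenPartialHomeomorph f hf' h0 with he
  have hcont : ContinuousOn (fderiv ℝ f) s :=
    (hf.fderiv_of_isOpen (m := 0) hs (by simp)).continuousOn
  set t := s ∩ (fderiv ℝ f) ⁻¹' (range ((↑) : (E ≃L[ℝ] F) → (E →L[ℝ] F))) with ht
  have htopen : IsOpen t := hcont.isOpen_inter_preimage hs (ContinuousLinearEquiv.isOpen)
  have hat : a ∈ t := ⟨ha, f', by rw [hf'.fderiv]⟩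
  set e' := e.restrOpen t htopen with he'
  have hsrc : e'.source = e.source ∩ t := rfl
  refine ⟨{ toPartialEquiv := e'.toPartialEquiv
            open_source := e'.open_source
            open_target := e'.open_target
            contMDiffOn_toFun := ?_
            contMDiffOn_invFun := ?_ }, ?_, ?_, ?_⟩
  · refine contMDiffOn_iff_contDiffOn.2 ?_
    exact hf.mono fun x hx => (hsrc ▸ hx : x ∈ e.source ∩ t).2.1
  · refine contMDiffOn_iff_contDiffOn.2 ?_
    intro y hy
    have hx : e'.symm y ∈ e.source ∩ t := hsrc ▸ e'.map_target hy
    obtain ⟨f₁, hf₁⟩ := hx.2.2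
    have hda : ContDiffAt ℝ ∞ f (e'.symm y) := hf.contDiffAt (hs.mem_nhds hx.2.1)
    have : HasFDerivAt e' (f₁ : E →L[ℝ] F) (e'.symm y) := by
      rw [hf₁]
      exact (hda.differentiableAt h0).hasFDerivAt
    exact (e'.contDiffAt_symm hy this hda).contDiffWithinAt
  · exact ⟨hfa.mem_toOpenPartialHomeomorph_source hf' h0, hat⟩
  · exact fun x hx => hx.2.1
  · exact fun x => rfl

section Manifold

variable {EA HA A EB HB B : Type*} [NormedAddCommGroup EA] [NormedSpace ℝ EA]
  [TopologicalSpace HA] {I : ModelWithCorners ℝ EA HA} [I.Boundaryless]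
  [TopologicalSpace A] [ChartedSpace HA A]
  [NormedAddCommGroup EB] [NormedSpace ℝ EB]
  [TopologicalSpace HB] {J : ModelWithCorners ℝ EB HB} [J.Boundaryless]
  [TopologicalSpace B] [ChartedSpace HB B]

/-- The extended chart at a point of a boundaryless manifold, as a partial diffeomorphism. -/
noncomputable def extChartPartialDiffeomorph (I : ModelWithCorners ℝ EA HA) [I.Boundaryless]
    [IsManifold I ∞ A] (a : A) : PartialDiffeomorph I 𝓘(ℝ, EA) A EA ∞ where
  toPartialEquiv := extChartAt I a
  open_source := isOpen_extChartAt_source a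
  open_target := isOpen_extChartAt_target a
  contMDiffOn_toFun := by
    rw [extChartAt_source]
    exact contMDiffOn_extChartAt
  contMDiffOn_invFun := contMDiffOn_extChartAt_symm a

/-- The inverse function theorem for manifolds without boundary. -/
theorem isLocalDiffeomorphAt_of_bijective_mfderiv [IsManifold I ∞ A] [IsManifold J ∞ B]
    [CompleteSpace EA] [CompleteSpace EB] {f : A → B} {s : Set A} (hs : IsOpen s)
    (hf : ContMDiffOn I J ∞ f s) {a : A} (ha : a ∈ s) (hb : Bijective (mfderiv I J f a)) :
    IsLocalDiffeomorphAt I J ∞ f a := by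
  set cA := extChartPartialDiffeomorph I a with hcA
  set cB := extChartPartialDiffeomorph J (f a) with hcB
  have haA : a ∈ cA.source := mem_extChartAt_source a
  have haB : f a ∈ cB.source := mem_extChartAt_source (f a)
  set F : EA → EB := fun z => cB (f (cA.symm z)) with hF
  set s' : Set A := s ∩ f ⁻¹' cB.source with hs'
  have hs'o : IsOpen s' := hf.continuousOn.isOpen_inter_preimage hs cB.open_source
  set W := cA.target ∩ cA.symm ⁻¹' s' with hW
  have hWo : IsOpen W :=
    cA.symm.contMDiffOn.continuousOn.isOpen_inter_preimage cA.open_target hs'o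
  have haW : cA a ∈ W := by
    refine ⟨cA.map_source haA, ?_⟩
    have : cA.symm (cA a) = a := cA.left_inv haA
    simp only [mem_preimage, this]
    exact ⟨ha, haB⟩
  have hFs : ContDiffOn ℝ ∞ F W := by
    refine contMDiffOn_iff_contDiffOn.1 ?_
    refine cB.contMDiffOn.comp (t := cB.source) ?_ (fun z hz => hz.2.2)
    exact hf.comp (t := s) (cA.symm.contMDiffOn.mono fun z hz => hz.1) (fun z hz => hz.2.1)
  have hmd : MDifferentiableAt I J f a :=
    (hf.contMDiffAt (hs.mem_nhds ha)).mdifferentiableAt (by simp)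
  let D : EA →L[ℝ] EB := mfderiv I J f a
  have hD : Bijective D := hb
  have hder : HasFDerivAt F D (cA a) := by
    have : HasFDerivWithinAt F D (range I) (cA a) := hmd.hasMFDerivAt.2
    rwa [I.range_eq_univ, hasFDerivWithinAt_univ] at this
  let f' : EA ≃L[ℝ] EB := ContinuousLinearEquiv.ofBijective D
    (LinearMap.ker_eq_bot.2 hD.1) (LinearMap.range_eq_top.2 hD.2)
  obtain ⟨Φ, haΦ, hΦW, hΦ⟩ := exists_partialDiffeomorph_of_hasFDerivAt hWo hFs haW (f' := f') hder
  refine ⟨(cA.trans Φ).trans cB.symm, ?_, ?_⟩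
  · refine ⟨⟨haA, haΦ⟩, ?_⟩
    change Φ (cA a) ∈ cB.target
    rw [hΦ]
    have : cA.symm (cA a) = a := cA.left_inv haA
    simp only [hF, this]
    exact cB.map_source haB
  · rintro x ⟨⟨hx1, hx2⟩, hx3⟩
    have hxx : cA.symm (cA x) = x := cA.left_inv hx1
    have h4 : f x ∈ cB.source := by
      have := (hΦW hx2).2.2
      change f (cA.symm (cA x)) ∈ cB.source at this
      rwa [hxx] at this
    change f x = cB.symm (Φ (cA x))
    rw [hΦ]
    simp only [hF, hxx]
    exact (cB.left_inv h4).symm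

/-- An immersion at `a` has a local left inverse that is smooth at the image of `a`. -/
theorem exists_smooth_leftInverse_of_injective_mfderiv [IsManifold I ∞ A] [IsManifold J ∞ B]
    [FiniteDimensional ℝ EA] [FiniteDimensional ℝ EB] {f : A → B}
    (hf : ContMDiff I J ∞ f) {a : A} (hi : Injective (mfderiv I J f a)) :
    ∃ ρ : B → A, ContMDiffAt J I ∞ ρ (f a) ∧ ∀ᶠ x in 𝓝 a, ρ (f x) = x := by
  set cB := extChartPartialDiffeomorph J (f a) with hcB
  have haB : f a ∈ cB.source := mem_extChartAt_source (f a)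
  let D₁ : EA →L[ℝ] EB := mfderiv I J f a
  let D₂ : EB →L[ℝ] EB := mfderiv J 𝓘(ℝ, EB) cB (f a)
  have hD₁ : Injective D₁ := hi
  have hD₂ : Injective D₂ :=
    ((PartialDiffeomorph.isLocalDiffeomorphAt J 𝓘(ℝ, EB) ∞ cB
      haB).mfderivToContinuousLinearEquiv (by simp)).injective
  obtain ⟨L, hL⟩ := LinearMap.exists_leftInverse_of_injective (D₂.comp D₁).toLinearMap
    (LinearMap.ker_eq_bot.2 (hD₂.comp hD₁))
  let L' : EB →L[ℝ] EA := L.toContinuousLinearMap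
  set π : B → EA := fun y => L' (cB y) with hπ
  have hπs : ContMDiffOn J 𝓘(ℝ, EA) ∞ π cB.source :=
    L'.contMDiff.comp_contMDiffOn cB.contMDiffOn
  set s : Set A := f ⁻¹' cB.source with hs
  have hso : IsOpen s := cB.open_source.preimage hf.continuous
  have hg : ContMDiffOn I 𝓘(ℝ, EA) ∞ (π ∘ f) s :=
    hπs.comp hf.contMDiffOn (fun x hx => hx)
  have hcd : MDifferentiableAt J 𝓘(ℝ, EB) cB (f a) :=
    (cB.contMDiffOn.contMDiffAt (cB.open_source.mem_nhds haB)).mdifferentiableAt (by simp)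
  have hfd : MDifferentiableAt I J f a := hf.contMDiffAt.mdifferentiableAt (by simp)
  have hder : mfderiv I 𝓘(ℝ, EA) (π ∘ f) a = ContinuousLinearMap.id ℝ EA := by
    have h1 : HasMFDerivAt I 𝓘(ℝ, EA) (π ∘ f) a
        ((L'.comp D₂).comp D₁) := by
      refine HasMFDerivAt.comp a ?_ hfd.hasMFDerivAt
      exact HasMFDerivAt.comp (f a) (L'.hasMFDerivAt) hcd.hasMFDerivAt
    rw [h1.mfderiv]
    ext v
    exact LinearMap.congr_fun hL v
  have hloc : IsLocalDiffeomorphAt I 𝓘(ℝ, EA) ∞ (π ∘ f) a := by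
    refine isLocalDiffeomorphAt_of_bijective_mfderiv hso hg haB ?_
    rw [hder]
    exact bijective_id
  obtain ⟨Φ, haΦ, hΦ⟩ := hloc
  refine ⟨fun y => Φ.symm (π y), ?_, ?_⟩
  · have h1 : ContMDiffAt J 𝓘(ℝ, EA) ∞ π (f a) := hπs.contMDiffAt (cB.open_source.mem_nhds haB)
    have h3 : π (f a) = Φ a := hΦ haΦ
    have h2 : ContMDiffAt 𝓘(ℝ, EA) I ∞ Φ.symm (π (f a)) := by
      rw [h3]
      exact Φ.symm.contMDiffOn.contMDiffAt (Φ.open_target.mem_nhds (Φ.map_source haΦ))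
    exact h2.comp (f a) h1
  · filter_upwards [Φ.open_source.mem_nhds haΦ] with x hx
    have h3 : π (f x) = Φ x := hΦ hx
    rw [h3]
    exact Φ.left_inv hx

omit [I.Boundaryless] in
/-- The inclusion of an open subset is a local diffeomorphism. -/
theorem isLocalDiffeomorph_opens_val [IsManifold I ∞ A] (U : TopologicalSpace.Opens A) :
    IsLocalDiffeomorph I I ∞ (Subtype.val : U → A) := by
  intro x
  classical
  refine ⟨{ toFun := Subtype.val
            invFun := fun y => if h : y ∈ U then ⟨y, h⟩ else x
            source := univ
            target := U
            map_source' := fun y _ => y.2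
            map_target' := fun _ _ => mem_univ _
            left_inv' := fun y _ => by simp
            right_inv' := fun y hy => by
              have : y ∈ U := hy
              simp [this]
            open_source := isOpen_univ
            open_target := U.isOpen
            contMDiffOn_toFun := contMDiff_subtype_val.contMDiffOn
            contMDiffOn_invFun := ?_ }, mem_univ _, fun _ _ => rfl⟩
  intro y hy
  rw [← ContMDiffWithinAt.subtypeVal_comp_iff]
  refine (contMDiffWithinAt_id (x := y)).congr (fun z hz => ?_) ?_
  · have : z ∈ U := hz
    simp [this]
  · have : y ∈ U := hy
    simp [this]

omit [I.Boundaryless] [J.Boundaryless] in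
theorem injective_mfderiv_of_isLocalDiffeomorphAt {f : A → B} {a : A}
    (h : IsLocalDiffeomorphAt I J ∞ f a) : Injective (mfderiv I J f a) :=
  (h.mfderivToContinuousLinearEquiv (by simp)).injective

end Manifold

theorem IsLocalDiffeomorphAt.map_nhds_eq {EA HA A EB HB B : Type*} [NormedAddCommGroup EA]
    [NormedSpace ℝ EA] [TopologicalSpace HA] {I : ModelWithCorners ℝ EA HA}
    [TopologicalSpace A] [ChartedSpace HA A] [NormedAddCommGroup EB] [NormedSpace ℝ EB]
    [TopologicalSpace HB] {J : ModelWithCorners ℝ EB HB} [TopologicalSpace B] [ChartedSpace HB B]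
    {f : A → B} {a : A} (h : IsLocalDiffeomorphAt I J ∞ f a) : map f (𝓝 a) = 𝓝 (f a) := by
  obtain ⟨Φ, ha, hΦ⟩ := h
  rw [hΦ ha, map_congr (eventuallyEq_of_mem (Φ.open_source.mem_nhds ha) hΦ)]
  exact Φ.toOpenPartialHomeomorph.map_nhds_eq ha

/-! ### Injectivity of derivatives of maps to products -/

theorem injective_mfderiv_prodMk {E₀ H₀ X E₁ H₁ Y E₂ H₂ Z : Type*}
    [NormedAddCommGroup E₀] [NormedSpace ℝ E₀] [TopologicalSpace H₀]
    {I₀ : ModelWithCorners ℝ E₀ H₀} [TopologicalSpace X] [ChartedSpace H₀ X]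
    [NormedAddCommGroup E₁] [NormedSpace ℝ E₁] [TopologicalSpace H₁]
    {I₁ : ModelWithCorners ℝ E₁ H₁} [TopologicalSpace Y] [ChartedSpace H₁ Y]
    [NormedAddCommGroup E₂] [NormedSpace ℝ E₂] [TopologicalSpace H₂]
    {I₂ : ModelWithCorners ℝ E₂ H₂} [TopologicalSpace Z] [ChartedSpace H₂ Z]
    {f₁ : X → Y} {f₂ : X → Z} {x : X} (h₁ : MDifferentiableAt I₀ I₁ f₁ x)
    (h₂ : MDifferentiableAt I₀ I₂ f₂ x) (h : Injective (mfderiv I₀ I₂ f₂ x)) :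
    Injective (mfderiv I₀ (I₁.prod I₂) (fun x => (f₁ x, f₂ x)) x) := by
  rw [(h₁.hasMFDerivAt.prodMk h₂.hasMFDerivAt).mfderiv]
  intro a b hab
  exact h (congrArg (Prod.snd : E₁ × E₂ → E₂) hab)

theorem injective_mfderiv_prodMap_id {EG HG G EA HA A EB HB B : Type*} [NormedAddCommGroup EG]
    [NormedSpace ℝ EG] [TopologicalSpace HG] {I₀ : ModelWithCorners ℝ EG HG}
    [TopologicalSpace G] [ChartedSpace HG G] [NormedAddCommGroup EA]
    [NormedSpace ℝ EA] [TopologicalSpace HA] {I : ModelWithCorners ℝ EA HA}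
    [TopologicalSpace A] [ChartedSpace HA A] [NormedAddCommGroup EB] [NormedSpace ℝ EB]
    [TopologicalSpace HB] {J : ModelWithCorners ℝ EB HB} [TopologicalSpace B] [ChartedSpace HB B]
    {κ : A → B} {z : G × A} (hκ : MDifferentiableAt I J κ z.2) (h : Injective (mfderiv I J κ z.2)) :
    Injective (mfderiv (I₀.prod I) (I₀.prod J) (Prod.map (id : G → G) κ) z) := by
  rw [mfderiv_prodMap mdifferentiableAt_id hκ, mfderiv_id]
  intro a b hab
  have h2 := congrArg (Prod.fst : EG × EB → EG) hab
  have h3 := congrArg (Prod.snd : EG × EB → EB) hab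
  exact Prod.ext h2 (h h3)

/-! ### Images of immersions as embedded submanifolds -/

/-- If `F` is an immersion at `a` with values in `S`, and maps every neighbourhood of `a` onto a
neighbourhood of `F a` in `S`, then `S` is a linear subspace in a suitable chart at `F a`. -/
theorem exists_chart_of_immersion {EA HA A EB HB B : Type*} [NormedAddCommGroup EA]
    [NormedSpace ℝ EA] [FiniteDimensional ℝ EA]
    [TopologicalSpace HA] {I : ModelWithCorners ℝ EA HA} [I.Boundaryless]
    [TopologicalSpace A] [ChartedSpace HA A] [IsManifold I ∞ A]
    [NormedAddCommGroup EB] [NormedSpace ℝ EB] [FiniteDimensional ℝ EB]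
    [TopologicalSpace HB] {J : ModelWithCorners ℝ EB HB} [J.Boundaryless]
    [TopologicalSpace B] [ChartedSpace HB B] [IsManifold J ∞ B]
    {F : A → B} (hF : ContMDiff I J ∞ F) {a : A} (hi : Injective (mfderiv I J F a))
    {S : Set B} (hS : ∀ z, F z ∈ S)
    (hopen : ∀ V ∈ 𝓝 a, ∀ᶠ y in 𝓝 (F a), y ∈ S → y ∈ F '' V) :
    ∃ e ∈ IsManifold.maximalAtlas J ∞ B, F a ∈ e.source ∧
      ∃ W : Submodule ℝ EB, ∀ y ∈ e.source, y ∈ S ↔ e.extend J y - e.extend J (F a) ∈ W := by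
  set cA := extChartPartialDiffeomorph I a with hcA
  set cB := extChartPartialDiffeomorph J (F a) with hcB
  have haA : a ∈ cA.source := mem_extChartAt_source a
  have haB : F a ∈ cB.source := mem_extChartAt_source (F a)
  set α := cA a with hα
  let D : EA →L[ℝ] EB := mfderiv I J F a
  have hD : Injective D := hi
  obtain ⟨L₀, hL₀⟩ := LinearMap.exists_leftInverse_of_injective D.toLinearMap
    (LinearMap.ker_eq_bot.2 hD)
  let L : EB →L[ℝ] EA := L₀.toContinuousLinearMap
  have hL : ∀ u, L (D u) = u := fun u => LinearMap.congr_fun hL₀ u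
  set f : EA → EB := fun z => cB (F (cA.symm z)) with hf
  have hder : HasFDerivAt f D α := by
    have hmd : MDifferentiableAt I J F a := hF.contMDiffAt.mdifferentiableAt (by simp)
    have : HasFDerivWithinAt f D (range I) α := hmd.hasMFDerivAt.2
    rwa [I.range_eq_univ, hasFDerivWithinAt_univ] at this
  have hsA : cA.symm α = a := cA.left_inv haA
  set O : Set EA := cA.target ∩ cA.symm ⁻¹' (F ⁻¹' cB.source) with hO
  have hOo : IsOpen O := cA.symm.contMDiffOn.continuousOn.isOpen_inter_preimage cA.open_target
    (cB.open_source.preimage hF.continuous)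
  have hfO : ContDiffOn ℝ ∞ f O := by
    refine contMDiffOn_iff_contDiffOn.1 ?_
    refine cB.contMDiffOn.comp (t := cB.source) ?_ (fun z hz => hz.2)
    exact hF.comp_contMDiffOn (cA.symm.contMDiffOn.mono fun z hz => hz.1)
  have hαO : α ∈ O := by
    refine ⟨cA.map_source haA, ?_⟩
    simp only [mem_preimage, hsA]
    exact haB
  -- `Θ` straightens the image: it agrees with `f` along the range of `D`.
  set Θ : EB → EB := fun z => z + f (α + L z) - D (L z) with hΘ
  set W : Set EB := (fun z => α + L z) ⁻¹' O with hW
  have hshift : ContDiff ℝ ∞ (fun z => α + L z) := contDiff_const.add L.contDiff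
  have hWo : IsOpen W := hOo.preimage hshift.continuous
  have hΘW : ContDiffOn ℝ ∞ Θ W := by
    refine (contDiffOn_id.add (hfO.comp hshift.contDiffOn (fun z hz => hz))).sub ?_
    exact (D.contDiff.comp L.contDiff).contDiffOn
  have h0W : (0 : EB) ∈ W := by
    simp only [hW, mem_preimage, map_zero, add_zero]
    exact hαO
  have hΘder : HasFDerivAt Θ ((ContinuousLinearEquiv.refl ℝ EB : EB ≃L[ℝ] EB) : EB →L[ℝ] EB) 0 := by
    have hs : HasFDerivAt (fun z => α + L z) L 0 := L.hasFDerivAt.const_add α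
    have h1 : HasFDerivAt f D ((fun z => α + L z) 0) := by simpa using hder
    have h2 := ((hasFDerivAt_id (𝕜 := ℝ) (0 : EB)).add (h1.comp (0 : EB) hs)).sub
      ((D.comp L).hasFDerivAt (x := (0 : EB)))
    have h3 : ((ContinuousLinearEquiv.refl ℝ EB : EB ≃L[ℝ] EB) : EB →L[ℝ] EB) =
        ContinuousLinearMap.id ℝ EB + D ∘L L - D ∘L L := by
      ext v
      simp
    rw [h3]
    exact h2
  obtain ⟨Φ, h0Φ, hΦW, hΦ⟩ := exists_partialDiffeomorph_of_hasFDerivAt hWo hΘW h0W hΘder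
  have hΘD : ∀ u, Θ (D u) = f (α + u) := by
    intro u
    simp [hΘ, hL]
  have hΘ0 : Φ 0 = cB (F a) := by
    have := hΘD 0
    rw [map_zero, add_zero] at this
    rw [hΦ, this]
    simp only [hf, hsA]
  have hΦFa : Φ.symm (cB (F a)) = 0 := by
    rw [← hΘ0]
    exact Φ.left_inv h0Φ
  -- The chart is `Θ⁻¹` in the coordinates at `F a`.
  set e₀ : OpenPartialHomeomorph B EB :=
    cB.toOpenPartialHomeomorph.trans Φ.symm.toOpenPartialHomeomorph with he₀
  set e₁ : OpenPartialHomeomorph B HB :=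
    e₀.trans J.toHomeomorph.symm.toOpenPartialHomeomorph with he₁
  have he₁mem : e₁ ∈ IsManifold.maximalAtlas J ∞ B := by
    refine e₁.mem_maximalAtlas_of_contMDiffOn ?_ ?_
    · have h1 : ContMDiffOn J 𝓘(ℝ, EB) ∞ e₀ e₀.source :=
        (cB.trans Φ.symm).contMDiffOn
      have h2 : ContMDiffOn 𝓘(ℝ, EB) J ∞ J.symm univ := by
        have := J.contMDiffOn_symm (n := ∞)
        rwa [J.range_eq_univ] at this
      exact h2.comp (h1.mono fun x hx => hx.1) (fun x _ => mem_univ _)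
    · have h1 : ContMDiffOn 𝓘(ℝ, EB) J ∞ e₀.symm e₀.target :=
        (cB.trans Φ.symm).symm.contMDiffOn
      exact h1.comp J.contMDiff.contMDiffOn (fun x hx => hx.2)
  set N : Set A := cA.source ∩ {x | D (cA x - α) ∈ Φ.source} with hN
  have hNa : N ∈ 𝓝 a := by
    refine inter_mem (cA.open_source.mem_nhds haA) ?_
    have hc : ContinuousAt (fun x => D (cA x - α)) a := by
      have : ContinuousAt cA a :=
        cA.contMDiffOn.continuousOn.continuousAt (cA.open_source.mem_nhds haA)
      exact D.continuous.continuousAt.comp (this.sub continuousAt_const)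
    refine hc.preimage_mem_nhds (Φ.open_source.mem_nhds ?_)
    simpa [hα] using h0Φ
  obtain ⟨V, hV, hVo, hVa⟩ := _root_.eventually_nhds_iff.1 (hopen N hNa)
  have hext : ∀ y, (e₁.restr V).extend J y = Φ.symm (cB y) := by
    intro y
    change J (J.symm (Φ.symm (cB y))) = _
    exact J.right_inv (by rw [J.range_eq_univ]; exact mem_univ _)
  refine ⟨e₁.restr V, restr_mem_maximalAtlas _ he₁mem hVo, ?_, LinearMap.range D.toLinearMap, ?_⟩
  · rw [OpenPartialHomeomorph.restr_source, hVo.interior_eq]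
    refine ⟨⟨⟨haB, ?_⟩, mem_univ _⟩, hVa⟩
    change cB (F a) ∈ Φ.target
    rw [← hΘ0]
    exact Φ.map_source h0Φ
  · intro y hy
    rw [OpenPartialHomeomorph.restr_source, hVo.interior_eq] at hy
    obtain ⟨⟨⟨hyB, hyΦ⟩, -⟩, hyV⟩ := hy
    change cB y ∈ Φ.target at hyΦ
    rw [hext, hext, hΦFa, sub_zero]
    constructor
    · intro hyS
      obtain ⟨x, ⟨hxA, hxΦ⟩, rfl⟩ := hV y hyV hyS
      refine ⟨cA x - α, ?_⟩
      have h1 : cB (F x) = Φ (D (cA x - α)) := by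
        rw [hΦ, hΘD, add_sub_cancel]
        have : cA.symm (cA x) = x := cA.left_inv hxA
        simp only [hf, this]
      rw [h1]
      exact (Φ.left_inv hxΦ).symm
    · rintro ⟨u, hu⟩
      change D u = _ at hu
      have h1 : D u ∈ Φ.source := hu ▸ Φ.map_target hyΦ
      have h2 : Φ (D u) = cB y := by
        rw [hu]
        exact Φ.right_inv hyΦ
      have h3 : α + u ∈ O := by
        have := hΦW h1
        simpa [hW, hL] using this
      rw [hΦ, hΘD] at h2
      have h4 : F (cA.symm (α + u)) = y := cB.injOn h3.2 hyB h2
      rw [← h4]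
      exact hS _

/-! ### Local structure of the tube around a slice disc -/

/-- A finite subgroup is discrete: its elements close to `1` are equal to `1`. -/
theorem Subgroup.eventually_mem_imp_eq_one {G : Type*} [Group G] [TopologicalSpace G] [T1Space G]
    (H : Subgroup G) [Finite H] : ∀ᶠ g in 𝓝 (1 : G), g ∈ H → g = 1 := by
  have hf : ((H : Set G) \ {1}).Finite := (Set.toFinite (H : Set G)).subset sdiff_subset
  filter_upwards [hf.isClosed.isOpen_compl.mem_nhds (fun h => h.2 rfl)] with g hg hgH
  by_contra h
  exact hg ⟨hgH, h⟩

theorem Subgroup.eq_of_continuous_of_mem {G : Type*} [Group G] [TopologicalSpace G] [T1Space G]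
    (H : Subgroup G) [Finite H] {X : Type*} [TopologicalSpace X] [PreconnectedSpace X]
    {f : X → G} (hf : Continuous f) (hmem : ∀ x, f x ∈ H) (x y : X) : f x = f y := by
  have : DiscreteTopology (H : Set G) := Finite.instDiscreteTopology
  exact isPreconnected_univ.constant_of_mapsTo (T := (H : Set G)) ⟨this⟩ hf.continuousOn
    (fun x _ => hmem x) (mem_univ x) (mem_univ y)

instance disc_preconnectedSpace (E : Type) [NormedAddCommGroup E] [NormedSpace ℝ E] (r : ℝ) :
    PreconnectedSpace (disc E r) :=
  isPreconnected_iff_preconnectedSpace.1 (convex_ball (0 : E) r).isPreconnected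

theorem discMap_continuous {E : Type} [NormedAddCommGroup E] [InnerProductSpace ℝ E] {r : ℝ}
    (A : E ≃ₗᵢ[ℝ] E) : Continuous (discMap A : disc E r → disc E r) :=
  (A.continuous.comp continuous_subtype_val).subtype_mk _

namespace SliceDisc

variable {EG EN HN : Type*} [NormedAddCommGroup EG] [NormedSpace ℝ EG] [FiniteDimensional ℝ EG]
  [NormedAddCommGroup EN] [NormedSpace ℝ EN] [FiniteDimensional ℝ EN]
  [TopologicalSpace HN] {IN : ModelWithCorners ℝ EN HN} [IN.Boundaryless]
  {G N P : Type*} [Group G] [TopologicalSpace G] [T2Space G]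
  [ChartedSpace EG G] [LieGroup 𝓘(ℝ, EG) ∞ G]
  [TopologicalSpace N] [ChartedSpace HN N] [IsManifold IN ∞ N]
  [TopologicalSpace P] [MulAction G P] {j : P → N}

section

variable (s : SliceDisc (G := G) 𝓘(ℝ, EG) IN j)

/-- The tube map `G × U → P`, `(g, x) ↦ g x`, of a slice disc `U`. -/
def tube (z : G × disc s.E s.radius) : P := z.1 • s.slice z.2

omit [FiniteDimensional ℝ EG] [FiniteDimensional ℝ EN] [IN.Boundaryless] [T2Space G]
  [LieGroup 𝓘(ℝ, EG) ∞ G] [IsManifold IN ∞ N]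

theorem smul_slice_eq_iff {g : G} {x y : disc s.E s.radius} :
    g • s.slice x = s.slice y ↔
      ∃ γ : MulAction.stabilizer G s.pt, (γ : G) = g ∧ discMap (s.rep γ) x = y := by
  constructor
  · intro h
    obtain ⟨γ, h1, h2⟩ := (s.tube_eq_iff g 1 x y).1 (by rw [h, one_smul])
    exact ⟨γ, (mul_inv_eq_one.1 h1.symm).symm, h2.symm⟩
  · rintro ⟨γ, rfl, rfl⟩
    exact (s.slice_equivariant γ x).symm

theorem slice_injective : Injective s.slice := by
  intro x y h
  obtain ⟨γ, h1, h2⟩ := s.smul_slice_eq_iff.1 (show (1 : G) • s.slice x = s.slice y by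
    rw [one_smul, h])
  have : γ = 1 := Subtype.ext h1
  subst this
  rw [← h2, map_one]
  rfl

theorem slice_origin : s.slice s.origin = s.pt := s.slice_zero

theorem discMap_origin (γ : MulAction.stabilizer G s.pt) :
    discMap (s.rep γ) s.origin = s.origin :=
  Subtype.ext (map_zero (s.rep γ))

variable (hj : IsInducing j)
include hj

theorem continuous_tube : Continuous s.tube :=
  hj.continuous_iff.2 s.tube_contMDiff.continuous

theorem continuous_slice : Continuous s.slice := by
  have h : Continuous (fun x : disc s.E s.radius => s.tube (1, x)) :=
    (s.continuous_tube hj).comp (by fun_prop)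
  simpa [tube] using h

end

section

omit [FiniteDimensional ℝ EG] [FiniteDimensional ℝ EN] [IN.Boundaryless] [IsManifold IN ∞ N]

/-- Since the isotropy group is discrete in `G`, the tube map is a local homeomorphism. -/
theorem isLocalHomeomorph_tube (s : SliceDisc (G := G) 𝓘(ℝ, EG) IN j) (hj : IsInducing j)
    [Finite (MulAction.stabilizer G s.pt)] : IsLocalHomeomorph s.tube := by
  have : IsTopologicalGroup G := topologicalGroup_of_lieGroup 𝓘(ℝ, EG) ∞
  refine IsLocalHomeomorph.mk _ fun z₀ => ?_
  have h1 : ∀ᶠ w : G × G in 𝓝 (z₀.1, z₀.1),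
      w.2⁻¹ * w.1 ∈ MulAction.stabilizer G s.pt → w.2⁻¹ * w.1 = 1 := by
    have hc : Tendsto (fun w : G × G => w.2⁻¹ * w.1) (𝓝 (z₀.1, z₀.1)) (𝓝 1) := by
      have : Continuous (fun w : G × G => w.2⁻¹ * w.1) := by fun_prop
      simpa using this.tendsto (z₀.1, z₀.1)
    exact hc.eventually (MulAction.stabilizer G s.pt).eventually_mem_imp_eq_one
  rw [nhds_prod_eq] at h1
  obtain ⟨V, hV, hVV⟩ := (Filter.eventually_prod_self_iff (r := fun a b : G =>
    b⁻¹ * a ∈ MulAction.stabilizer G s.pt → b⁻¹ * a = 1)).1 h1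
  obtain ⟨V', hV'V, hV'o, hzV'⟩ := mem_nhds_iff.1 hV
  have hinj : InjOn s.tube (V' ×ˢ univ) := by
    rintro ⟨g, x⟩ hg ⟨h, y⟩ hh heq
    obtain ⟨γ, h1, h2⟩ := (s.tube_eq_iff g h x y).1 heq
    have h3 : h⁻¹ * g = γ := by rw [h1]; group
    have h4 : h⁻¹ * g = 1 := hVV g (hV'V hg.1) h (hV'V hh.1) (h3 ▸ γ.2)
    have h5 : γ = 1 := Subtype.ext (h3.symm.trans h4)
    subst h5
    rw [map_one] at h2
    refine Prod.ext ?_ ?_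
    · simpa using h1.symm
    · exact h2.symm
  have : Nonempty (G × disc s.E s.radius) := ⟨z₀⟩
  refine ⟨OpenPartialHomeomorph.ofContinuousOpen hinj.toPartialEquiv
    (s.continuous_tube hj).continuousOn s.tube_isOpenMap (hV'o.prod isOpen_univ),
    ⟨hzV', mem_univ _⟩, fun _ _ => rfl⟩

end

omit [T2Space G] in
/-- A continuous lift through the tube map of a smooth map is smooth. -/
theorem contMDiffAt_of_tube (s : SliceDisc (G := G) 𝓘(ℝ, EG) IN j) {EX HX X : Type*}
    [NormedAddCommGroup EX]
    [NormedSpace ℝ EX] [TopologicalSpace HX] {IX : ModelWithCorners ℝ EX HX} [TopologicalSpace X]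
    [ChartedSpace HX X] {z : X → G × disc s.E s.radius} {x₀ : X} (hz : ContinuousAt z x₀)
    (h : ContMDiffAt IX IN ∞ (fun x => j (s.tube (z x))) x₀) :
    ContMDiffAt IX (𝓘(ℝ, EG).prod 𝓘(ℝ, s.E)) ∞ z x₀ := by
  obtain ⟨ρ, hρ, hρ'⟩ := exists_smooth_leftInverse_of_injective_mfderiv s.tube_contMDiff
    (s.tube_immersion (z x₀))
  -- Near `x₀`, the lift is the composite of `x ↦ j (s.tube (z x))` with a left inverse of the tube.
  have h1 : (fun x => ρ (j (s.tube (z x)))) =ᶠ[𝓝 x₀] z := hz.eventually hρ'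
  exact (ContMDiffAt.comp x₀ hρ h).congr_of_eventuallyEq h1.symm

/-! ### Transition maps between slice discs -/

variable (s t : SliceDisc (G := G) 𝓘(ℝ, EG) IN j)

/-- A map `ψ` from one slice disc to another of the form `ψ(x) = f(x) x`, where `f` is a
continuous `G`-valued function. -/
structure IsTransition (f : disc s.E s.radius → G) (ψ : disc s.E s.radius → disc t.E t.radius) :
    Prop where
  continuous_fun : Continuous f
  slice_apply : ∀ x, t.slice (ψ x) = f x • s.slice x

namespace IsTransition

variable {s t} {f : disc s.E s.radius → G} {ψ : disc s.E s.radius → disc t.E t.radius}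

section

omit [FiniteDimensional ℝ EG] [FiniteDimensional ℝ EN] [IN.Boundaryless] [IsManifold IN ∞ N]

/-- A local inverse of the tube map of `t` writes `ψ(x)` as `a y` with `a` close to `1`. Then `a` is
an element of the finite isotropy group, so `a = 1` and `ψ(x) = y`, which is continuous in `x`. -/
protected theorem continuous [ContinuousSMul G P] (h : IsTransition s t f ψ) (hj : IsInducing j)
    [Finite (MulAction.stabilizer G t.pt)] : Continuous ψ := by
  refine continuous_iff_continuousAt.2 fun x₀ => ?_
  obtain ⟨e, he, het⟩ := t.isLocalHomeomorph_tube hj (1, ψ x₀)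
  have h1 : (fun x => t.slice (ψ x)) = fun x => f x • s.slice x := funext h.slice_apply
  have hc : Continuous fun x => t.slice (ψ x) := by
    rw [h1]
    exact h.continuous_fun.smul (s.continuous_slice hj)
  have h2 : t.slice (ψ x₀) = e (1, ψ x₀) := by rw [← het]; simp [tube]
  have h3 : e.symm (t.slice (ψ x₀)) = (1, ψ x₀) := by rw [h2]; exact e.left_inv he
  have htgt : t.slice (ψ x₀) ∈ e.target := h2 ▸ e.map_source he
  have hsymm : ContinuousAt (fun x => e.symm (t.slice (ψ x))) x₀ :=
    (e.continuousAt_symm htgt).comp (f := fun x => t.slice (ψ x)) hc.continuousAt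
  have h4 : ∀ᶠ x in 𝓝 x₀, (e.symm (t.slice (ψ x))).1 ∈ MulAction.stabilizer G t.pt →
      (e.symm (t.slice (ψ x))).1 = 1 := by
    have : Tendsto (fun x => (e.symm (t.slice (ψ x))).1) (𝓝 x₀) (𝓝 1) := by
      have := hsymm.fst.tendsto
      rwa [h3] at this
    exact this.eventually (MulAction.stabilizer G t.pt).eventually_mem_imp_eq_one
  have h5 : (fun x => (e.symm (t.slice (ψ x))).2) =ᶠ[𝓝 x₀] ψ := by
    filter_upwards [h4, hc.continuousAt.eventually (e.open_target.mem_nhds htgt)] with x hx1 hx2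
    have h6 : t.tube (e.symm (t.slice (ψ x))) = t.slice (ψ x) := by
      rw [het]
      exact e.right_inv hx2
    obtain ⟨γ, h7, h8⟩ := t.smul_slice_eq_iff.1 h6
    have h9 : γ = 1 := Subtype.ext (h7.trans (hx1 (h7 ▸ γ.2)))
    rw [h9, map_one] at h8
    exact h8
  exact hsymm.snd.congr h5

/-- A transition map is equivariant with respect to the homomorphism
`γ ↦ f(0) γ f(0)⁻¹`, because `x ↦ f(γ x) γ f(x)⁻¹` takes values in the finite isotropy group. -/
theorem apply_discMap [ContinuousSMul G P] (h : IsTransition s t f ψ)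
    [Finite (MulAction.stabilizer G t.pt)] (γ : MulAction.stabilizer G s.pt)
    (x : disc s.E s.radius) :
    f (discMap (s.rep γ) x) * γ = f s.origin * γ * (f s.origin)⁻¹ * f x := by
  have : IsTopologicalGroup G := topologicalGroup_of_lieGroup 𝓘(ℝ, EG) ∞
  have hc : Continuous fun x => f (discMap (s.rep γ) x) * γ * (f x)⁻¹ :=
    ((h.continuous_fun.comp (discMap_continuous _)).mul continuous_const).mul
      h.continuous_fun.inv
  have hm : ∀ x, f (discMap (s.rep γ) x) * γ * (f x)⁻¹ ∈ MulAction.stabilizer G t.pt := by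
    intro x
    have : (f (discMap (s.rep γ) x) * γ * (f x)⁻¹) • t.slice (ψ x) =
        t.slice (ψ (discMap (s.rep γ) x)) := by
      rw [h.slice_apply, h.slice_apply, s.slice_equivariant, smul_smul, smul_smul]
      congr 1
      group
    obtain ⟨δ, h1, -⟩ := t.smul_slice_eq_iff.1 this
    exact h1 ▸ δ.2
  have := Subgroup.eq_of_continuous_of_mem _ hc hm x s.origin
  simp only [s.discMap_origin] at this
  rw [← this]
  group

protected theorem injective [ContinuousSMul G P] (h : IsTransition s t f ψ)
    [Finite (MulAction.stabilizer G t.pt)] : Injective ψ := by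
  intro x y hxy
  have h1 : f x • s.slice x = f y • s.slice y := by
    rw [← h.slice_apply, ← h.slice_apply, hxy]
  obtain ⟨γ, h2, h3⟩ := (s.tube_eq_iff _ _ _ _).1 h1
  have h4 := h.apply_discMap γ x
  rw [← h3, h2, inv_mul_cancel_right] at h4
  have h5 : (γ : G) = 1 := by
    have h6 : f s.origin * γ * (f s.origin)⁻¹ = 1 := mul_eq_right.1 h4.symm
    rwa [conj_eq_one_iff] at h6
  have h7 : γ = 1 := Subtype.ext h5
  rw [h3, h7, map_one]
  rfl

end

/-- The continuous map `x ↦ (f(x)⁻¹, ψ(x))` lifts the slice map of `s` through the tube map of `t`,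
so it is smooth by `contMDiffAt_of_tube`. -/
protected theorem contMDiff [ContinuousSMul G P] (h : IsTransition s t f ψ) (hj : IsInducing j)
    [Finite (MulAction.stabilizer G t.pt)] : ContMDiff 𝓘(ℝ, s.E) 𝓘(ℝ, t.E) ∞ ψ := by
  have : IsTopologicalGroup G := topologicalGroup_of_lieGroup 𝓘(ℝ, EG) ∞
  intro x₀
  have hz : ContinuousAt (fun x => ((f x)⁻¹, ψ x)) x₀ :=
    (h.continuous_fun.inv.prodMk (h.continuous hj)).continuousAt
  have h1 : (fun x => j (t.tube ((f x)⁻¹, ψ x))) = fun x => j (s.tube (1, x)) := by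
    funext x
    simp [tube, h.slice_apply]
  have h2 : ContMDiff 𝓘(ℝ, s.E) IN ∞ fun x => j (s.tube (1, x)) :=
    s.tube_contMDiff.comp (contMDiff_const.prodMk contMDiff_id)
  exact (t.contMDiffAt_of_tube hz (h1 ▸ h2 x₀)).snd

/-- Transition maps are local diffeomorphisms: a local inverse of `ψ` is the slice component of a
local inverse of the tube map of `s`. -/
theorem isLocalDiffeomorph [ContinuousSMul G P] (h : IsTransition s t f ψ) (hj : IsInducing j)
    [Finite (MulAction.stabilizer G s.pt)] [Finite (MulAction.stabilizer G t.pt)] :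
    IsLocalDiffeomorph 𝓘(ℝ, s.E) 𝓘(ℝ, t.E) ∞ ψ := by
  have : IsTopologicalGroup G := topologicalGroup_of_lieGroup 𝓘(ℝ, EG) ∞
  intro x₀
  obtain ⟨e, he, hes⟩ := s.isLocalHomeomorph_tube hj (f x₀, x₀)
  have ht := t.continuous_slice hj
  have h2 : t.slice (ψ x₀) = e (f x₀, x₀) := by rw [← hes, h.slice_apply]; rfl
  have h3 : e.symm (t.slice (ψ x₀)) = (f x₀, x₀) := by rw [h2]; exact e.left_inv he
  -- `z w = (a, x)` solves `a x = w`; the second component is the local inverse of `ψ`.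
  set z : disc t.E t.radius → G × disc s.E s.radius := fun w => e.symm (t.slice w) with hz
  set Ω : Set (disc t.E t.radius) := t.slice ⁻¹' e.target with hΩ
  have hΩo : IsOpen Ω := e.open_target.preimage ht
  have hΩ0 : ψ x₀ ∈ Ω := by
    change t.slice (ψ x₀) ∈ e.target
    exact h2 ▸ e.map_source he
  have hzc : ∀ w ∈ Ω, ContinuousAt z w := fun w hw =>
    (e.continuousAt_symm hw).comp (f := t.slice) ht.continuousAt
  have hzt : ∀ w ∈ Ω, s.tube (z w) = t.slice w := fun w hw => by
    rw [hes]
    exact e.right_inv hw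
  have hzs : ∀ w ∈ Ω, ContMDiffAt 𝓘(ℝ, t.E) (𝓘(ℝ, EG).prod 𝓘(ℝ, s.E)) ∞ z w := by
    intro w hw
    refine s.contMDiffAt_of_tube (hzc w hw) ?_
    have h4 : ContMDiff 𝓘(ℝ, t.E) IN ∞ fun x => j (t.tube (1, x)) :=
      t.tube_contMDiff.comp (contMDiff_const.prodMk contMDiff_id)
    refine (h4 w).congr_of_eventuallyEq ?_
    filter_upwards [hΩo.mem_nhds hw] with v hv
    rw [hzt v hv]
    simp [tube]
  have hzcont : ContinuousOn z Ω := fun w hw => (hzc w hw).continuousWithinAt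
  have hev : ∀ᶠ w in 𝓝 (ψ x₀), f (z w).2 * (z w).1⁻¹ ∈ MulAction.stabilizer G t.pt →
      f (z w).2 * (z w).1⁻¹ = 1 := by
    have : ContinuousAt (fun w => f (z w).2 * (z w).1⁻¹) (ψ x₀) :=
      (ContinuousAt.comp (g := f) h.continuous_fun.continuousAt (hzc _ hΩ0).snd).mul
        (hzc _ hΩ0).fst.inv
    have h5 : f (z (ψ x₀)).2 * (z (ψ x₀)).1⁻¹ = 1 := by
      simp only [hz, h3, mul_inv_cancel]
    have h6 := this.tendsto
    rw [h5] at h6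
    exact h6.eventually (MulAction.stabilizer G t.pt).eventually_mem_imp_eq_one
  obtain ⟨V, hV, hVo, hV0⟩ := _root_.eventually_nhds_iff.1 hev
  have hinv : ∀ w ∈ Ω ∩ V, ψ (z w).2 = w := by
    rintro w ⟨hwΩ, hwV⟩
    have h7 : (f (z w).2 * (z w).1⁻¹) • t.slice w = t.slice (ψ (z w).2) := by
      rw [h.slice_apply, ← hzt w hwΩ, tube, smul_smul, inv_mul_cancel_right]
    obtain ⟨γ, h8, h9⟩ := t.smul_slice_eq_iff.1 h7
    have h10 : γ = 1 := Subtype.ext (h8.trans (hV w hwV (h8 ▸ γ.2)))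
    rw [← h9, h10, map_one]
    rfl
  have hψ := h.continuous hj
  refine ⟨{ toFun := ψ
            invFun := fun w => (z w).2
            source := ψ ⁻¹' (Ω ∩ V)
            target := Ω ∩ V
            map_source' := fun x hx => hx
            map_target' := fun w hw => by
              simp only [mem_preimage, hinv w hw]
              exact hw
            left_inv' := fun x hx => h.injective (hinv _ hx)
            right_inv' := fun w hw => hinv w hw
            open_source := (hΩo.inter hVo).preimage hψ
            open_target := hΩo.inter hVo
            contMDiffOn_toFun := (h.contMDiff hj).contMDiffOn
            contMDiffOn_invFun := fun w hw =>
              (hzs w hw.1).snd.contMDiffWithinAt }, ⟨hΩ0, hV0⟩, fun _ _ => rfl⟩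

end IsTransition

end SliceDisc

/-! ### Restricting a slice disc -/

section AffineDiscMap

variable {E E' : Type} [NormedAddCommGroup E] [InnerProductSpace ℝ E]
  [NormedAddCommGroup E'] [InnerProductSpace ℝ E']
  {r r' : ℝ} {κ : disc E' r' → disc E r} {c : E} {L : E' →L[ℝ] E}

theorem contMDiff_affine_disc (hκ : ∀ v, (κ v : E) = c + L v) :
    ContMDiff 𝓘(ℝ, E') 𝓘(ℝ, E) ∞ κ := by
  rw [← ContMDiff.subtypeVal_comp_iff]
  have h : (Subtype.val ∘ κ) = (fun v => c + L v) ∘ Subtype.val := funext hκ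
  rw [h]
  have h1 : ContMDiff 𝓘(ℝ, E') 𝓘(ℝ, E) ∞ (fun v => c + L v) :=
    contMDiff_iff_contDiff.2 (contDiff_const.add L.contDiff)
  exact h1.comp contMDiff_subtype_val

theorem injective_mfderiv_affine_disc (hκ : ∀ v, (κ v : E) = c + L v) (hL : Injective L)
    (v : disc E' r') : Injective (mfderiv 𝓘(ℝ, E') 𝓘(ℝ, E) κ v) := by
  have h : (Subtype.val ∘ κ) = (fun v => c + L v) ∘ Subtype.val := funext hκ
  have h1 : MDifferentiableAt 𝓘(ℝ, E') 𝓘(ℝ, E) κ v :=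
    (contMDiff_affine_disc hκ).contMDiffAt.mdifferentiableAt (by simp)
  have h2 : MDifferentiableAt 𝓘(ℝ, E) 𝓘(ℝ, E) (Subtype.val : disc E r → E) (κ v) :=
    contMDiff_subtype_val.contMDiffAt.mdifferentiableAt (n := ∞) (by simp)
  have h3 : HasMFDerivAt 𝓘(ℝ, E') 𝓘(ℝ, E) (fun v => c + L v) (v : E') L :=
    (L.hasFDerivAt.const_add c).hasMFDerivAt
  have h4 : MDifferentiableAt 𝓘(ℝ, E') 𝓘(ℝ, E') (Subtype.val : disc E' r' → E') v :=
    contMDiff_subtype_val.contMDiffAt.mdifferentiableAt (n := ∞) (by simp)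
  have h5 := h2.hasMFDerivAt.comp v h1.hasMFDerivAt
  have h6 := h3.comp v h4.hasMFDerivAt
  rw [h] at h5
  have h7 := hasMFDerivAt_unique h5 h6
  have h8 : Injective (mfderiv 𝓘(ℝ, E') 𝓘(ℝ, E') (Subtype.val : disc E' r' → E') v) :=
    injective_mfderiv_of_isLocalDiffeomorphAt (isLocalDiffeomorph_opens_val (disc E' r') v)
  intro a b hab
  refine h8 (hL ?_)
  have ha := DFunLike.congr_fun h7 a
  have hb := DFunLike.congr_fun h7 b
  refine ha.symm.trans (Eq.trans ?_ hb)
  exact congrArg (mfderiv 𝓘(ℝ, E) 𝓘(ℝ, E) (Subtype.val : disc E r → E) (κ v)) hab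

theorem injective_mfderiv_prodMap_affine_disc {EG G : Type*} [NormedAddCommGroup EG]
    [NormedSpace ℝ EG] [TopologicalSpace G] [ChartedSpace EG G]
    (hκ : ∀ v, (κ v : E) = c + L v) (hL : Injective L) (z : G × disc E' r') :
    Injective (mfderiv (𝓘(ℝ, EG).prod 𝓘(ℝ, E')) (𝓘(ℝ, EG).prod 𝓘(ℝ, E))
      (Prod.map (id : G → G) κ) z) :=
  injective_mfderiv_prodMap_id
    ((contMDiff_affine_disc hκ).contMDiffAt.mdifferentiableAt (by simp))
    (injective_mfderiv_affine_disc hκ hL z.2)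

end AffineDiscMap

namespace SliceDisc

variable {EG EN HN : Type*} [NormedAddCommGroup EG] [NormedSpace ℝ EG]
  [NormedAddCommGroup EN] [NormedSpace ℝ EN]
  [TopologicalSpace HN] {IN : ModelWithCorners ℝ EN HN}
  {G N P : Type*} [Group G] [TopologicalSpace G]
  [ChartedSpace EG G]
  [TopologicalSpace N] [ChartedSpace HN N]
  [TopologicalSpace P] [MulAction G P] {j : P → N}
  (s : SliceDisc (G := G) 𝓘(ℝ, EG) IN j)

theorem stabilizer_slice_le (x : disc s.E s.radius) :
    MulAction.stabilizer G (s.slice x) ≤ MulAction.stabilizer G s.pt := by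
  intro g hg
  obtain ⟨γ, rfl, -⟩ := s.smul_slice_eq_iff.1 (MulAction.mem_stabilizer_iff.1 hg)
  exact γ.2

theorem discMap_eq_self_iff {γ : MulAction.stabilizer G s.pt} {x : disc s.E s.radius} :
    discMap (s.rep γ) x = x ↔ (γ : G) ∈ MulAction.stabilizer G (s.slice x) := by
  rw [MulAction.mem_stabilizer_iff, ← s.slice_equivariant]
  exact s.slice_injective.eq_iff.symm

/-- The slice disc of radius `ε` about a point `x` of a slice disc, for a sufficiently small
`ε`. -/
def restrict (x : disc s.E s.radius) (ε : ℝ) (hε : 0 < ε) (κ : disc s.E ε → disc s.E s.radius)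
    (hκ : ∀ v, (κ v : s.E) = x + v)
    (hfix : ∀ γ v w, discMap (s.rep γ) (κ v) = κ w → discMap (s.rep γ) x = x) :
    SliceDisc (G := G) 𝓘(ℝ, EG) IN j where
  pt := s.slice x
  E := s.E
  rep := s.rep.comp (Subgroup.inclusion (s.stabilizer_slice_le x))
  radius := ε
  radius_pos := hε
  slice v := s.slice (κ v)
  slice_zero := by
    congr 1
    exact Subtype.ext ((hκ _).trans (add_zero _))
  slice_equivariant γ v := by
    have hγ := s.discMap_eq_self_iff (γ := Subgroup.inclusion (s.stabilizer_slice_le x) γ).2 γ.2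
    have h := s.slice_equivariant (Subgroup.inclusion (s.stabilizer_slice_le x) γ) (κ v)
    rw [Subgroup.coe_inclusion] at h
    rw [← h]
    congr 1
    refine Subtype.ext ?_
    have h1 : s.rep (Subgroup.inclusion (s.stabilizer_slice_le x) γ) (x : s.E) = x :=
      congrArg Subtype.val hγ
    change (κ (discMap _ v) : s.E) = s.rep _ (κ v : s.E)
    rw [hκ, hκ, map_add, h1]
    rfl
  tube_eq_iff g h v w := by
    rw [s.tube_eq_iff]
    constructor
    · rintro ⟨γ, h1, h2⟩
      have hγ := hfix γ v w h2.symm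
      refine ⟨⟨γ, s.discMap_eq_self_iff.1 hγ⟩, h1, Subtype.ext ?_⟩
      have h3 : s.rep γ (x : s.E) = x := congrArg Subtype.val hγ
      have h4 : (κ w : s.E) = s.rep γ (κ v : s.E) := congrArg Subtype.val h2
      rw [hκ, hκ, map_add, h3] at h4
      exact add_left_cancel h4
    · rintro ⟨γ, h1, h2⟩
      have hγ := s.discMap_eq_self_iff (γ := Subgroup.inclusion (s.stabilizer_slice_le x) γ).2 γ.2
      refine ⟨Subgroup.inclusion (s.stabilizer_slice_le x) γ, h1, Subtype.ext ?_⟩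
      have h3 : s.rep (Subgroup.inclusion (s.stabilizer_slice_le x) γ) (x : s.E) = x :=
        congrArg Subtype.val hγ
      change (κ w : s.E) = s.rep _ (κ v : s.E)
      rw [hκ, hκ, map_add, h3, h2]
      rfl
  tube_contMDiff := by
    have h := contMDiff_affine_disc (L := ContinuousLinearMap.id ℝ s.E) hκ
    exact s.tube_contMDiff.comp (contMDiff_fst.prodMk (h.comp contMDiff_snd))
  tube_immersion z := by
    have h := contMDiff_affine_disc (L := ContinuousLinearMap.id ℝ s.E) hκ
    have h1 : MDifferentiableAt (𝓘(ℝ, EG).prod 𝓘(ℝ, s.E)) (𝓘(ℝ, EG).prod 𝓘(ℝ, s.E))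
        (Prod.map (id : G → G) κ) z :=
      (contMDiff_id.prodMap h).contMDiffAt.mdifferentiableAt (n := ∞) (by simp)
    have h2 : MDifferentiableAt (𝓘(ℝ, EG).prod 𝓘(ℝ, s.E)) IN
        (fun z : G × disc s.E s.radius => j (z.1 • s.slice z.2)) (Prod.map (id : G → G) κ z) :=
      s.tube_contMDiff.contMDiffAt.mdifferentiableAt (by simp)
    have h3 := mfderiv_comp z h2 h1
    change Injective (mfderiv _ _ ((fun z : G × disc s.E s.radius => j (z.1 • s.slice z.2)) ∘
      (Prod.map (id : G → G) κ)) z)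
    rw [h3]
    exact (s.tube_immersion _).comp
      (injective_mfderiv_prodMap_affine_disc (L := ContinuousLinearMap.id ℝ s.E) hκ
        injective_id z)
  tube_isOpenMap := by
    have h1 : IsOpenEmbedding κ := by
      refine IsOpenEmbedding.of_comp (g := (Subtype.val : disc s.E s.radius → s.E)) κ
        (disc s.E s.radius).isOpenEmbedding' ?_
      have h2 : Subtype.val ∘ κ = (Homeomorph.addLeft (x : s.E)) ∘ Subtype.val := funext hκ
      rw [h2]
      exact (Homeomorph.isOpenEmbedding _).comp (disc s.E ε).isOpenEmbedding'
    exact s.tube_isOpenMap.comp (IsOpenMap.id.prodMap h1.isOpenMap)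

/-- A sufficiently small disc about any point of a slice disc is again a slice disc. -/
theorem exists_restrict [Finite (MulAction.stabilizer G s.pt)] (hs : Continuous s.slice)
    (x : disc s.E s.radius) {V : Set P} (hV : V ∈ 𝓝 (s.slice x)) :
    ∃ (u : SliceDisc (G := G) 𝓘(ℝ, EG) IN j) (ψ : disc u.E u.radius → disc s.E s.radius),
      u.pt = s.slice x ∧ ψ u.origin = x ∧ (∀ v, u.slice v = s.slice (ψ v)) ∧
        ∀ v, u.slice v ∈ V := by
  have h1 : ∀ᶠ y in 𝓝 x, s.slice y ∈ V := hs.continuousAt.eventually hV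
  -- The translates of a small neighbourhood of `x` by elements moving `x` are disjoint from it.
  have h2 : ∀ γ, ∀ᶠ p : disc s.E s.radius × disc s.E s.radius in 𝓝 (x, x),
      discMap (s.rep γ) p.1 = p.2 → discMap (s.rep γ) x = x := by
    intro γ
    by_cases hγ : discMap (s.rep γ) x = x
    · exact Eventually.of_forall fun _ _ => hγ
    · have hc : Continuous fun p : disc s.E s.radius × disc s.E s.radius =>
          discMap (s.rep γ) p.1 := (discMap_continuous _).comp continuous_fst
      have ho : IsOpen {p : disc s.E s.radius × disc s.E s.radius |
          discMap (s.rep γ) p.1 ≠ p.2} := isOpen_ne_fun hc continuous_snd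
      filter_upwards [ho.mem_nhds hγ] with p hp hp'
      exact absurd hp' hp
  have h3 := eventually_all.2 h2
  rw [nhds_prod_eq] at h3
  obtain ⟨W, hW, hWW⟩ := (Filter.eventually_prod_self_iff (r := fun a b =>
    ∀ γ, discMap (s.rep γ) a = b → discMap (s.rep γ) x = x)).1 h3
  have h4 : ∀ᶠ y in 𝓝 (x : s.E), ∃ h : y ∈ disc s.E s.radius, (⟨y, h⟩ : disc s.E s.radius) ∈ W ∧
      s.slice ⟨y, h⟩ ∈ V := by
    have := (disc s.E s.radius).isOpenEmbedding'.map_nhds_eq x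
    change map _ (𝓝 x) = 𝓝 (x : s.E) at this
    rw [← this, eventually_map]
    filter_upwards [hW, h1] with y hy1 hy2
    exact ⟨y.2, hy1, hy2⟩
  obtain ⟨ε, hε, hball⟩ := Metric.eventually_nhds_iff.1 h4
  have hb : ∀ v : disc s.E ε, ∃ h : (x : s.E) + v ∈ disc s.E s.radius,
      (⟨x + v, h⟩ : disc s.E s.radius) ∈ W ∧ s.slice ⟨x + v, h⟩ ∈ V := fun v =>
    hball (by simpa using mem_ball_zero_iff.1 v.2)
  choose hb1 hb2 hb3 using hb
  let κ : disc s.E ε → disc s.E s.radius := fun v => ⟨x + v, hb1 v⟩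
  refine ⟨s.restrict x ε hε κ (fun v => rfl) ?_, κ, rfl, ?_, fun v => rfl, hb3⟩
  · intro γ v w h
    exact hWW _ (hb2 v) _ (hb2 w) γ h
  · exact Subtype.ext (add_zero _)

end SliceDisc

/-! ### The orbifold structure of the quotient -/

/-- The orbit relation of a compact group is closed, so the orbit space is Hausdorff. -/
theorem t2Space_orbitRel_quotient (G P : Type*) [Group G] [TopologicalSpace G] [CompactSpace G]
    [TopologicalSpace P] [T2Space P] [MulAction G P] [ContinuousSMul G P] :
    T2Space (MulAction.orbitRel.Quotient G P) := by
  refine (t2Space_iff_of_isOpenQuotientMap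
    (MulAction.isOpenQuotientMap_quotientMk (Γ := G) (T := P))).2 ?_
  have h1 : IsClosed {z : G × P × P | z.1 • z.2.2 = z.2.1} :=
    isClosed_eq (by fun_prop) (by fun_prop)
  convert isClosedMap_snd_of_compactSpace _ h1 using 1
  ext ⟨x, y⟩
  constructor
  · intro h
    obtain ⟨g, hg⟩ := Quotient.exact h
    exact ⟨(g, x, y), hg, rfl⟩
  · rintro ⟨⟨g, -⟩, hg, rfl⟩
    exact Quotient.sound ⟨g, hg⟩

namespace SliceDisc

variable {EG EN HN : Type*} [NormedAddCommGroup EG] [NormedSpace ℝ EG] [FiniteDimensional ℝ EG]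
  [NormedAddCommGroup EN] [NormedSpace ℝ EN] [FiniteDimensional ℝ EN]
  [TopologicalSpace HN] {IN : ModelWithCorners ℝ EN HN} [IN.Boundaryless]
  {G N P : Type*} [Group G] [TopologicalSpace G] [T2Space G]
  [ChartedSpace EG G] [LieGroup 𝓘(ℝ, EG) ∞ G]
  [TopologicalSpace N] [ChartedSpace HN N] [IsManifold IN ∞ N]
  [TopologicalSpace P] [MulAction G P] [ContinuousSMul G P] {j : P → N}

section

omit [FiniteDimensional ℝ EG] [FiniteDimensional ℝ EN] [IN.Boundaryless] [IsManifold IN ∞ N]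
  [T2Space G] [LieGroup 𝓘(ℝ, EG) ∞ G] [ContinuousSMul G P]

omit [TopologicalSpace G] [TopologicalSpace P] in
theorem quotient_mk_eq_iff {x y : P} :
    (Quotient.mk _ x : MulAction.orbitRel.Quotient G P) = Quotient.mk _ y ↔
      ∃ g : G, g • x = y := by
  constructor
  · intro h
    obtain ⟨g, hg⟩ := Quotient.exact h.symm
    exact ⟨g, hg⟩
  · rintro ⟨g, rfl⟩
    exact Quotient.sound ⟨g⁻¹, inv_smul_smul g x⟩

theorem toChart_isCenteredAt (s : SliceDisc (G := G) 𝓘(ℝ, EG) IN j) :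
    s.toChart.IsCenteredAt (Quotient.mk _ s.pt) :=
  ⟨s.origin, rfl, congrArg _ s.slice_zero⟩

theorem toChart_isChart [ContinuousConstSMul G P] (s : SliceDisc (G := G) 𝓘(ℝ, EG) IN j)
    (hj : IsInducing j) [Finite (MulAction.stabilizer G s.pt)] : s.toChart.IsChart where
  radius_pos := s.radius_pos
  finite := ‹_›
  continuous := continuous_quotient_mk'.comp (s.continuous_slice hj)
  isOpenMap := by
    intro V hV
    have h1 : IsOpen (s.tube '' (univ ×ˢ V)) := s.tube_isOpenMap _ (isOpen_univ.prod hV)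
    have h2 := isOpenMap_quotient_mk'_mul (Γ := G) (T := P) _ h1
    convert h2 using 1
    ext q
    constructor
    · rintro ⟨x, hx, rfl⟩
      exact ⟨s.slice x, ⟨(1, x), ⟨mem_univ _, hx⟩, one_smul _ _⟩, rfl⟩
    · rintro ⟨-, ⟨⟨g, x⟩, ⟨-, hx⟩, rfl⟩, rfl⟩
      exact ⟨x, hx, quotient_mk_eq_iff.2 ⟨g, rfl⟩⟩
  fiber x y := by
    refine quotient_mk_eq_iff.trans ⟨?_, ?_⟩
    · rintro ⟨g, hg⟩
      obtain ⟨γ, -, h⟩ := s.smul_slice_eq_iff.1 hg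
      exact ⟨γ, h⟩
    · rintro ⟨γ, rfl⟩
      exact ⟨γ.1, (s.slice_equivariant γ x).symm⟩

/-- The homomorphism `γ ↦ f(0) γ f(0)⁻¹` of isotropy groups induced by a transition map. -/
noncomputable def IsTransition.hom {s t : SliceDisc (G := G) 𝓘(ℝ, EG) IN j}
    {f : disc s.E s.radius → G} {ψ : disc s.E s.radius → disc t.E t.radius}
    (h : IsTransition s t f ψ) :
    MulAction.stabilizer G s.pt →* MulAction.stabilizer G t.pt :=
  ((MulAut.conj (f s.origin)).toMonoidHom.comp (MulAction.stabilizer G s.pt).subtype).codRestrict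
    _ fun γ => by
      have h1 : (f s.origin * γ * (f s.origin)⁻¹) • t.slice (ψ s.origin) =
          t.slice (ψ s.origin) := by
        rw [h.slice_apply, slice_origin, smul_smul, inv_mul_cancel_right, mul_smul, γ.2]
      obtain ⟨δ, h2, -⟩ := t.smul_slice_eq_iff.1 h1
      change f s.origin * γ * (f s.origin)⁻¹ ∈ _
      exact h2 ▸ δ.2

theorem IsTransition.coe_hom {s t : SliceDisc (G := G) 𝓘(ℝ, EG) IN j} {f : disc s.E s.radius → G}
    {ψ : disc s.E s.radius → disc t.E t.radius} (h : IsTransition s t f ψ)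
    (γ : MulAction.stabilizer G s.pt) :
    (h.hom γ : G) = f s.origin * γ * (f s.origin)⁻¹ := rfl

theorem IsTransition.mem_emb {s t : SliceDisc (G := G) 𝓘(ℝ, EG) IN j} {f : disc s.E s.radius → G}
    {ψ : disc s.E s.radius → disc t.E t.radius} (h : IsTransition s t f ψ) :
    (ψ, h.hom) ∈ (quotientAtlas (G := G) 𝓘(ℝ, EG) IN j).emb s t :=
  ⟨f, h.continuous_fun, h.slice_apply, h.coe_hom⟩

theorem exists_isTransition_of_mem_emb {s t : SliceDisc (G := G) 𝓘(ℝ, EG) IN j}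
    {e : (s.toChart.U → t.toChart.U) × (s.toChart.Γ →* t.toChart.Γ)}
    (he : e ∈ (quotientAtlas (G := G) 𝓘(ℝ, EG) IN j).emb s t) :
    ∃ f, ∃ h : IsTransition s t f e.1, e.2 = h.hom := by
  obtain ⟨f, hf, h1, h2⟩ := he
  refine ⟨f, ⟨hf, h1⟩, ?_⟩
  exact MonoidHom.ext fun γ => Subtype.ext (h2 γ)

end

section

omit [FiniteDimensional ℝ EG] [FiniteDimensional ℝ EN] [IN.Boundaryless] [IsManifold IN ∞ N]

variable {s t : SliceDisc (G := G) 𝓘(ℝ, EG) IN j} {f : disc s.E s.radius → G}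
  {ψ : disc s.E s.radius → disc t.E t.radius}

theorem IsTransition.equivariant (h : IsTransition s t f ψ)
    [Finite (MulAction.stabilizer G t.pt)] (γ : MulAction.stabilizer G s.pt)
    (x : disc s.E s.radius) :
    ψ (discMap (s.rep γ) x) = discMap (t.rep (h.hom γ)) (ψ x) := by
  refine t.slice_injective ?_
  rw [h.slice_apply, t.slice_equivariant, h.slice_apply, h.coe_hom, s.slice_equivariant,
    smul_smul, smul_smul, h.apply_discMap]

theorem IsTransition.comp {u : SliceDisc (G := G) 𝓘(ℝ, EG) IN j} {f' : disc t.E t.radius → G}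
    {ψ' : disc t.E t.radius → disc u.E u.radius} (h' : IsTransition t u f' ψ')
    (h : IsTransition s t f ψ) (hj : IsInducing j) [Finite (MulAction.stabilizer G t.pt)] :
    IsTransition s u (fun x => f' (ψ x) * f x) (ψ' ∘ ψ) where
  continuous_fun := by
    have : IsTopologicalGroup G := topologicalGroup_of_lieGroup 𝓘(ℝ, EG) ∞
    exact (h'.continuous_fun.comp (h.continuous hj)).mul h.continuous_fun
  slice_apply x := by
    rw [comp_apply, h'.slice_apply, h.slice_apply, smul_smul]

theorem IsTransition.comp_hom {u : SliceDisc (G := G) 𝓘(ℝ, EG) IN j}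
    {f' : disc t.E t.radius → G} {ψ' : disc t.E t.radius → disc u.E u.radius}
    (h' : IsTransition t u f' ψ') (h : IsTransition s t f ψ) (hj : IsInducing j)
    [Finite (MulAction.stabilizer G t.pt)] [Finite (MulAction.stabilizer G u.pt)]
    (γ : MulAction.stabilizer G s.pt) : (h'.comp h hj).hom γ = h'.hom (h.hom γ) := by
  refine Subtype.ext ?_
  -- `θ γ` fixes `ψ 0`, so `f'` may be evaluated at `ψ 0` instead of `0`.
  have h3 := h.equivariant γ s.origin
  rw [s.discMap_origin] at h3
  have h4 := h'.apply_discMap (h.hom γ) (ψ s.origin)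
  rw [← h3] at h4
  rw [coe_hom, h'.coe_hom, ← mul_inv_eq_iff_eq_mul.2 h4, h.coe_hom]
  group

omit [ContinuousSMul G P] in
/-- Two transition maps between the same slice discs differ by an element of the isotropy
group of the target. -/
theorem IsTransition.exists_eq (h : IsTransition s t f ψ) {f' : disc s.E s.radius → G}
    {ψ' : disc s.E s.radius → disc t.E t.radius} (h' : IsTransition s t f' ψ')
    [Finite (MulAction.stabilizer G t.pt)] :
    ∃ γ : MulAction.stabilizer G t.pt, (∀ x, ψ' x = discMap (t.rep γ) (ψ x)) ∧
      ∀ δ, h'.hom δ = γ * h.hom δ * γ⁻¹ := by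
  have : IsTopologicalGroup G := topologicalGroup_of_lieGroup 𝓘(ℝ, EG) ∞
  have h1 : ∀ x, (f' x * (f x)⁻¹) • t.slice (ψ x) = t.slice (ψ' x) := fun x => by
    rw [h.slice_apply, h'.slice_apply, smul_smul, inv_mul_cancel_right]
  have h2 : ∀ x, f' x * (f x)⁻¹ ∈ MulAction.stabilizer G t.pt := fun x => by
    obtain ⟨δ, h2, -⟩ := t.smul_slice_eq_iff.1 (h1 x)
    exact h2 ▸ δ.2
  have h3 := Subgroup.eq_of_continuous_of_mem _ (h'.continuous_fun.mul h.continuous_fun.inv) h2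
  refine ⟨⟨_, h2 s.origin⟩, fun x => ?_, fun δ => Subtype.ext ?_⟩
  · refine t.slice_injective ?_
    rw [t.slice_equivariant, ← h1 x]
    congr 1
    exact h3 x s.origin
  · simp only [Subgroup.coe_mul, Subgroup.coe_inv, coe_hom]
    group

omit [ContinuousSMul G P] [T2Space G] [LieGroup 𝓘(ℝ, EG) ∞ G] in
theorem IsTransition.hom_injective (h : IsTransition s t f ψ) : Injective h.hom := by
  intro γ γ' hγ
  have h1 := congrArg (Subtype.val (p := (· ∈ MulAction.stabilizer G t.pt))) hγ
  rw [h.coe_hom, h.coe_hom] at h1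
  exact Subtype.ext (mul_left_cancel (mul_right_cancel h1))

/-- An element of the target group that maps a point of the image of a transition map into the
image comes from the source group. -/
theorem IsTransition.exists_hom_eq (h : IsTransition s t f ψ)
    [Finite (MulAction.stabilizer G t.pt)] {δ : MulAction.stabilizer G t.pt}
    {x y : disc s.E s.radius} (hδ : discMap (t.rep δ) (ψ x) = ψ y) : ∃ γ, h.hom γ = δ := by
  have h1 : (δ * f x) • s.slice x = f y • s.slice y := by
    rw [← h.slice_apply, ← hδ, mul_smul, ← h.slice_apply, t.slice_equivariant]
  obtain ⟨γ, h2, h3⟩ := (s.tube_eq_iff _ _ _ _).1 h1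
  refine ⟨γ, Subtype.ext ?_⟩
  have h4 := h.apply_discMap γ x
  rw [← h3, h2, inv_mul_cancel_right] at h4
  rw [h.coe_hom]
  exact (mul_right_cancel h4).symm

end

theorem IsTransition.isEmbedding {s t : SliceDisc (G := G) 𝓘(ℝ, EG) IN j}
    {f : disc s.E s.radius → G} {ψ : disc s.E s.radius → disc t.E t.radius}
    (h : IsTransition s t f ψ) (hj : IsInducing j)
    [Finite (MulAction.stabilizer G s.pt)] [Finite (MulAction.stabilizer G t.pt)] :
    s.toChart.IsEmbedding t.toChart ψ h.hom where
  injective := h.injective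
  isLocalDiffeomorph := h.isLocalDiffeomorph hj
  injective_hom := h.hom_injective
  equivariant := h.equivariant
  map_comp x := quotient_mk_eq_iff.2 ⟨(f x)⁻¹, inv_smul_eq_iff.2 (h.slice_apply x)⟩
  full _ _ _ hδ := h.exists_hom_eq hδ

omit [FiniteDimensional ℝ EG] [FiniteDimensional ℝ EN] [IN.Boundaryless] [IsManifold IN ∞ N]
  [ContinuousSMul G P] in
/-- If two slice discs meet the same orbit, then a small slice disc at a given point of the first
admits a transition map to the second with prescribed value of `f` at its centre. -/
theorem exists_common_restrict (hj : IsInducing j)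
    (hfin : ∀ p : P, Finite (MulAction.stabilizer G p))
    (s t : SliceDisc (G := G) 𝓘(ℝ, EG) IN j) {x : disc s.E s.radius} {y : disc t.E t.radius}
    {k : G} (hk : t.slice y = k • s.slice x) :
    ∃ (u : SliceDisc (G := G) 𝓘(ℝ, EG) IN j) (ψ₁ : disc u.E u.radius → disc s.E s.radius)
      (ψ₂ : disc u.E u.radius → disc t.E t.radius) (f : disc u.E u.radius → G),
      u.pt = s.slice x ∧ ψ₁ u.origin = x ∧ ψ₂ u.origin = y ∧ f u.origin = k ∧
      IsTransition u s (fun _ => 1) ψ₁ ∧ IsTransition u t f ψ₂ := by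
  have : IsTopologicalGroup G := topologicalGroup_of_lieGroup 𝓘(ℝ, EG) ∞
  have := hfin s.pt
  have := hfin t.pt
  obtain ⟨e, he, het⟩ := t.isLocalHomeomorph_tube hj (k⁻¹, y)
  have h1 : s.slice x = e (k⁻¹, y) := by
    rw [← het]
    simp [tube, hk]
  have htgt : s.slice x ∈ e.target := h1 ▸ e.map_source he
  obtain ⟨u, ψ₁, hu1, hu2, hu3, hu4⟩ := s.exists_restrict (s.continuous_slice hj) x
    (e.open_target.mem_nhds htgt)
  have hc : Continuous fun v => e.symm (u.slice v) := continuous_iff_continuousAt.2 fun v =>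
    (e.continuousAt_symm (hu4 v)).comp (f := u.slice) (u.continuous_slice hj).continuousAt
  have h2 : e.symm (u.slice u.origin) = (k⁻¹, y) := by
    rw [hu3, hu2, h1]
    exact e.left_inv he
  refine ⟨u, ψ₁, fun v => (e.symm (u.slice v)).2, fun v => (e.symm (u.slice v)).1⁻¹, hu1, hu2,
    congrArg Prod.snd h2, by simp [h2], ⟨continuous_const, fun v => ?_⟩, ⟨hc.fst.inv, fun v => ?_⟩⟩
  · rw [hu3, one_smul]
  · have h3 : t.tube (e.symm (u.slice v)) = u.slice v := by
      rw [het]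
      exact e.right_inv (hu4 v)
    rw [eq_inv_smul_iff]
    exact h3

omit [FiniteDimensional ℝ EG] [FiniteDimensional ℝ EN] [IN.Boundaryless] [IsManifold IN ∞ N]
  [ContinuousSMul G P] [T2Space G] [LieGroup 𝓘(ℝ, EG) ∞ G] in
theorem act_mem_emb (s : SliceDisc (G := G) 𝓘(ℝ, EG) IN j) (γ : s.toChart.Γ) :
    (s.toChart.act γ, (MulAut.conj γ).toMonoidHom) ∈
      (quotientAtlas (G := G) 𝓘(ℝ, EG) IN j).emb s s :=
  ⟨fun _ => γ.1, continuous_const, fun x => s.slice_equivariant γ x, fun _ => rfl⟩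

/-- If there is a slice disc at every point of `P`, then the quotient by the almost free action is
an orbifold. -/
theorem quotientAtlas_isOrbifold [CompactSpace G] [T2Space P] [SecondCountableTopology P]
    (hj : IsInducing j) (hfin : ∀ p : P, Finite (MulAction.stabilizer G p))
    (hex : ∀ p : P, ∃ s : SliceDisc (G := G) 𝓘(ℝ, EG) IN j, s.pt = p) :
    (quotientAtlas (G := G) 𝓘(ℝ, EG) IN j).IsOrbifold where
  t2Space := t2Space_orbitRel_quotient G P
  secondCountable := ContinuousConstSMul.secondCountableTopology
  isChart s := by
    have := hfin s.pt
    exact toChart_isChart s hj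
  isEmbedding s t e he := by
    have := hfin s.pt
    have := hfin t.pt
    obtain ⟨f, h, h2⟩ := exists_isTransition_of_mem_emb he
    rw [h2]
    exact h.isEmbedding hj
  exists_centered q := by
    induction q using Quotient.inductionOn with
    | h p =>
      obtain ⟨s, rfl⟩ := hex p
      exact ⟨s, s.toChart_isCenteredAt⟩
  compatible s t q hq := by
    obtain ⟨⟨x, rfl⟩, ⟨y, hy⟩⟩ := hq
    obtain ⟨k, hk⟩ := quotient_mk_eq_iff.1 hy.symm
    obtain ⟨u, ψ₁, ψ₂, f, hu, -, -, -, h₁, h₂⟩ := exists_common_restrict hj hfin s t hk.symm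
    refine ⟨u, ?_, ⟨_, h₁.mem_emb⟩, ⟨_, h₂.mem_emb⟩⟩
    have := u.toChart_isCenteredAt
    rw [hu] at this
    exact this
  act_mem := act_mem_emb
  comp_mem s t u e he e' he' := by
    have := hfin t.pt
    have := hfin u.pt
    obtain ⟨f, h, h2⟩ := exists_isTransition_of_mem_emb he
    obtain ⟨f', h', h2'⟩ := exists_isTransition_of_mem_emb he'
    refine ⟨_, (h'.comp h hj).continuous_fun, (h'.comp h hj).slice_apply, fun γ => ?_⟩
    have h3 := congrArg Subtype.val (h'.comp_hom h hj γ)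
    rw [h2, h2']
    exact h3.symm
  unique s t e he e' he' := by
    have := hfin t.pt
    obtain ⟨f, h, h2⟩ := exists_isTransition_of_mem_emb he
    obtain ⟨f', h', h2'⟩ := exists_isTransition_of_mem_emb he'
    obtain ⟨γ, h3, h4⟩ := h.exists_eq h'
    refine ⟨γ, Prod.ext (funext h3) ?_⟩
    rw [h2', h2]
    exact MonoidHom.ext h4

end SliceDisc

/-! ### Embeddings of charts of the inertia orbifold -/

namespace OrbifoldAtlas

universe w v u

variable {X : Type u} {A : OrbifoldAtlas.{w, v, u} X}

/-- The inclusion of `U^g` into `U`, as a map defined on the domain of the chart of the inertia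
orbifold. -/
def inertiaPoint (k : A.InertiaIndex) (x : (A.inertiaChart k).U) : (A.chart k.1).U :=
  A.inertiaIncl k x

theorem inertiaPoint_injective (k : A.InertiaIndex) : Injective (inertiaPoint k) := by
  intro x y h
  exact Subtype.ext (Subtype.ext (congrArg (fun z : (A.chart k.1).U => (z : (A.chart k.1).E)) h))

theorem act_inertiaPoint (k : A.InertiaIndex) (x : (A.inertiaChart k).U) :
    (A.chart k.1).act k.2 (inertiaPoint k x) = inertiaPoint k x :=
  Subtype.ext x.1.2

theorem exists_inertiaPoint_eq {k : A.InertiaIndex} {x : (A.chart k.1).U}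
    (hx : (A.chart k.1).act k.2 x = x) : ∃ y, inertiaPoint k y = x := by
  have h : (A.chart k.1).rep k.2 (x : (A.chart k.1).E) = x := congrArg Subtype.val hx
  exact ⟨⟨⟨x.1, h⟩, mem_ball_zero_iff.2 (mem_ball_zero_iff.1 x.2)⟩, rfl⟩

theorem inertiaPoint_act (k : A.InertiaIndex) (z : (A.inertiaChart k).Γ)
    (x : (A.inertiaChart k).U) :
    inertiaPoint k ((A.inertiaChart k).act z x) =
      (A.chart k.1).act (A.inertiaGroupIncl k z) (inertiaPoint k x) := rfl

theorem mem_inertia_emb_iff {k l : A.InertiaIndex}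
    {e : ((A.inertiaChart k).U → (A.inertiaChart l).U) ×
      ((A.inertiaChart k).Γ →* (A.inertiaChart l).Γ)} :
    e ∈ A.inertia.emb k l ↔ ∃ e₀ ∈ A.emb k.1 l.1, e₀.2 k.2 = l.2 ∧
      (∀ x, inertiaPoint l (e.1 x) = e₀.1 (inertiaPoint k x)) ∧
      ∀ z, A.inertiaGroupIncl l (e.2 z) = e₀.2 (A.inertiaGroupIncl k z) := Iff.rfl

theorem inertiaGroupIncl_injective (k : A.InertiaIndex) : Injective (A.inertiaGroupIncl k) :=
  Subgroup.subtype_injective _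

theorem inertiaGroupIncl_comm (k : A.InertiaIndex) (z : (A.inertiaChart k).Γ) :
    A.inertiaGroupIncl k z * k.2 = k.2 * A.inertiaGroupIncl k z :=
  Subgroup.mem_centralizer_singleton_iff.1 z.2

theorem exists_inertiaGroupIncl_eq {k : A.InertiaIndex} {γ : (A.chart k.1).Γ}
    (h : γ * k.2 = k.2 * γ) : ∃ z, A.inertiaGroupIncl k z = γ :=
  ⟨⟨γ, Subgroup.mem_centralizer_singleton_iff.2 h⟩, rfl⟩

/-- An embedding of charts restricts to an embedding of fixed point sets. -/
theorem exists_inertia_emb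
    (hA : ∀ i j, ∀ e ∈ A.emb i j, (A.chart i).IsEmbedding (A.chart j) e.1 e.2)
    {k l : A.InertiaIndex} {e₀ : ((A.chart k.1).U → (A.chart l.1).U) ×
      ((A.chart k.1).Γ →* (A.chart l.1).Γ)}
    (he₀ : e₀ ∈ A.emb k.1 l.1) (h : e₀.2 k.2 = l.2) : (A.inertia.emb k l).Nonempty := by
  have h1 : ∀ x : (A.inertiaChart k).U, ∃ y : (A.inertiaChart l).U,
      inertiaPoint l y = e₀.1 (inertiaPoint k x) := by
    intro x
    apply exists_inertiaPoint_eq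
    rw [← h, ← (hA _ _ _ he₀).equivariant, act_inertiaPoint]
  choose ψ hψ using h1
  have h2 : ∀ z : (A.inertiaChart k).Γ, e₀.2 (A.inertiaGroupIncl k z) ∈
      Subgroup.centralizer ({l.2} : Set (A.chart l.1).Γ) := by
    intro z
    rw [Subgroup.mem_centralizer_singleton_iff, ← h, ← map_mul, ← map_mul, inertiaGroupIncl_comm]
  exact ⟨(ψ, (e₀.2.comp (A.inertiaGroupIncl k)).codRestrict _ h2), e₀, he₀, h, hψ, fun z => rfl⟩

/-- The maps between charts `U^g` that are induced by embeddings of charts are embeddings. For a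
general orbifold atlas, that they are local diffeomorphisms is a hypothesis here; for a quotient by
an almost free action, it is `SliceDisc.isLocalDiffeomorph_of_mem_inertia_emb`. -/
theorem inertia_isEmbedding [TopologicalSpace X] (hA : A.IsOrbifold) {k l : A.InertiaIndex}
    {e : ((A.inertiaChart k).U → (A.inertiaChart l).U) ×
      ((A.inertiaChart k).Γ →* (A.inertiaChart l).Γ)} (he : e ∈ A.inertia.emb k l)
    (hloc : IsLocalDiffeomorph 𝓘(ℝ, (A.inertiaChart k).E) 𝓘(ℝ, (A.inertiaChart l).E) ∞ e.1) :
    (A.inertiaChart k).IsEmbedding (A.inertiaChart l) e.1 e.2 := by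
  obtain ⟨e₀, he₀, h, h1, h2⟩ := mem_inertia_emb_iff.1 he
  have hE := hA.isEmbedding _ _ _ he₀
  refine ⟨?_, hloc, ?_, ?_, ?_, ?_⟩
  · intro x y hxy
    apply inertiaPoint_injective k
    apply hE.injective
    rw [← h1, ← h1, hxy]
  · intro z z' hzz
    apply inertiaGroupIncl_injective k
    apply hE.injective_hom
    rw [← h2, ← h2, hzz]
  · intro z x
    apply inertiaPoint_injective l
    rw [h1, inertiaPoint_act, inertiaPoint_act, hE.equivariant, h2, h1]
  · intro x
    exact (Quot.sound ⟨e₀, he₀, h, (h1 x).symm⟩).symm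
  -- A preimage in `Γ` of an element commuting with `θ(g)` commutes with `g`, as `θ` is injective.
  · intro δ x y hδ
    have h3 := congrArg (inertiaPoint l) hδ
    rw [inertiaPoint_act, h1, h1] at h3
    obtain ⟨γ, hγ⟩ := hE.full _ _ _ h3
    have h4 : γ * k.2 = k.2 * γ := by
      apply hE.injective_hom
      rw [map_mul, map_mul, hγ, h, inertiaGroupIncl_comm]
    obtain ⟨z, hz⟩ := exists_inertiaGroupIncl_eq h4
    refine ⟨z, inertiaGroupIncl_injective l ?_⟩
    rw [h2, hz, hγ]

theorem inertia_act_mem [TopologicalSpace X] (hA : A.IsOrbifold) (k : A.InertiaIndex)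
    (z : (A.inertiaChart k).Γ) :
    ((A.inertiaChart k).act z, (MulAut.conj z).toMonoidHom) ∈ A.inertia.emb k k := by
  refine ⟨_, hA.act_mem k.1 (A.inertiaGroupIncl k z), ?_, fun x => rfl, fun z' => rfl⟩
  change A.inertiaGroupIncl k z * k.2 * (A.inertiaGroupIncl k z)⁻¹ = k.2
  rw [inertiaGroupIncl_comm, mul_inv_cancel_right]

theorem inertia_comp_mem [TopologicalSpace X] (hA : A.IsOrbifold) {k l m : A.InertiaIndex}
    {e : ((A.inertiaChart k).U → (A.inertiaChart l).U) ×
      ((A.inertiaChart k).Γ →* (A.inertiaChart l).Γ)} (he : e ∈ A.inertia.emb k l)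
    {e' : ((A.inertiaChart l).U → (A.inertiaChart m).U) ×
      ((A.inertiaChart l).Γ →* (A.inertiaChart m).Γ)} (he' : e' ∈ A.inertia.emb l m) :
    (e'.1 ∘ e.1, e'.2.comp e.2) ∈ A.inertia.emb k m := by
  obtain ⟨e₀, he₀, h, h1, h2⟩ := mem_inertia_emb_iff.1 he
  obtain ⟨e₀', he₀', h', h1', h2'⟩ := mem_inertia_emb_iff.1 he'
  refine ⟨_, hA.comp_mem _ _ _ _ he₀ _ he₀', ?_, fun x => ?_, fun z => ?_⟩
  · change e₀'.2 (e₀.2 k.2) = m.2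
    rw [h, h']
  · exact (h1' (e.1 x)).trans (congrArg e₀'.1 (h1 x))
  · exact (h2' (e.2 z)).trans (congrArg e₀'.2 (h2 z))

/-- Two induced maps from `U^g` to `U'^h` come from embeddings that differ by an element of `Γ'`
which commutes with `h`, since both homomorphisms take `g` to `h`. -/
theorem inertia_unique [TopologicalSpace X] (hA : A.IsOrbifold) {k l : A.InertiaIndex}
    {e e' : ((A.inertiaChart k).U → (A.inertiaChart l).U) ×
      ((A.inertiaChart k).Γ →* (A.inertiaChart l).Γ)} (he : e ∈ A.inertia.emb k l)
    (he' : e' ∈ A.inertia.emb k l) :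
    ∃ z : (A.inertiaChart l).Γ,
      e' = ((A.inertiaChart l).act z ∘ e.1, (MulAut.conj z).toMonoidHom.comp e.2) := by
  obtain ⟨e₀, he₀, h, h1, h2⟩ := mem_inertia_emb_iff.1 he
  obtain ⟨e₀', he₀', h', h1', h2'⟩ := mem_inertia_emb_iff.1 he'
  obtain ⟨γ, rfl⟩ := hA.unique _ _ _ he₀ _ he₀'
  have h3 : γ * l.2 = l.2 * γ := by
    have h4 : γ * e₀.2 k.2 * γ⁻¹ = l.2 := h'
    rw [h, mul_inv_eq_iff_eq_mul] at h4
    exact h4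
  obtain ⟨z, hz⟩ := exists_inertiaGroupIncl_eq h3
  refine ⟨z, Prod.ext (funext fun x => ?_) (MonoidHom.ext fun w => ?_)⟩
  · apply inertiaPoint_injective l
    rw [h1']
    change _ = inertiaPoint l ((A.inertiaChart l).act z (e.1 x))
    rw [inertiaPoint_act, hz, h1]
    rfl
  · apply inertiaGroupIncl_injective l
    rw [h2']
    change γ * e₀.2 (A.inertiaGroupIncl k w) * γ⁻¹ = A.inertiaGroupIncl l (z * e.2 w * z⁻¹)
    rw [map_mul, map_mul, map_inv, hz, h2]

end OrbifoldAtlas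

/-! ### Slice discs of the fixed point set `Ī` -/

section ConjProd

variable {G M : Type*}

instance [TopologicalSpace G] [TopologicalSpace M] [T2Space G] [T2Space M] :
    T2Space (ConjProd G M) := inferInstanceAs (T2Space (G × M))

instance [TopologicalSpace G] [TopologicalSpace M] [SecondCountableTopology G]
    [SecondCountableTopology M] : SecondCountableTopology (ConjProd G M) :=
  inferInstanceAs (SecondCountableTopology (G × M))

instance {EG EM : Type*} [NormedAddCommGroup EG] [NormedSpace ℝ EG]
    [NormedAddCommGroup EM] [NormedSpace ℝ EM]
    [TopologicalSpace G] [TopologicalSpace M] [ChartedSpace EG G] [ChartedSpace EM M]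
    [IsManifold 𝓘(ℝ, EG) ∞ G] [IsManifold 𝓘(ℝ, EM) ∞ M] :
    IsManifold (𝓘(ℝ, EG).prod 𝓘(ℝ, EM)) ∞ (ConjProd G M) :=
  inferInstanceAs (IsManifold (𝓘(ℝ, EG).prod 𝓘(ℝ, EM)) ∞ (G × M))

variable [Group G] [MulAction G M]

/-- The point `(g, p)` of the fixed point set `Ī`, where `g p = p`. -/
def fixedLocus.mk (g : G) (p : M) (h : g • p = p) : fixedLocus G M :=
  ⟨((g, p) : G × M), congrArg (fun q => ((g, q) : G × M)) h⟩

theorem fixedLocus.exists_mk (x : fixedLocus G M) : ∃ g p h, x = fixedLocus.mk (M := M) g p h :=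
  ⟨x.1.1, x.1.2, congrArg Prod.snd x.2, rfl⟩

/-- The first component of a point `(g, p)` of `Ī`. -/
def fixedLocus.fst (x : fixedLocus G M) : G := x.1.1

/-- The second component of a point `(g, p)` of `Ī`. -/
def fixedLocus.snd (x : fixedLocus G M) : M := x.1.2

theorem fixedLocus.eq_iff {x y : fixedLocus G M} :
    x = y ↔ fixedLocus.fst x = fixedLocus.fst y ∧ fixedLocus.snd x = fixedLocus.snd y :=
  Subtype.ext_iff.trans (Prod.ext_iff (x := (x.1 : G × M)) (y := (y.1 : G × M)))

theorem fixedLocus.continuous_fst [TopologicalSpace G] [TopologicalSpace M] :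
    Continuous (fixedLocus.fst : fixedLocus G M → G) :=
  (_root_.continuous_fst : Continuous (Prod.fst : G × M → G)).comp
    (continuous_subtype_val : Continuous (Subtype.val : fixedLocus G M → ConjProd G M))

theorem fixedLocus.continuous_snd [TopologicalSpace G] [TopologicalSpace M] :
    Continuous (fixedLocus.snd : fixedLocus G M → M) :=
  (_root_.continuous_snd : Continuous (Prod.snd : G × M → M)).comp
    (continuous_subtype_val : Continuous (Subtype.val : fixedLocus G M → ConjProd G M))

theorem fixedLocus.mk_eq_iff {g g' : G} {p p' : M} {h : g • p = p} {h' : g' • p' = p'} :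
    fixedLocus.mk g p h = fixedLocus.mk g' p' h' ↔ g = g' ∧ p = p' :=
  fixedLocus.eq_iff

theorem fixedLocus.smul_mk (k g : G) (p : M) (h : g • p = p) :
    k • fixedLocus.mk g p h = fixedLocus.mk (k * g * k⁻¹) (k • p)
      (by rw [smul_smul, inv_mul_cancel_right, mul_smul, h]) := rfl

instance [TopologicalSpace G] [TopologicalSpace M] [IsTopologicalGroup G] [ContinuousSMul G M] :
    ContinuousSMul G (fixedLocus G M) where
  continuous_smul := by
    have h3 : Continuous fun z : G × fixedLocus G M =>
        ((z.1 * fixedLocus.fst z.2 * z.1⁻¹, z.1 • fixedLocus.snd z.2) : G × M) :=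
      ((continuous_fst.mul (fixedLocus.continuous_fst.comp continuous_snd)).mul
        continuous_fst.inv).prodMk
        (continuous_fst.smul (fixedLocus.continuous_snd.comp continuous_snd))
    exact Continuous.subtype_mk h3 _

end ConjProd

/-- The inclusion of `U^A` into the disc `U`, for a linear isometry `A`. -/
def fixedIncl {E : Type} [NormedAddCommGroup E] [InnerProductSpace ℝ E] (A : E ≃ₗᵢ[ℝ] E) {r : ℝ}
    (x : disc (fixedSubspace A) r) : disc E r :=
  ⟨(x.1 : E), mem_ball_zero_iff.2 (mem_ball_zero_iff.1 x.2)⟩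

theorem fixedIncl_injective {E : Type} [NormedAddCommGroup E] [InnerProductSpace ℝ E]
    (A : E ≃ₗᵢ[ℝ] E) {r : ℝ} : Injective (fixedIncl A (r := r)) := fun _ _ h =>
  Subtype.ext (Subtype.ext (congrArg (fun z : disc E r => (z : E)) h))

theorem isInducing_fixedIncl {E : Type} [NormedAddCommGroup E] [InnerProductSpace ℝ E]
    (A : E ≃ₗᵢ[ℝ] E) {r : ℝ} : IsInducing (fixedIncl A (r := r)) := by
  refine (IsInducing.subtypeVal (t := (disc E r : Set E))).of_comp_iff.1 ?_
  exact (IsInducing.subtypeVal (t := (fixedSubspace A : Set E))).comp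
    (IsInducing.subtypeVal (t := (disc (fixedSubspace A) r : Set (fixedSubspace A))))

theorem coe_fixedIncl {E : Type} [NormedAddCommGroup E] [InnerProductSpace ℝ E]
    (A : E ≃ₗᵢ[ℝ] E) {r : ℝ} (x : disc (fixedSubspace A) r) :
    (fixedIncl A x : E) = 0 + (fixedSubspace A).subtypeL x := (zero_add _).symm

theorem discMap_fixedIncl {E : Type} [NormedAddCommGroup E] [InnerProductSpace ℝ E]
    (A : E ≃ₗᵢ[ℝ] E) {r : ℝ} (x : disc (fixedSubspace A) r) :
    discMap A (fixedIncl A x) = fixedIncl A x := Subtype.ext x.1.2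

namespace SliceDisc

variable {EG EM : Type*} [NormedAddCommGroup EG] [NormedSpace ℝ EG]
  [NormedAddCommGroup EM] [NormedSpace ℝ EM]
  {G M : Type*} [Group G] [TopologicalSpace G] [ChartedSpace EG G]
  [TopologicalSpace M] [ChartedSpace EM M] [MulAction G M]

section

variable (s : SliceDisc (G := G) 𝓘(ℝ, EG) 𝓘(ℝ, EM) (id : M → M))
  (g : MulAction.stabilizer G s.pt)

/-- The isotropy group of the point `(g, p)` of `Ī` is the centralizer of `g` in the isotropy
group of `p`. -/
def stabilizerEquivCentralizer :
    MulAction.stabilizer G (fixedLocus.mk (g : G) s.pt g.2) ≃*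
      Subgroup.centralizer ({g} : Set (MulAction.stabilizer G s.pt)) where
  toFun h :=
    have hh := fixedLocus.mk_eq_iff.1 ((fixedLocus.smul_mk h.1 g.1 s.pt g.2).symm.trans h.2)
    ⟨⟨h, hh.2⟩, Subgroup.mem_centralizer_singleton_iff.2
      (Subtype.ext (mul_inv_eq_iff_eq_mul.1 hh.1))⟩
  invFun z := ⟨z.1.1, (fixedLocus.smul_mk z.1.1 g.1 s.pt g.2).trans (fixedLocus.mk_eq_iff.2
    ⟨mul_inv_eq_iff_eq_mul.2 (congrArg Subtype.val
      (Subgroup.mem_centralizer_singleton_iff.1 z.2)), z.1.2⟩)⟩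
  left_inv _ := rfl
  right_inv _ := rfl
  map_mul' _ _ := rfl

theorem smul_slice_fixedIncl (x : disc (fixedSubspace (s.rep g)) s.radius) :
    (g : G) • s.slice (fixedIncl _ x) = s.slice (fixedIncl _ x) := by
  rw [← s.slice_equivariant, discMap_fixedIncl]

/-- The point `(g, x)` of `Ī`, for `x ∈ U^g`. -/
def inertiaSliceMap (x : disc (fixedSubspace (s.rep g)) s.radius) : fixedLocus G M :=
  fixedLocus.mk (g : G) (s.slice (fixedIncl _ x)) (s.smul_slice_fixedIncl g x)

theorem smul_inertiaSliceMap_eq_iff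
    {t : SliceDisc (G := G) 𝓘(ℝ, EG) 𝓘(ℝ, EM) (id : M → M)} {h : MulAction.stabilizer G t.pt}
    {k : G} {x : disc (fixedSubspace (s.rep g)) s.radius}
    {y : disc (fixedSubspace (t.rep h)) t.radius} :
    k • s.inertiaSliceMap g x = t.inertiaSliceMap h y ↔
      k * g * k⁻¹ = h ∧ k • s.slice (fixedIncl _ x) = t.slice (fixedIncl _ y) :=
  fixedLocus.eq_iff

theorem smul_inertiaSliceMap_eq_smul_iff {k k' : G}
    {x y : disc (fixedSubspace (s.rep g)) s.radius} :
    k • s.inertiaSliceMap g x = k' • s.inertiaSliceMap g y ↔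
      k * g * k⁻¹ = k' * g * k'⁻¹ ∧
        k • s.slice (fixedIncl _ x) = k' • s.slice (fixedIncl _ y) :=
  fixedLocus.eq_iff

variable [FiniteDimensional ℝ EG] [FiniteDimensional ℝ EM] [T2Space G] [LieGroup 𝓘(ℝ, EG) ∞ G]
  [IsManifold 𝓘(ℝ, EM) ∞ M] [ContinuousSMul G M]

omit [FiniteDimensional ℝ EG] [FiniteDimensional ℝ EM] [IsManifold 𝓘(ℝ, EM) ∞ M]
  [ContinuousSMul G M] in
/-- The tube map `G × U^g → Ī` is open: if `(k, a x)` is a point of `Ī` close to `(g, p)`, with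
`a` close to `1` and `x ∈ U`, then `a⁻¹ k a` is an element of `G_p` close to `g`, hence equal
to `g`. -/
theorem isOpenMap_inertiaTube [Finite (MulAction.stabilizer G s.pt)] :
    IsOpenMap (fun z : G × disc (fixedSubspace (s.rep g)) s.radius =>
      z.1 • s.inertiaSliceMap g z.2) := by
  have : IsTopologicalGroup G := topologicalGroup_of_lieGroup 𝓘(ℝ, EG) ∞
  refine IsOpenMap.of_nhds_le ?_
  rintro ⟨h, x⟩ V hV
  rw [mem_map] at hV
  obtain ⟨W, hW, hWV⟩ := ((IsInducing.id.prodMap (isInducing_fixedIncl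
    (s.rep g) (r := s.radius))).nhds_eq_comap (h, x) ▸ hV : _ ∈ comap _ _)
  obtain ⟨e, he, hes⟩ := s.isLocalHomeomorph_tube IsInducing.id (h, fixedIncl _ x)
  have h0 : e (h, fixedIncl _ x) = h • s.slice (fixedIncl _ x) := by rw [← hes]; rfl
  set y₀ : fixedLocus G M := h • s.inertiaSliceMap g x with hy₀
  have hfst := fixedLocus.continuous_fst (G := G) (M := M)
  have hsnd := fixedLocus.continuous_snd (G := G) (M := M)
  have hy1 : fixedLocus.fst y₀ = h * g * h⁻¹ := rfl
  have hy2 : fixedLocus.snd y₀ = e (h, fixedIncl _ x) := h0.symm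
  have htgt : fixedLocus.snd y₀ ∈ e.target := hy2 ▸ e.map_source he
  have hc : ContinuousAt (fun y : fixedLocus G M => e.symm (fixedLocus.snd y)) y₀ :=
    (e.continuousAt_symm htgt).comp (f := fixedLocus.snd) hsnd.continuousAt
  have hsy : e.symm (fixedLocus.snd y₀) = (h, fixedIncl _ x) := by
    rw [hy2]
    exact e.left_inv he
  have h1 : ∀ᶠ y in 𝓝 y₀, e.symm (fixedLocus.snd y) ∈ W := by
    have h3 := hc.tendsto
    rw [hsy] at h3
    exact h3.eventually hW
  let d : fixedLocus G M → G := fun y =>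
    ((e.symm (fixedLocus.snd y)).1⁻¹ * fixedLocus.fst y * (e.symm (fixedLocus.snd y)).1) *
      (g : G)⁻¹
  have h2 : ∀ᶠ y in 𝓝 y₀, d y ∈ MulAction.stabilizer G s.pt → d y = 1 := by
    have h3 : ContinuousAt d y₀ :=
      ((hc.fst.inv.mul hfst.continuousAt).mul hc.fst).mul continuousAt_const
    have h4 := h3.tendsto
    have h5 : d y₀ = 1 := by
      simp only [d]
      rw [hsy, hy1]
      group
    rw [h5] at h4
    exact h4.eventually (MulAction.stabilizer G s.pt).eventually_mem_imp_eq_one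
  filter_upwards [h1, h2, hsnd.continuousAt.eventually (e.open_target.mem_nhds htgt)]
    with y hyW hyd hyt
  obtain ⟨k, q, hkq, rfl⟩ := fixedLocus.exists_mk y
  change e.symm q ∈ W at hyW
  change ((e.symm q).1⁻¹ * k * (e.symm q).1) * (g : G)⁻¹ ∈ _ →
    ((e.symm q).1⁻¹ * k * (e.symm q).1) * (g : G)⁻¹ = 1 at hyd
  obtain ⟨⟨a, v⟩, hav⟩ : ∃ z, z = e.symm q := ⟨_, rfl⟩
  have hq : a • s.slice v = q := by
    have : s.tube (e.symm q) = q := by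
      rw [hes]
      exact e.right_inv hyt
    rw [← hav] at this
    exact this
  rw [← hav] at hyW hyd
  simp only at hyd
  have h6 : (a⁻¹ * k * a) • s.slice v = s.slice v := by
    rw [mul_smul, hq, mul_smul, hkq, ← hq, inv_smul_smul]
  obtain ⟨γ, h7, h8⟩ := s.smul_slice_eq_iff.1 h6
  have h9 : γ = g := by
    refine Subtype.ext (h7.trans ?_)
    rw [← mul_inv_eq_one]
    refine hyd ?_
    rw [← h7]
    exact mul_mem γ.2 (inv_mem g.2)
  rw [h9] at h8
  have h10 : s.rep g (v : s.E) = v := congrArg Subtype.val h8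
  set x' : disc (fixedSubspace (s.rep g)) s.radius :=
    ⟨⟨v.1, h10⟩, mem_ball_zero_iff.2 (mem_ball_zero_iff.1 v.2)⟩ with hx'
  have hx'v : fixedIncl _ x' = v := rfl
  have h11 : a • s.inertiaSliceMap g x' = fixedLocus.mk k q hkq := by
    refine fixedLocus.eq_iff.2 ⟨?_, hq⟩
    change a * (g : G) * a⁻¹ = k
    rw [← h9, h7]
    group
  rw [← h11]
  exact hWV (a := (a, x')) hyW

omit [FiniteDimensional ℝ EG] [FiniteDimensional ℝ EM] [IsManifold 𝓘(ℝ, EM) ∞ M]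
  [ContinuousSMul G M] [T2Space G] in
/-- The map `(k, v) ↦ (k a k⁻¹, k κ(v))` is an immersion, because its second component is. -/
theorem injective_mfderiv_prodMk_tube {E : Type} [NormedAddCommGroup E] [InnerProductSpace ℝ E]
    {r : ℝ} {κ : disc E r → disc s.E s.radius} {c : s.E} {L : E →L[ℝ] s.E}
    (hκ : ∀ v, (κ v : s.E) = c + L v) (hL : Injective L) (a : G) (z : G × disc E r) :
    Injective (mfderiv (𝓘(ℝ, EG).prod 𝓘(ℝ, E)) (𝓘(ℝ, EG).prod 𝓘(ℝ, EM))
      (fun z : G × disc E r => (z.1 * a * z.1⁻¹, z.1 • s.slice (κ z.2))) z) := by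
  have h1 : MDifferentiableAt (𝓘(ℝ, EG).prod 𝓘(ℝ, E)) 𝓘(ℝ, EG)
      (fun z : G × disc E r => z.1 * a * z.1⁻¹) z :=
    ((contMDiff_fst.mul contMDiff_const).mul contMDiff_fst.inv).contMDiffAt.mdifferentiableAt
      (n := ∞) (by simp)
  have h2 : MDifferentiableAt (𝓘(ℝ, EG).prod 𝓘(ℝ, s.E)) 𝓘(ℝ, EM)
      (fun z : G × disc s.E s.radius => id (z.1 • s.slice z.2)) (Prod.map (id : G → G) κ z) :=
    s.tube_contMDiff.contMDiffAt.mdifferentiableAt (by simp)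
  have h3 : MDifferentiableAt (𝓘(ℝ, EG).prod 𝓘(ℝ, E)) (𝓘(ℝ, EG).prod 𝓘(ℝ, s.E))
      (Prod.map (id : G → G) κ) z :=
    (contMDiff_id.prodMap (contMDiff_affine_disc hκ)).contMDiffAt
      |>.mdifferentiableAt (n := ∞) (by simp)
  refine injective_mfderiv_prodMk h1 (h2.comp z h3) ?_
  change Injective (mfderiv _ _ ((fun z : G × disc s.E s.radius => id (z.1 • s.slice z.2)) ∘
    (Prod.map (id : G → G) κ)) z)
  rw [mfderiv_comp z h2 h3]
  exact (s.tube_immersion (Prod.map (id : G → G) κ z)).comp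
    (injective_mfderiv_prodMap_affine_disc hκ hL z)

/-- The slice disc `{g} × U^g` of `Ī` at `(g, p)`, for a slice disc `U` of `M` at `p`. -/
noncomputable def inertiaSlice [Finite (MulAction.stabilizer G s.pt)] : SliceDisc (G := G) 𝓘(ℝ, EG)
    (𝓘(ℝ, EG).prod 𝓘(ℝ, EM)) (Subtype.val : fixedLocus G M → ConjProd G M) where
  pt := fixedLocus.mk (g : G) s.pt g.2
  E := fixedSubspace (s.rep g)
  rep := (centralizerRep s.rep g).comp (s.stabilizerEquivCentralizer g).toMonoidHom
  radius := s.radius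
  radius_pos := s.radius_pos
  slice := s.inertiaSliceMap g
  slice_zero := fixedLocus.mk_eq_iff.2 ⟨rfl, s.slice_zero⟩
  slice_equivariant γ x := by
    have hγ := (Subgroup.mem_centralizer_singleton_iff.1 (s.stabilizerEquivCentralizer g γ).2)
    refine Eq.symm ((s.smul_inertiaSliceMap_eq_iff g).2 ⟨?_, ?_⟩)
    · exact mul_inv_eq_iff_eq_mul.2 (congrArg Subtype.val hγ)
    · exact (s.slice_equivariant (s.stabilizerEquivCentralizer g γ).1 (fixedIncl _ x)).symm
  tube_eq_iff k k' x y := by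
    rw [smul_inertiaSliceMap_eq_smul_iff]
    constructor
    · rintro ⟨h1, h2⟩
      obtain ⟨γ, h3, h4⟩ := (s.tube_eq_iff _ _ _ _).1 h2
      have h5 : γ * g = g * γ := by
        refine Subtype.ext ?_
        rw [h3] at h1
        have h6 : (g : G) = γ⁻¹ * g * γ := by
          have := congrArg (fun a => k⁻¹ * a * k) h1
          simpa [mul_assoc] using this
        have h7 := congrArg (fun a => (γ : G) * a) h6
        simpa [mul_assoc] using h7
      refine ⟨(s.stabilizerEquivCentralizer g).symm
        ⟨γ, Subgroup.mem_centralizer_singleton_iff.2 h5⟩, h3, ?_⟩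
      exact fixedIncl_injective _ h4
    · rintro ⟨γ, h3, h4⟩
      have hγ := (Subgroup.mem_centralizer_singleton_iff.1 (s.stabilizerEquivCentralizer g γ).2)
      have h5 : (γ : G) * g = g * γ := congrArg Subtype.val hγ
      refine ⟨?_, (s.tube_eq_iff _ _ _ _).2 ⟨(s.stabilizerEquivCentralizer g γ).1, h3, ?_⟩⟩
      · have h6 : (γ : G)⁻¹ * g * γ = g := by rw [mul_assoc, ← h5, inv_mul_cancel_left]
        rw [h3]
        calc k * g * k⁻¹ = k * ((γ : G)⁻¹ * g * γ) * k⁻¹ := by rw [h6]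
          _ = _ := by group
      · rw [h4]
        rfl
  tube_contMDiff := by
    have hκ := contMDiff_affine_disc (coe_fixedIncl (s.rep g) (r := s.radius))
    have h1 : ContMDiff (𝓘(ℝ, EG).prod 𝓘(ℝ, fixedSubspace (s.rep g))) 𝓘(ℝ, EG) ∞
        (fun z : G × disc (fixedSubspace (s.rep g)) s.radius => z.1 * g * z.1⁻¹) :=
      (contMDiff_fst.mul contMDiff_const).mul contMDiff_fst.inv
    have h2 : ContMDiff (𝓘(ℝ, EG).prod 𝓘(ℝ, fixedSubspace (s.rep g))) 𝓘(ℝ, EM) ∞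
        (fun z : G × disc (fixedSubspace (s.rep g)) s.radius => z.1 • s.slice (fixedIncl _ z.2)) :=
      s.tube_contMDiff.comp (contMDiff_fst.prodMk (hκ.comp contMDiff_snd))
    exact h1.prodMk h2
  tube_immersion := s.injective_mfderiv_prodMk_tube (coe_fixedIncl (s.rep g))
    (fixedSubspace (s.rep g)).subtype_injective (g : G)
  tube_isOpenMap := s.isOpenMap_inertiaTube g

end

end SliceDisc

/-! ### The inertia orbifold as a quotient of the fixed point set -/

section

variable {EG EM : Type*} [NormedAddCommGroup EG] [NormedSpace ℝ EG] [FiniteDimensional ℝ EG]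
  [NormedAddCommGroup EM] [NormedSpace ℝ EM] [FiniteDimensional ℝ EM]
  {G M : Type*} [Group G] [TopologicalSpace G] [T2Space G] [ChartedSpace EG G]
  [LieGroup 𝓘(ℝ, EG) ∞ G]
  [TopologicalSpace M] [ChartedSpace EM M] [IsManifold 𝓘(ℝ, EM) ∞ M]
  [MulAction G M] [ContinuousSMul G M]

namespace SliceDisc

variable {s t : SliceDisc (G := G) 𝓘(ℝ, EG) 𝓘(ℝ, EM) (id : M → M)}
  {f : disc s.E s.radius → G} {ψ : disc s.E s.radius → disc t.E t.radius}

omit [FiniteDimensional ℝ EG] [FiniteDimensional ℝ EM] [IsManifold 𝓘(ℝ, EM) ∞ M] in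
/-- A transition map of slice discs of `M` restricts to one of the corresponding slice discs of
the fixed point set. -/
theorem IsTransition.inertiaSlice (h : IsTransition s t f ψ)
    [Finite (MulAction.stabilizer G s.pt)] [Finite (MulAction.stabilizer G t.pt)]
    {g : MulAction.stabilizer G s.pt} {g' : MulAction.stabilizer G t.pt} (hg : h.hom g = g')
    {ψ' : disc (fixedSubspace (s.rep g)) s.radius → disc (fixedSubspace (t.rep g')) t.radius}
    (hψ : ∀ x, fixedIncl _ (ψ' x) = ψ (fixedIncl _ x)) :
    IsTransition (s.inertiaSlice g) (t.inertiaSlice g') (fun x => f (fixedIncl (s.rep g) x))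
      ψ' := by
  refine ⟨h.continuous_fun.comp (isInducing_fixedIncl _).continuous, ?_⟩
  intro (x : disc (fixedSubspace (s.rep g)) s.radius)
  refine Eq.symm ((s.smul_inertiaSliceMap_eq_iff g).2 ⟨?_, ?_⟩)
  · have h1 := h.apply_discMap g (fixedIncl _ x)
    rw [discMap_fixedIncl, ← h.coe_hom, hg] at h1
    rw [h1, mul_inv_cancel_right]
  · rw [hψ, h.slice_apply]

omit [FiniteDimensional ℝ EG] [FiniteDimensional ℝ EM] [IsManifold 𝓘(ℝ, EM) ∞ M] in
/-- Points of the sets `U^g` that are identified in the inertia orbifold lie in the same orbit of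
the fixed point set. -/
theorem exists_smul_inertiaSliceMap_eq_of_mem_emb
    (hfin : ∀ p : M, Finite (MulAction.stabilizer G p)) {g : MulAction.stabilizer G s.pt}
    {g' : MulAction.stabilizer G t.pt} {x : disc (fixedSubspace (s.rep g)) s.radius}
    {y : disc (fixedSubspace (t.rep g')) t.radius}
    {e : (s.toChart.U → t.toChart.U) × (s.toChart.Γ →* t.toChart.Γ)}
    (he : e ∈ (quotientAtlas (G := G) 𝓘(ℝ, EG) 𝓘(ℝ, EM) (id : M → M)).emb s t)
    (hg : e.2 g = g') (hx : e.1 (fixedIncl _ x) = fixedIncl _ y) :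
    ∃ k : G, k • s.inertiaSliceMap g x = t.inertiaSliceMap g' y := by
  have := hfin t.pt
  obtain ⟨f, h, h3⟩ := exists_isTransition_of_mem_emb he
  refine ⟨f (fixedIncl _ x), (s.smul_inertiaSliceMap_eq_iff g).2 ⟨?_, ?_⟩⟩
  · have h4 := h.apply_discMap g (fixedIncl _ x)
    rw [discMap_fixedIncl, ← h.coe_hom, ← h3] at h4
    rw [h4, mul_inv_cancel_right]
    exact congrArg Subtype.val hg
  · exact (h.slice_apply (fixedIncl _ x)).symm.trans (congrArg t.slice hx)

/-- The maps between charts of the inertia orbifold are local diffeomorphisms, because they are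
transition maps between slice discs of the fixed point set. -/
theorem isLocalDiffeomorph_of_mem_inertia_emb
    (hfin : ∀ p : M, Finite (MulAction.stabilizer G p))
    {k l : (quotientAtlas (G := G) 𝓘(ℝ, EG) 𝓘(ℝ, EM) (id : M → M)).InertiaIndex}
    {e : ((OrbifoldAtlas.inertiaChart _ k).U → (OrbifoldAtlas.inertiaChart _ l).U) ×
      ((OrbifoldAtlas.inertiaChart _ k).Γ →* (OrbifoldAtlas.inertiaChart _ l).Γ)}
    (he : e ∈ (quotientAtlas (G := G) 𝓘(ℝ, EG) 𝓘(ℝ, EM) (id : M → M)).inertia.emb k l) :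
    IsLocalDiffeomorph 𝓘(ℝ, (OrbifoldAtlas.inertiaChart _ k).E)
      𝓘(ℝ, (OrbifoldAtlas.inertiaChart _ l).E) ∞ e.1 := by
  have : IsTopologicalGroup G := topologicalGroup_of_lieGroup 𝓘(ℝ, EG) ∞
  obtain ⟨s, g⟩ := k
  obtain ⟨t, g'⟩ := l
  have := hfin s.pt
  have := hfin t.pt
  obtain ⟨e₀, he₀, h, h1, -⟩ := OrbifoldAtlas.mem_inertia_emb_iff.1 he
  obtain ⟨f, hf, h2⟩ := exists_isTransition_of_mem_emb he₀
  rw [h2] at h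
  have := Finite.of_equiv _ (s.stabilizerEquivCentralizer g).symm.toEquiv
  have := Finite.of_equiv _ (t.stabilizerEquivCentralizer g').symm.toEquiv
  have h3 := (hf.inertiaSlice h h1)
  have : Finite (MulAction.stabilizer G (s.inertiaSlice g).pt) := ‹_›
  have : Finite (MulAction.stabilizer G (t.inertiaSlice g').pt) := ‹_›
  exact h3.isLocalDiffeomorph IsInducing.subtypeVal

end SliceDisc

omit [TopologicalSpace G] [TopologicalSpace M] in
theorem fixedLocus.finite_stabilizer (hfin : ∀ p : M, Finite (MulAction.stabilizer G p))
    (x : fixedLocus G M) : Finite (MulAction.stabilizer G x) := by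
  have := hfin (fixedLocus.snd x)
  have h : MulAction.stabilizer G x ≤ MulAction.stabilizer G (fixedLocus.snd x) :=
    fun g hg => congrArg fixedLocus.snd hg
  exact Finite.of_injective _ (Subgroup.inclusion_injective h)

omit [FiniteDimensional ℝ EG] [FiniteDimensional ℝ EM] [T2Space G] [LieGroup 𝓘(ℝ, EG) ∞ G]
  [IsManifold 𝓘(ℝ, EM) ∞ M] [ContinuousSMul G M] in
theorem fixedLocus.exists_sliceDisc
    (hex : ∀ p : M, ∃ s : SliceDisc (G := G) 𝓘(ℝ, EG) 𝓘(ℝ, EM) (id : M → M), s.pt = p)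
    (x : fixedLocus G M) :
    ∃ (s : SliceDisc (G := G) 𝓘(ℝ, EG) 𝓘(ℝ, EM) (id : M → M))
      (g : MulAction.stabilizer G s.pt), fixedLocus.mk (g : G) s.pt g.2 = x := by
  obtain ⟨g, p, h, rfl⟩ := fixedLocus.exists_mk x
  obtain ⟨s, rfl⟩ := hex p
  exact ⟨s, ⟨g, h⟩, rfl⟩

omit [ContinuousSMul G M] in
/-- The fixed point set is locally the image of the tube maps of its slice discs, which are
immersions into `G × M` and open as maps to the fixed point set. -/
theorem isEmbeddedSubmanifold_fixedPoints_inertiaMap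
    (hfin : ∀ p : M, Finite (MulAction.stabilizer G p))
    (hex : ∀ p : M, ∃ s : SliceDisc (G := G) 𝓘(ℝ, EG) 𝓘(ℝ, EM) (id : M → M), s.pt = p) :
    IsEmbeddedSubmanifold (𝓘(ℝ, EG).prod 𝓘(ℝ, EM)) (fixedPoints (inertiaMap G M)) := by
  intro x hx
  obtain ⟨s, g, h⟩ := fixedLocus.exists_sliceDisc hex ⟨x, hx⟩
  have := hfin s.pt
  let u := s.inertiaSlice g
  have h1 : u.tube (1, u.origin) = ⟨x, hx⟩ := by
    rw [← h]
    exact (one_smul _ _).trans u.slice_zero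
  have h2 : x = (u.tube (1, u.origin)).1 := by rw [h1]
  rw [h2]
  refine exists_chart_of_immersion u.tube_contMDiff (u.tube_immersion (1, u.origin))
    (fun z => (u.tube z).2) ?_
  intro V hV
  have h3 := u.tube_isOpenMap.image_mem_nhds hV
  rw [IsInducing.subtypeVal.nhds_eq_comap] at h3
  obtain ⟨W, hW, hWV⟩ := h3
  filter_upwards [hW] with y hy hyS
  obtain ⟨z, hz, hzy⟩ := hWV (a := ⟨y, hyS⟩) hy
  exact ⟨z, hz, congrArg Subtype.val hzy⟩

omit [FiniteDimensional ℝ EG] [FiniteDimensional ℝ EM] [IsManifold 𝓘(ℝ, EM) ∞ M]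
  [ContinuousSMul G M] in
/-- If points `(g, x)` and `(h, y)` of two slice discs of the fixed point set lie in the same
orbit, then there are a slice disc of `M` with an element of its isotropy group, and transition
maps from it that take this element and the centre to `(g, x)` and to `(h, y)`. -/
theorem exists_emb_of_smul_inertiaSliceMap_eq
    (hfin : ∀ p : M, Finite (MulAction.stabilizer G p))
    {s t : SliceDisc (G := G) 𝓘(ℝ, EG) 𝓘(ℝ, EM) (id : M → M)}
    {g : MulAction.stabilizer G s.pt} {h : MulAction.stabilizer G t.pt}
    {x : disc (fixedSubspace (s.rep g)) s.radius} {y : disc (fixedSubspace (t.rep h)) t.radius}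
    {k : G} (hk : k • s.inertiaSliceMap g x = t.inertiaSliceMap h y) :
    ∃ (u : SliceDisc (G := G) 𝓘(ℝ, EG) 𝓘(ℝ, EM) (id : M → M)) (γ : MulAction.stabilizer G u.pt),
      (∃ e ∈ (quotientAtlas (G := G) 𝓘(ℝ, EG) 𝓘(ℝ, EM) (id : M → M)).emb u s,
        e.2 γ = g ∧ e.1 u.origin = fixedIncl _ x) ∧
      ∃ e ∈ (quotientAtlas (G := G) 𝓘(ℝ, EG) 𝓘(ℝ, EM) (id : M → M)).emb u t,
        e.2 γ = h ∧ e.1 u.origin = fixedIncl _ y := by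
  obtain ⟨h1, h2⟩ := (s.smul_inertiaSliceMap_eq_iff g).1 hk
  obtain ⟨u, ψ₁, ψ₂, f, hu, hu1, hu2, hf, h₁, h₂⟩ :=
    SliceDisc.exists_common_restrict IsInducing.id hfin s t h2.symm
  refine ⟨u, ⟨g, hu ▸ s.smul_slice_fixedIncl g x⟩, ⟨_, h₁.mem_emb, Subtype.ext ?_, hu1⟩,
    ⟨_, h₂.mem_emb, Subtype.ext ?_, hu2⟩⟩
  · change (1 : G) * g * 1⁻¹ = g
    simp
  · change f u.origin * g * (f u.origin)⁻¹ = h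
    rw [hf, h1]

/-- The map `Λ(G\M) → G\Ī` sending the class of `x ∈ U^g` to the orbit of `(g, x)`. -/
def inertiaToQuotient (hfin : ∀ p : M, Finite (MulAction.stabilizer G p)) :
    (quotientAtlas (G := G) 𝓘(ℝ, EG) 𝓘(ℝ, EM) (id : M → M)).Inertia →
      MulAction.orbitRel.Quotient G (fixedLocus G M) :=
  Quot.lift (fun a => Quotient.mk _ (SliceDisc.inertiaSliceMap a.1.1 a.1.2 a.2)) (by
    rintro ⟨⟨s, g⟩, x⟩ ⟨⟨t, g'⟩, y⟩ ⟨e, he, h1, h2⟩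
    exact SliceDisc.quotient_mk_eq_iff.2
      (SliceDisc.exists_smul_inertiaSliceMap_eq_of_mem_emb hfin he h1 h2))

omit [FiniteDimensional ℝ EG] [FiniteDimensional ℝ EM] [IsManifold 𝓘(ℝ, EM) ∞ M] in
theorem inertiaToQuotient_injective (hfin : ∀ p : M, Finite (MulAction.stabilizer G p)) :
    Injective (inertiaToQuotient (EG := EG) (EM := EM) hfin) := by
  rintro ⟨⟨⟨s, g⟩, x⟩⟩ ⟨⟨⟨t, h⟩, y⟩⟩ hxy
  obtain ⟨k, hk⟩ := SliceDisc.quotient_mk_eq_iff.1 hxy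
  obtain ⟨u, γ, ⟨e, he, h1, h2⟩, ⟨e', he', h1', h2'⟩⟩ :=
    exists_emb_of_smul_inertiaSliceMap_eq hfin hk
  let o : disc (fixedSubspace (u.rep γ)) u.radius := ⟨0, Metric.mem_ball_self u.radius_pos⟩
  have h3 := Quot.sound (r := OrbifoldAtlas.InertiaRel _) (a := ⟨⟨u, γ⟩, o⟩) (b := ⟨⟨s, g⟩, x⟩)
    ⟨e, he, h1, h2⟩
  have h4 := Quot.sound (r := OrbifoldAtlas.InertiaRel _) (a := ⟨⟨u, γ⟩, o⟩) (b := ⟨⟨t, h⟩, y⟩)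
    ⟨e', he', h1', h2'⟩
  exact h3.symm.trans h4

omit [FiniteDimensional ℝ EG] [FiniteDimensional ℝ EM] [IsManifold 𝓘(ℝ, EM) ∞ M] in
theorem inertiaToQuotient_surjective (hfin : ∀ p : M, Finite (MulAction.stabilizer G p))
    (hex : ∀ p : M, ∃ s : SliceDisc (G := G) 𝓘(ℝ, EG) 𝓘(ℝ, EM) (id : M → M), s.pt = p) :
    Surjective (inertiaToQuotient (EG := EG) (EM := EM) hfin) := by
  intro q
  induction q using Quotient.inductionOn with
  | h x =>
    obtain ⟨s, g, rfl⟩ := fixedLocus.exists_sliceDisc hex x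
    have := hfin s.pt
    exact ⟨Quot.mk _ ⟨⟨s, g⟩, (s.inertiaSlice g).origin⟩,
      congrArg _ (s.inertiaSlice g).slice_zero⟩

omit [FiniteDimensional ℝ EG] [FiniteDimensional ℝ EM] [IsManifold 𝓘(ℝ, EM) ∞ M] in
theorem isHomeomorph_inertiaToQuotient (hfin : ∀ p : M, Finite (MulAction.stabilizer G p))
    (hex : ∀ p : M, ∃ s : SliceDisc (G := G) 𝓘(ℝ, EG) 𝓘(ℝ, EM) (id : M → M), s.pt = p) :
    IsHomeomorph (inertiaToQuotient (EG := EG) (EM := EM) hfin) := by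
  have : IsTopologicalGroup G := topologicalGroup_of_lieGroup 𝓘(ℝ, EG) ∞
  have h1 : ∀ k : (quotientAtlas (G := G) 𝓘(ℝ, EG) 𝓘(ℝ, EM) (id : M → M)).InertiaIndex,
      Continuous (fun x => inertiaToQuotient hfin (Quot.mk _ ⟨k, x⟩)) ∧
      IsOpenMap (fun x => inertiaToQuotient hfin (Quot.mk _ ⟨k, x⟩)) := by
    rintro ⟨s, g⟩
    have := hfin s.pt
    have := fixedLocus.finite_stabilizer hfin (s.inertiaSlice g).pt
    have h := (s.inertiaSlice g).toChart_isChart IsInducing.subtypeVal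
    exact ⟨h.continuous, h.isOpenMap⟩
  refine ⟨continuous_quot_lift _ (continuous_sigma fun k => (h1 k).1), ?_,
    inertiaToQuotient_injective hfin, inertiaToQuotient_surjective hfin hex⟩
  intro U hU
  have h2 : IsOpenMap fun a => inertiaToQuotient (EG := EG) (EM := EM) hfin (Quot.mk _ a) :=
    isOpenMap_sigma.2 fun k => (h1 k).2
  convert h2 _ (hU.preimage continuous_quot_mk) using 1
  ext q
  constructor
  · rintro ⟨⟨a⟩, ha, rfl⟩
    exact ⟨a, ha, rfl⟩
  · rintro ⟨a, ha, rfl⟩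
    exact ⟨Quot.mk _ a, ha, rfl⟩

/-- If every point of `M` has a slice disc, then the inertia orbifold of `G\M` is an orbifold. -/
theorem inertia_quotientAtlas_isOrbifold [CompactSpace G] [T2Space M] [SecondCountableTopology M]
    [SecondCountableTopology G]
    (hfin : ∀ p : M, Finite (MulAction.stabilizer G p))
    (hex : ∀ p : M, ∃ s : SliceDisc (G := G) 𝓘(ℝ, EG) 𝓘(ℝ, EM) (id : M → M), s.pt = p) :
    (quotientAtlas (G := G) 𝓘(ℝ, EG) 𝓘(ℝ, EM) (id : M → M)).inertia.IsOrbifold := by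
  have : IsTopologicalGroup G := topologicalGroup_of_lieGroup 𝓘(ℝ, EG) ∞
  have hA := SliceDisc.quotientAtlas_isOrbifold IsInducing.id hfin hex
  let Φ := (isHomeomorph_inertiaToQuotient hfin hex).homeomorph
  have : T2Space (MulAction.orbitRel.Quotient G (fixedLocus G M)) := t2Space_orbitRel_quotient G _
  have : SecondCountableTopology (fixedLocus G M) :=
    TopologicalSpace.Subtype.secondCountableTopology _
  have : SecondCountableTopology (MulAction.orbitRel.Quotient G (fixedLocus G M)) :=
    ContinuousConstSMul.secondCountableTopology
  -- The topological conditions and the charts are carried over from the quotient of `Ī` by `Φ`.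
  refine ⟨Φ.symm.t2Space, Φ.secondCountableTopology, ?_,
    fun k l e he => OrbifoldAtlas.inertia_isEmbedding hA he
      (SliceDisc.isLocalDiffeomorph_of_mem_inertia_emb hfin he), ?_, ?_,
    OrbifoldAtlas.inertia_act_mem hA,
    fun k l m e he e' he' => OrbifoldAtlas.inertia_comp_mem hA he he',
    fun k l e he e' he' => OrbifoldAtlas.inertia_unique hA he he'⟩
  · rintro ⟨s, g⟩
    have := hfin s.pt
    have := fixedLocus.finite_stabilizer hfin (s.inertiaSlice g).pt
    have h := (s.inertiaSlice g).toChart_isChart IsInducing.subtypeVal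
    have hm : ((quotientAtlas (G := G) 𝓘(ℝ, EG) 𝓘(ℝ, EM) (id : M → M)).inertiaChart ⟨s, g⟩).map =
        Φ.symm ∘ (s.inertiaSlice g).toChart.map :=
      funext fun x => (Φ.symm_apply_eq.2 rfl).symm
    refine ⟨s.radius_pos, Finite.of_injective (β := MulAction.stabilizer G s.pt)
      _ Subtype.val_injective,
      hm ▸ Φ.symm.continuous.comp h.continuous, hm ▸ Φ.symm.isOpenMap.comp h.isOpenMap, ?_⟩
    intro x y
    refine (inertiaToQuotient_injective hfin).eq_iff.symm.trans ((h.fiber x y).trans ?_)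
    exact (s.stabilizerEquivCentralizer g).toEquiv.exists_congr fun γ => Iff.rfl
  · intro q
    obtain ⟨x, hx⟩ := Quotient.exists_rep (inertiaToQuotient hfin q)
    obtain ⟨s, g, rfl⟩ := fixedLocus.exists_sliceDisc hex x
    have := hfin s.pt
    refine ⟨⟨s, g⟩, (s.inertiaSlice g).origin, rfl, inertiaToQuotient_injective hfin ?_⟩
    exact (congrArg _ (s.inertiaSlice g).slice_zero).trans hx
  · rintro ⟨s, g⟩ ⟨t, h⟩ q ⟨⟨x, rfl⟩, ⟨y, hy⟩⟩
    obtain ⟨k, hk⟩ := SliceDisc.quotient_mk_eq_iff.1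
      (congrArg (inertiaToQuotient hfin) hy.symm)
    obtain ⟨u, γ, ⟨e, he, h1, h2⟩, ⟨e', he', h1', h2'⟩⟩ :=
      exists_emb_of_smul_inertiaSliceMap_eq hfin hk
    refine ⟨⟨u, γ⟩, ⟨⟨0, Metric.mem_ball_self u.radius_pos⟩, rfl,
      Quot.sound ⟨e, he, h1, h2⟩⟩, ?_, ?_⟩
    · exact OrbifoldAtlas.exists_inertia_emb hA.isEmbedding he h1
    · exact OrbifoldAtlas.exists_inertia_emb hA.isEmbedding he' h1'

omit [FiniteDimensional ℝ EG] [FiniteDimensional ℝ EM] [IsManifold 𝓘(ℝ, EM) ∞ M] in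
/-- The slice disc `{g} × U^g` of `Ī` and the chart `U^g` of `Λ(G\M)` have the same domain, and
their groups are identified by `stabilizerEquivCentralizer`. -/
theorem orbifoldDiffeomorphic_fixedLocus_inertia
    (hfin : ∀ p : M, Finite (MulAction.stabilizer G p))
    (hex : ∀ p : M, ∃ s : SliceDisc (G := G) 𝓘(ℝ, EG) 𝓘(ℝ, EM) (id : M → M), s.pt = p) :
    OrbifoldDiffeomorphic
      (quotientAtlas (G := G) 𝓘(ℝ, EG) (𝓘(ℝ, EG).prod 𝓘(ℝ, EM))
        (Subtype.val : fixedLocus G M → ConjProd G M))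
      (quotientAtlas (G := G) 𝓘(ℝ, EG) 𝓘(ℝ, EM) (id : M → M)).inertia := by
  let Φ := (isHomeomorph_inertiaToQuotient hfin hex).homeomorph
  refine ⟨Φ.symm, fun q => ?_⟩
  induction q using Quotient.inductionOn with
  | h x =>
    obtain ⟨s, g, rfl⟩ := fixedLocus.exists_sliceDisc hex x
    have := hfin s.pt
    refine ⟨s.inertiaSlice g, ⟨s, g⟩, (s.inertiaSlice g).toChart_isCenteredAt, ?_,
      Diffeomorph.refl _ _ _, s.stabilizerEquivCentralizer g, fun γ x => rfl, fun x => ?_⟩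
    · refine ⟨(s.inertiaSlice g).origin, rfl, ?_⟩
      refine (Φ.symm_apply_eq.2 ?_).symm
      exact congrArg _ (s.inertiaSlice g).slice_zero.symm
    · exact Φ.symm_apply_eq.2 rfl

end

/-! ### Orbits of an almost free action -/

section Orbit

variable {EG EM : Type*} [NormedAddCommGroup EG] [NormedSpace ℝ EG] [FiniteDimensional ℝ EG]
  [NormedAddCommGroup EM] [NormedSpace ℝ EM]
  {G M : Type*} [Group G] [TopologicalSpace G] [T2Space G]
  [ChartedSpace EG G] [LieGroup 𝓘(ℝ, EG) ∞ G]
  [TopologicalSpace M] [ChartedSpace EM M] [IsManifold 𝓘(ℝ, EM) ∞ M]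
  [MulAction G M] [ContMDiffSMul 𝓘(ℝ, EG) 𝓘(ℝ, EM) ∞ G M]

omit [FiniteDimensional ℝ EG] [T2Space G] [IsManifold 𝓘(ℝ, EM) ∞ M] [LieGroup 𝓘(ℝ, EG) ∞ G] in
theorem contMDiff_smul_point (p : M) : ContMDiff 𝓘(ℝ, EG) 𝓘(ℝ, EM) ∞ (fun g : G => g • p) :=
  (contMDiff_smul (I := 𝓘(ℝ, EG)) (I' := 𝓘(ℝ, EM)) (n := ∞)).comp
    (contMDiff_id.prodMk contMDiff_const)

omit [FiniteDimensional ℝ EG] [T2Space G] [IsManifold 𝓘(ℝ, EM) ∞ M] in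
/-- The kernel of the derivative of the orbit map at `1` is spread by left translations: a
left-invariant vector field whose value at `1` is in the kernel is tangent to the fibres. -/
theorem mfderiv_smul_point_mulInvariantVectorField {p : M} {v : GroupLieAlgebra 𝓘(ℝ, EG) G}
    (hv : mfderiv 𝓘(ℝ, EG) 𝓘(ℝ, EM) (fun g : G => g • p) 1 v = 0) (a : G) :
    mfderiv 𝓘(ℝ, EG) 𝓘(ℝ, EM) (fun g : G => g • p) a (mulInvariantVectorField v a) = 0 := by
  have hφ : MDifferentiable 𝓘(ℝ, EG) 𝓘(ℝ, EM) (fun g : G => g • p) :=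
    (contMDiff_smul_point p).mdifferentiable (by simp)
  have hL : MDifferentiable 𝓘(ℝ, EG) 𝓘(ℝ, EG) (fun g : G => a * g) :=
    (contMDiff_mul_left (n := ∞)).mdifferentiable (by simp)
  have hA : MDifferentiable 𝓘(ℝ, EM) 𝓘(ℝ, EM) (fun q : M => a • q) :=
    (ContMDiffSMul.contMDiff_const_smul (I := 𝓘(ℝ, EG)) (n := ∞) a).mdifferentiable (by simp)
  have hφa : HasMFDerivAt 𝓘(ℝ, EG) 𝓘(ℝ, EM) (fun g : G => g • p) (a * 1)
      (mfderiv 𝓘(ℝ, EG) 𝓘(ℝ, EM) (fun g : G => g • p) (a * 1)) := (hφ _).hasMFDerivAt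
  have h1 := hφa.comp (1 : G) (hL 1).hasMFDerivAt
  have h2 := HasMFDerivAt.comp (1 : G) (hA ((1 : G) • p)).hasMFDerivAt (hφ 1).hasMFDerivAt
  have h3 : (fun g : G => g • p) ∘ (fun g : G => a * g) =
      (fun q : M => a • q) ∘ fun g : G => g • p :=
    funext fun g => mul_smul a g p
  rw [h3] at h1
  have h4 := DFunLike.congr_fun (hasMFDerivAt_unique h1 h2) v
  have h5 : mfderiv 𝓘(ℝ, EG) 𝓘(ℝ, EM) (fun g : G => g • p) (a * 1)
      (mfderiv 𝓘(ℝ, EG) 𝓘(ℝ, EG) (fun g : G => a * g) 1 v) = 0 := by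
    refine h4.trans ?_
    change mfderiv 𝓘(ℝ, EM) 𝓘(ℝ, EM) (fun q : M => a • q) ((1 : G) • p)
      (mfderiv 𝓘(ℝ, EG) 𝓘(ℝ, EM) (fun g : G => g • p) 1 v) = 0
    rw [hv, map_zero]
  have h6 : ∀ b : G, b = a * 1 → mfderiv 𝓘(ℝ, EG) 𝓘(ℝ, EM) (fun g : G => g • p) b
      (mfderiv 𝓘(ℝ, EG) 𝓘(ℝ, EG) (fun g : G => a * g) 1 v : EG) = 0 := by
    rintro _ rfl
    exact h5
  exact h6 a (mul_one a).symm

/-- If the stabilizer of `p` is finite, then the orbit map `g ↦ g p` is an immersion at `1`: the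
integral curve of a left-invariant vector field in the kernel of the derivative stays in the
stabilizer, so it is constant. -/
theorem injective_mfderiv_smul_point (p : M) [Finite (MulAction.stabilizer G p)] :
    Injective (mfderiv 𝓘(ℝ, EG) 𝓘(ℝ, EM) (fun g : G => g • p) 1) := by
  have : LieGroup 𝓘(ℝ, EG) (minSmoothness ℝ 3) G := LieGroup.of_le (n := ∞) (by
    rw [minSmoothness_of_isRCLikeNormedField]
    exact WithTop.coe_le_coe.2 (le_top (a := (3 : ℕ∞))))
  have : IsManifold 𝓘(ℝ, EG) 1 G := IsManifold.of_le (n := ∞) (by simp)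
  have : IsTopologicalGroup G := topologicalGroup_of_lieGroup 𝓘(ℝ, EG) ∞
  refine (injective_iff_map_eq_zero _).2 fun (v : GroupLieAlgebra 𝓘(ℝ, EG) G) hv => ?_
  obtain ⟨c, hc0, hc⟩ := exists_isMIntegralCurveAt_of_contMDiffAt_boundaryless (I := 𝓘(ℝ, EG))
    (v := mulInvariantVectorField v) (x₀ := (1 : G)) (t₀ := (0 : ℝ))
    ((contMDiffAt_mulInvariantVectorField v).of_le (by simp))
  have hφ : MDifferentiable 𝓘(ℝ, EG) 𝓘(ℝ, EM) (fun g : G => g • p) :=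
    (contMDiff_smul_point p).mdifferentiable (by simp)
  have hcont : ContinuousAt (fun t => c t • p) 0 :=
    (contMDiff_smul_point (EG := EG) (EM := EM) p).continuous.continuousAt.comp
      (f := c) hc.continuousAt
  -- Along the integral curve `c`, the point `c(t) p` has zero velocity in the chart at `p`.
  have hev : ∀ᶠ t in 𝓝 (0 : ℝ), HasDerivAt (fun t => extChartAt 𝓘(ℝ, EM) p (c t • p)) 0 t ∧
      c t • p ∈ (extChartAt 𝓘(ℝ, EM) p).source := by
    have h1 : ∀ᶠ t in 𝓝 (0 : ℝ), c t • p ∈ (extChartAt 𝓘(ℝ, EM) p).source :=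
      hcont.eventually ((isOpen_extChartAt_source p).mem_nhds (by
        simp only [hc0, one_smul]
        exact mem_extChartAt_source p))
    filter_upwards [hc, h1] with t ht ht1
    refine ⟨?_, ht1⟩
    have h2 := ((hφ (c t)).hasMFDerivAt).comp t ht
    have h3 := HasMFDerivAt.comp t
      ((contMDiffAt_extChartAt' (n := ∞) (by simpa using ht1)).mdifferentiableAt
        (by simp)).hasMFDerivAt h2
    have h4 : HasFDerivAt (fun t => extChartAt 𝓘(ℝ, EM) p (c t • p)) (0 : ℝ →L[ℝ] EM) t := by
      refine hasMFDerivAt_iff_hasFDerivAt.1 (h3.congr_mfderiv ?_)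
      refine ContinuousLinearMap.ext fun (r : ℝ) => ?_
      change mfderiv 𝓘(ℝ, EM) 𝓘(ℝ, EM) (extChartAt 𝓘(ℝ, EM) p) (c t • p)
        (mfderiv 𝓘(ℝ, EG) 𝓘(ℝ, EM) (fun g : G => g • p) (c t)
          (r • mulInvariantVectorField v (c t))) = 0
      rw [map_smul, mfderiv_smul_point_mulInvariantVectorField hv, smul_zero, map_zero]
    have h5 := h4.hasDerivAt
    simpa using h5
  obtain ⟨ε, hε, hball⟩ := Metric.eventually_nhds_iff_ball.1 hev
  have hstab : ∀ t ∈ Metric.ball (0 : ℝ) ε, c t ∈ MulAction.stabilizer G p := by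
    intro t ht
    have h1 := Metric.isOpen_ball.is_const_of_deriv_eq_zero
      (convex_ball (0 : ℝ) ε).isPreconnected
      (fun s hs => (hball s hs).1.differentiableAt.differentiableWithinAt)
      (fun s hs => (hball s hs).1.deriv) ht (Metric.mem_ball_self hε)
    have h2 := (extChartAt 𝓘(ℝ, EM) p).injOn (hball t ht).2
      (hball 0 (Metric.mem_ball_self hε)).2 h1
    rw [hc0, one_smul] at h2
    exact h2
  -- The stabilizer is discrete, so `c` is constant near `0`, and its velocity `v` vanishes.
  have h1 : ∀ᶠ t in 𝓝 (0 : ℝ), c t = 1 := by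
    have h2 := hc.continuousAt.tendsto
    rw [hc0] at h2
    filter_upwards [h2.eventually (MulAction.stabilizer G p).eventually_mem_imp_eq_one,
      Metric.ball_mem_nhds _ hε] with t ht1 ht2
    exact ht1 (hstab t ht2)
  have h2 := hc.hasMFDerivAt
  have h3 : HasMFDerivAt 𝓘(ℝ, ℝ) 𝓘(ℝ, EG) c 0 (0 : ℝ →L[ℝ] EG) :=
    (hasMFDerivAt_const (1 : G) (0 : ℝ)).congr_of_eventuallyEq h1
  have h4 := DFunLike.congr_fun (hasMFDerivAt_unique h2 h3) (1 : ℝ)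
  have h5 : (mulInvariantVectorField v (c 0) : EG) = 0 := by
    refine Eq.trans ?_ h4
    exact (one_smul ℝ (mulInvariantVectorField v (c 0) : EG)).symm
  rw [hc0] at h5
  have h6 : mfderiv 𝓘(ℝ, EG) 𝓘(ℝ, EG) (fun g : G => 1 * g) 1 = ContinuousLinearMap.id ℝ EG :=
    ((hasMFDerivAt_id (1 : G)).congr_of_eventuallyEq (Eventually.of_forall one_mul)).mfderiv
  exact (DFunLike.congr_fun h6 v).symm.trans h5

end Orbit

/-! ### Equivariant linear charts -/

section InvariantSubspace

variable {E : Type} [NormedAddCommGroup E] [InnerProductSpace ℝ E] {Γ : Type*} [Group Γ]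
  (ρ : Γ →* (E ≃ₗᵢ[ℝ] E))

theorem map_inv_map_apply (γ : Γ) (x : E) : ρ γ⁻¹ (ρ γ x) = x := by
  change (ρ γ⁻¹ * ρ γ) x = x
  rw [← map_mul, inv_mul_cancel, map_one]
  rfl

theorem map_map_inv_apply (γ : Γ) (x : E) : ρ γ (ρ γ⁻¹ x) = x := by
  change (ρ γ * ρ γ⁻¹) x = x
  rw [← map_mul, mul_inv_cancel, map_one]
  rfl

/-- The restriction of an orthogonal representation to an invariant subspace. -/
def invariantRep (W : Submodule ℝ E) (hW : ∀ γ, ∀ x ∈ W, ρ γ x ∈ W) : Γ →* (W ≃ₗᵢ[ℝ] W) where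
  toFun γ :=
    { toFun := fun x => ⟨ρ γ x, hW γ x x.2⟩
      map_add' := fun x y => Subtype.ext (map_add (ρ γ) (x : E) (y : E))
      map_smul' := fun c x => Subtype.ext (map_smul (ρ γ) c (x : E))
      invFun := fun x => ⟨ρ γ⁻¹ x, hW γ⁻¹ x x.2⟩
      left_inv := fun x => Subtype.ext (map_inv_map_apply ρ γ x)
      right_inv := fun x => Subtype.ext (map_map_inv_apply ρ γ x)
      norm_map' := fun x => (ρ γ).norm_map (x : E) }
  map_one' := by
    ext x
    change ρ (1 : Γ) (x : E) = x
    rw [map_one]; rfl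
  map_mul' a b := by
    ext x
    change ρ (a * b) (x : E) = ρ a (ρ b x)
    rw [map_mul]; rfl

theorem coe_invariantRep_apply (W : Submodule ℝ E) (hW : ∀ γ, ∀ x ∈ W, ρ γ x ∈ W) (γ : Γ) (x : W) :
    (invariantRep ρ W hW γ x : E) = ρ γ x := rfl

theorem map_mem_orthogonal {W : Submodule ℝ E} (hW : ∀ γ, ∀ x ∈ W, ρ γ x ∈ W) (γ : Γ) :
    ∀ x ∈ Wᗮ, ρ γ x ∈ Wᗮ := by
  intro x hx
  rw [Submodule.mem_orthogonal] at hx ⊢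
  intro w hw
  rw [← map_map_inv_apply ρ γ w, LinearIsometryEquiv.inner_map_map]
  exact hx _ (hW _ _ hw)

theorem orthogonalProjectionOnto_map [FiniteDimensional ℝ E] {W : Submodule ℝ E}
    (hW : ∀ γ, ∀ x ∈ W, ρ γ x ∈ W) (γ : Γ) (x : E) :
    W.orthogonalProjectionOnto (ρ γ x) =
      invariantRep ρ W hW γ (W.orthogonalProjectionOnto x) := by
  refine Subtype.ext (Submodule.eq_starProjection_of_mem_orthogonal ?_ ?_)
  · exact hW _ _ (W.orthogonalProjectionOnto x).2
  · rw [coe_invariantRep_apply, ← map_sub]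
    exact map_mem_orthogonal ρ hW γ _ (Submodule.sub_starProjection_mem_orthogonal x)

/-- The permutation representation of a finite group `Γ` on the space of families of vectors of
`F` indexed by `Γ`. The elements of `Γ` are numbered by `e`, so that the space lies in the lowest
universe. -/
noncomputable def permRep {m : ℕ} (e : Γ ≃ Fin m) (F : Type) [NormedAddCommGroup F]
    [InnerProductSpace ℝ F] :
    Γ →* (PiLp 2 (fun _ : Fin m => F) ≃ₗᵢ[ℝ] PiLp 2 (fun _ : Fin m => F)) where
  toFun γ := LinearIsometryEquiv.piLpCongrLeft 2 ℝ F (e.symm.trans ((Equiv.mulLeft γ).trans e))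
  map_one' := by
    ext x i
    change x (e ((1 : Γ)⁻¹ * e.symm i)) = x i
    simp
  map_mul' a b := by
    ext x i
    change x (e ((a * b)⁻¹ * e.symm i)) = x (e (b⁻¹ * e.symm (e (a⁻¹ * e.symm i))))
    simp [mul_assoc]

theorem permRep_apply {m : ℕ} (e : Γ ≃ Fin m) (F : Type) [NormedAddCommGroup F]
    [InnerProductSpace ℝ F] (γ : Γ) (x : PiLp 2 (fun _ : Fin m => F)) (i : Fin m) :
    permRep e F γ x i = x (e (γ⁻¹ * e.symm i)) := rfl

end InvariantSubspace

section LinearChart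

variable {EM : Type*} [NormedAddCommGroup EM] [NormedSpace ℝ EM] [FiniteDimensional ℝ EM]
  {G M : Type*} [Group G] [TopologicalSpace M] [ChartedSpace EM M] [IsManifold 𝓘(ℝ, EM) ∞ M]
  [MulAction G M]

/-- A map from `M` to an orthogonal representation of the finite stabilizer of `p` that is
equivariant, and an immersion at `p`: the family of all translates of a chart. -/
theorem exists_equivariant_immersion
    (hsm : ∀ a : G, ContMDiff 𝓘(ℝ, EM) 𝓘(ℝ, EM) ∞ fun q : M => a • q)
    (p : M) [Finite (MulAction.stabilizer G p)] :
    ∃ (K : Type) (_ : NormedAddCommGroup K) (_ : InnerProductSpace ℝ K)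
      (_ : FiniteDimensional ℝ K) (ρ : MulAction.stabilizer G p →* (K ≃ₗᵢ[ℝ] K)) (κ : M → K)
      (O : Set M), IsOpen O ∧ p ∈ O ∧ ContMDiffOn 𝓘(ℝ, EM) 𝓘(ℝ, K) ∞ κ O ∧ κ p = 0 ∧
      (∀ (γ : MulAction.stabilizer G p) (q : M), κ ((γ : G) • q) = ρ γ (κ q)) ∧
      Injective (mfderiv 𝓘(ℝ, EM) 𝓘(ℝ, K) κ p) := by
  obtain ⟨m, ⟨e⟩⟩ := Finite.exists_equiv_fin (MulAction.stabilizer G p)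
  let F := EuclideanSpace ℝ (Fin (Module.finrank ℝ EM))
  set c := extChartPartialDiffeomorph 𝓘(ℝ, EM) p with hc
  have hpc : p ∈ c.source := mem_extChartAt_source p
  let ℓ : EM ≃L[ℝ] F := toEuclidean
  let κ : M → PiLp 2 (fun _ : Fin m => F) := fun q => WithLp.toLp 2 fun i =>
    ℓ (c (((e.symm i)⁻¹ : MulAction.stabilizer G p) • q)) - ℓ (c p)
  have hκ : ∀ q i, κ q i = ℓ (c (((e.symm i)⁻¹ : MulAction.stabilizer G p) • q)) - ℓ (c p) :=
    fun q i => rfl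
  let O : Set M := ⋂ i : Fin m, (fun q : M =>
    ((e.symm i)⁻¹ : MulAction.stabilizer G p) • q) ⁻¹' c.source
  have hO : IsOpen O := isOpen_iInter_of_finite fun i =>
    c.open_source.preimage (hsm (((e.symm i)⁻¹ : MulAction.stabilizer G p) : G)).continuous
  have hpO : p ∈ O := by
    refine mem_iInter.2 fun i => ?_
    have h : ((e.symm i)⁻¹ : MulAction.stabilizer G p) • p = p := (e.symm i)⁻¹.2
    simp only [mem_preimage, h]
    exact hpc
  have hκO : ContMDiffOn 𝓘(ℝ, EM) 𝓘(ℝ, PiLp 2 (fun _ : Fin m => F)) ∞ κ O := by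
    have h1 : ContMDiffOn 𝓘(ℝ, EM) 𝓘(ℝ, Fin m → F) ∞ (fun q i =>
        ℓ (c (((e.symm i)⁻¹ : MulAction.stabilizer G p) • q)) - ℓ (c p)) O := by
      refine contMDiffOn_pi_space.2 fun i => ContMDiffOn.sub ?_ contMDiffOn_const
      refine ℓ.contDiff.contMDiff.comp_contMDiffOn ?_
      exact c.contMDiffOn.comp (hsm (((e.symm i)⁻¹ : MulAction.stabilizer G p) : G)).contMDiffOn
        fun q hq => mem_iInter.1 hq i
    let S := (PiLp.continuousLinearEquiv 2 ℝ (fun _ : Fin m => F)).symm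
    exact S.contDiff.contMDiff.comp_contMDiffOn h1
  refine ⟨_, _, _, inferInstance, permRep e F, κ, O, hO, hpO, hκO, ?_, ?_, ?_⟩
  · refine PiLp.ext fun i => ?_
    have h : ((e.symm i)⁻¹ : MulAction.stabilizer G p) • p = p := (e.symm i)⁻¹.2
    rw [hκ, h, sub_self]
    rfl
  · intro γ q
    refine PiLp.ext fun i => ?_
    rw [permRep_apply, hκ, hκ, e.symm_apply_apply]
    congr 3
    change (e.symm i)⁻¹ • γ • q = (γ⁻¹ * e.symm i)⁻¹ • q
    rw [smul_smul, mul_inv_rev, inv_inv]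
  -- The component of `κ` at the unit of the stabilizer is the chart itself, up to a translation.
  · let P := PiLp.proj (𝕜 := ℝ) 2 (fun _ : Fin m => F) (e 1)
    have h1 : HasMFDerivAt 𝓘(ℝ, EM) 𝓘(ℝ, F) (P ∘ κ) p _ := HasMFDerivAt.comp p P.hasMFDerivAt
      ((hκO.contMDiffAt (hO.mem_nhds hpO)).mdifferentiableAt (by simp)).hasMFDerivAt
    let A : F → F := fun y => y - ℓ (c p)
    have hA : HasMFDerivAt 𝓘(ℝ, F) 𝓘(ℝ, F) A (ℓ (c p)) (ContinuousLinearMap.id ℝ F) :=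
      ((hasFDerivAt_id _).sub_const _).hasMFDerivAt
    have hcp : MDifferentiableAt 𝓘(ℝ, EM) 𝓘(ℝ, EM) c p :=
      (c.contMDiffOn.contMDiffAt (c.open_source.mem_nhds hpc)).mdifferentiableAt (by simp)
    have h2 : HasMFDerivAt 𝓘(ℝ, EM) 𝓘(ℝ, F) (A ∘ ℓ ∘ c) p _ :=
      hA.comp p (HasMFDerivAt.comp p (ℓ : EM →L[ℝ] F).hasMFDerivAt hcp.hasMFDerivAt)
    have h3 : P ∘ κ = A ∘ ℓ ∘ c := by
      funext q
      change κ q (e 1) = _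
      rw [hκ, e.symm_apply_apply, inv_one, one_smul]
      rfl
    rw [h3] at h1
    have h4 := hasMFDerivAt_unique h1 h2
    have h5 : Injective (mfderiv 𝓘(ℝ, EM) 𝓘(ℝ, EM) c p) :=
      injective_mfderiv_of_isLocalDiffeomorphAt
        (PartialDiffeomorph.isLocalDiffeomorphAt _ _ _ c hpc)
    intro a b hab
    refine h5 (ℓ.injective ?_)
    refine (DFunLike.congr_fun h4 a).symm.trans (Eq.trans ?_ (DFunLike.congr_fun h4 b))
    exact congrArg P hab

/-- An equivariant local diffeomorphism at `p` from `M` to an orthogonal representation of the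
finite stabilizer of `p`: an equivariant immersion, projected orthogonally onto the image of its
derivative at `p`. -/
theorem exists_equivariant_chart
    (hsm : ∀ a : G, ContMDiff 𝓘(ℝ, EM) 𝓘(ℝ, EM) ∞ fun q : M => a • q)
    (p : M) [Finite (MulAction.stabilizer G p)] :
    ∃ (H : Type) (_ : NormedAddCommGroup H) (_ : InnerProductSpace ℝ H)
      (_ : FiniteDimensional ℝ H) (ρ : MulAction.stabilizer G p →* (H ≃ₗᵢ[ℝ] H)) (Λ : M → H),
      Λ p = 0 ∧ (∀ (γ : MulAction.stabilizer G p) (q : M), Λ ((γ : G) • q) = ρ γ (Λ q)) ∧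
      IsLocalDiffeomorphAt 𝓘(ℝ, EM) 𝓘(ℝ, H) ∞ Λ p := by
  obtain ⟨K, _, _, _, ρ, κ, O, hO, hpO, hκ, hκp, heq, hinj⟩ := exists_equivariant_immersion hsm p
  let D : EM →L[ℝ] K := mfderiv 𝓘(ℝ, EM) 𝓘(ℝ, K) κ p
  have hD : HasMFDerivAt 𝓘(ℝ, EM) 𝓘(ℝ, K) κ p D :=
    ((hκ.contMDiffAt (hO.mem_nhds hpO)).mdifferentiableAt (by simp)).hasMFDerivAt
  let H : Submodule ℝ K := LinearMap.range D.toLinearMap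
  have hH : ∀ γ, ∀ x ∈ H, ρ γ x ∈ H := by
    rintro γ _ ⟨v, rfl⟩
    have h1 : HasMFDerivAt 𝓘(ℝ, EM) 𝓘(ℝ, EM) (fun q : M => (γ : G) • q) p _ :=
      ((hsm γ).mdifferentiable (by simp) p).hasMFDerivAt
    have h2 : (γ : G) • p = p := γ.2
    have h3 : HasMFDerivAt 𝓘(ℝ, EM) 𝓘(ℝ, K) κ ((γ : G) • p) D := h2.symm ▸ hD
    have h4 := h3.comp p h1
    have h5 := HasMFDerivAt.comp p (I'' := 𝓘(ℝ, K))
      ((ρ γ).toContinuousLinearEquiv : K →L[ℝ] K).hasMFDerivAt hD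
    have h6 : κ ∘ (fun q : M => (γ : G) • q) =
        ((ρ γ).toContinuousLinearEquiv : K →L[ℝ] K) ∘ κ := funext (heq γ)
    rw [h6] at h4
    exact ⟨_, DFunLike.congr_fun (hasMFDerivAt_unique h4 h5) v⟩
  refine ⟨H, inferInstance, inferInstance, inferInstance, invariantRep ρ H hH,
    H.orthogonalProjectionOnto ∘ κ, ?_, fun γ q => ?_, ?_⟩
  · rw [comp_apply, hκp, map_zero]
  · rw [comp_apply, heq, orthogonalProjectionOnto_map ρ hH, comp_apply]
  · refine isLocalDiffeomorphAt_of_bijective_mfderiv hO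
      (H.orthogonalProjectionOnto.contDiff.contMDiff.comp_contMDiffOn hκ) hpO ?_
    have h1 : HasMFDerivAt 𝓘(ℝ, EM) 𝓘(ℝ, H) (H.orthogonalProjectionOnto ∘ κ) p
        (H.orthogonalProjectionOnto ∘L D) :=
      HasMFDerivAt.comp p H.orthogonalProjectionOnto.hasMFDerivAt hD
    rw [h1.mfderiv]
    have h2 : ∀ v : EM, H.orthogonalProjectionOnto (D v) = ⟨D v, v, rfl⟩ := fun v =>
      H.orthogonalProjectionOnto_mem_subspace_eq_self ⟨D v, v, rfl⟩
    constructor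
    · intro (a : EM) (b : EM) hab
      have h3 : (⟨D a, a, rfl⟩ : H) = ⟨D b, b, rfl⟩ := (h2 a).symm.trans (hab.trans (h2 b))
      exact hinj (congrArg Subtype.val h3)
    · rintro ⟨_, v, rfl⟩
      exact ⟨v, h2 v⟩

end LinearChart

/-! ### The slice theorem -/

section Slice

variable {EG EM : Type*} [NormedAddCommGroup EG] [NormedSpace ℝ EG] [FiniteDimensional ℝ EG]
  [NormedAddCommGroup EM] [NormedSpace ℝ EM] [FiniteDimensional ℝ EM]
  {G M : Type*} [Group G] [TopologicalSpace G] [T2Space G]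
  [ChartedSpace EG G] [LieGroup 𝓘(ℝ, EG) ∞ G]
  [TopologicalSpace M] [ChartedSpace EM M] [IsManifold 𝓘(ℝ, EM) ∞ M]
  [MulAction G M] [ContMDiffSMul 𝓘(ℝ, EG) 𝓘(ℝ, EM) ∞ G M]

omit [FiniteDimensional ℝ EG] [FiniteDimensional ℝ EM] [T2Space G] [TopologicalSpace M]
  [IsManifold 𝓘(ℝ, EM) ∞ M] in
/-- The image of the tangent space of the orbit under an equivariant chart is invariant. -/
theorem map_mem_range_mfderiv_orbit {p : M} {H : Type} [NormedAddCommGroup H]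
    [InnerProductSpace ℝ H] {ρ : MulAction.stabilizer G p →* (H ≃ₗᵢ[ℝ] H)} {Λ : M → H}
    (heq : ∀ (γ : MulAction.stabilizer G p) (q : M), Λ ((γ : G) • q) = ρ γ (Λ q))
    {D : EG →L[ℝ] H} (hD : HasMFDerivAt 𝓘(ℝ, EG) 𝓘(ℝ, H) (fun g : G => Λ (g • p)) 1 D)
    (γ : MulAction.stabilizer G p) :
    ∀ x ∈ LinearMap.range D.toLinearMap, ρ γ x ∈ LinearMap.range D.toLinearMap := by
  rintro _ ⟨v, rfl⟩
  have h1 : HasMFDerivAt 𝓘(ℝ, EG) 𝓘(ℝ, EG) (fun g : G => γ * g * (γ : G)⁻¹) 1 _ :=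
    (((contMDiff_const.mul contMDiff_id).mul contMDiff_const).mdifferentiable
      (n := ∞) (by simp) 1).hasMFDerivAt
  have h2 : (γ : G) * 1 * (γ : G)⁻¹ = 1 := by simp
  have h3 : HasMFDerivAt 𝓘(ℝ, EG) 𝓘(ℝ, H) (fun g : G => Λ (g • p)) (γ * 1 * (γ : G)⁻¹) D :=
    h2.symm ▸ hD
  have h4 := h3.comp (1 : G) h1
  have h5 := HasMFDerivAt.comp (1 : G) (I'' := 𝓘(ℝ, H))
    ((ρ γ).toContinuousLinearEquiv : H →L[ℝ] H).hasMFDerivAt hD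
  have h6 : (fun g : G => Λ (g • p)) ∘ (fun g : G => γ * g * (γ : G)⁻¹) =
      ((ρ γ).toContinuousLinearEquiv : H →L[ℝ] H) ∘ fun g : G => Λ (g • p) := by
    funext g
    have h7 : (γ : G)⁻¹ • p = p := (γ⁻¹).2
    change Λ ((γ * g * (γ : G)⁻¹) • p) = ρ γ (Λ (g • p))
    rw [mul_smul, mul_smul, h7, heq]
  rw [h6] at h4
  exact ⟨_, DFunLike.congr_fun (hasMFDerivAt_unique h4 h5) v⟩

/-- The orthogonal complement of the tangent space of the orbit, in an equivariant chart at `p`, is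
a germ of a slice. -/
theorem exists_local_slice (p : M) [Finite (MulAction.stabilizer G p)] :
    ∃ (E : Type) (_ : NormedAddCommGroup E) (_ : InnerProductSpace ℝ E)
      (_ : FiniteDimensional ℝ E) (ρ : MulAction.stabilizer G p →* (E ≃ₗᵢ[ℝ] E)) (σ : E → M),
      σ 0 = p ∧
      (∀ᶠ x in 𝓝 (0 : E), ∀ γ : MulAction.stabilizer G p, σ (ρ γ x) = (γ : G) • σ x) ∧
      IsLocalDiffeomorphAt (𝓘(ℝ, EG).prod 𝓘(ℝ, E)) 𝓘(ℝ, EM) ∞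
        (fun z : G × E => z.1 • σ z.2) (1, 0) := by
  have hsm : ∀ a : G, ContMDiff 𝓘(ℝ, EM) 𝓘(ℝ, EM) ∞ fun q : M => a • q := fun a =>
    ContMDiffSMul.contMDiff_const_smul (I := 𝓘(ℝ, EG)) (n := ∞) a
  obtain ⟨H, _, _, _, ρ, Λ, hΛp, heq, Φ, hpΦ, hΦ⟩ := exists_equivariant_chart hsm p
  have hΦp : Φ p = 0 := by rw [← hΦ hpΦ, hΛp]
  have hΛ : ContMDiffOn 𝓘(ℝ, EM) 𝓘(ℝ, H) ∞ Λ Φ.source := Φ.contMDiffOn.congr hΦ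
  have hΛloc : IsLocalDiffeomorphAt 𝓘(ℝ, EM) 𝓘(ℝ, H) ∞ Λ p := ⟨Φ, hpΦ, hΦ⟩
  have hΛd : MDifferentiableAt 𝓘(ℝ, EM) 𝓘(ℝ, H) Λ p :=
    (hΛ.contMDiffAt (Φ.open_source.mem_nhds hpΦ)).mdifferentiableAt (by simp)
  have hφ := contMDiff_smul_point (EG := EG) (EM := EM) (G := G) p
  have hφd : MDifferentiableAt 𝓘(ℝ, EG) 𝓘(ℝ, EM) (fun g : G => g • p) 1 :=
    hφ.mdifferentiable (by simp) 1
  have h1p : (fun g : G => g • p) 1 = p := one_smul G p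
  have hΛd' : MDifferentiableAt 𝓘(ℝ, EM) 𝓘(ℝ, H) Λ ((fun g : G => g • p) 1) := h1p.symm ▸ hΛd
  have hΛloc' : IsLocalDiffeomorphAt 𝓘(ℝ, EM) 𝓘(ℝ, H) ∞ Λ ((fun g : G => g • p) 1) :=
    h1p.symm ▸ hΛloc
  let D : EG →L[ℝ] H := mfderiv 𝓘(ℝ, EG) 𝓘(ℝ, H) (fun g : G => Λ (g • p)) 1
  have hD : HasMFDerivAt 𝓘(ℝ, EG) 𝓘(ℝ, H) (fun g : G => Λ (g • p)) 1 D :=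
    (hΛd'.comp 1 hφd).hasMFDerivAt
  have hDinj : Injective D := by
    have h1 := hasMFDerivAt_unique hD (HasMFDerivAt.comp (1 : G) hΛd'.hasMFDerivAt hφd.hasMFDerivAt)
    intro a b hab
    refine injective_mfderiv_smul_point p (injective_mfderiv_of_isLocalDiffeomorphAt hΛloc' ?_)
    exact (DFunLike.congr_fun h1 a).symm.trans (hab.trans (DFunLike.congr_fun h1 b))
  let V : Submodule ℝ H := LinearMap.range D.toLinearMap
  have hV : ∀ γ, ∀ x ∈ V, ρ γ x ∈ V := map_mem_range_mfderiv_orbit heq hD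
  let σ : Vᗮ → M := fun x => Φ.symm (x : H)
  have hσ0 : σ 0 = p := by
    change Φ.symm ((0 : Vᗮ) : H) = p
    rw [Submodule.coe_zero, ← hΦp]
    exact Φ.left_inv hpΦ
  have h0 : ((0 : Vᗮ) : H) ∈ Φ.target := by
    rw [Submodule.coe_zero, ← hΦp]
    exact Φ.map_source hpΦ
  have hval : ContDiff ℝ ∞ (Subtype.val : Vᗮ → H) := Vᗮ.subtypeL.contDiff
  have hσ : ContMDiffOn 𝓘(ℝ, Vᗮ) 𝓘(ℝ, EM) ∞ σ (Subtype.val ⁻¹' Φ.target) :=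
    Φ.symm.contMDiffOn.comp hval.contMDiff.contMDiffOn fun x hx => hx
  have hto : IsOpen (Subtype.val ⁻¹' Φ.target : Set Vᗮ) := Φ.open_target.preimage hval.continuous
  refine ⟨Vᗮ, inferInstance, inferInstance, inferInstance,
    invariantRep ρ Vᗮ (map_mem_orthogonal ρ hV), σ, hσ0, ?_, ?_⟩
  · have hσc : ContinuousAt σ 0 := hσ.continuousOn.continuousAt (hto.mem_nhds h0)
    have h1 : ∀ γ : MulAction.stabilizer G p, ∀ᶠ x in 𝓝 (0 : Vᗮ), (γ : G) • σ x ∈ Φ.source := by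
      intro γ
      have h2 : ContinuousAt (fun x => (γ : G) • σ x) 0 :=
        (hsm γ).continuous.continuousAt.comp hσc
      refine h2.eventually (Φ.open_source.mem_nhds ?_)
      have h3 : (γ : G) • p = p := γ.2
      simpa only [hσ0, h3] using hpΦ
    filter_upwards [hto.mem_nhds h0, eventually_all.2 h1] with x hx hx1 γ
    have h3 : Φ (σ x) = x := Φ.right_inv hx
    have h4 : σ x ∈ Φ.source := Φ.map_target hx
    have h5 : Φ ((γ : G) • σ x) = ρ γ x := by rw [← hΦ (hx1 γ), heq, hΦ h4, h3]
    change Φ.symm (ρ γ x) = _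
    rw [← h5]
    exact Φ.left_inv (hx1 γ)
  · have hs : IsOpen (univ ×ˢ (Subtype.val ⁻¹' Φ.target) : Set (G × Vᗮ)) := isOpen_univ.prod hto
    have hF : ContMDiffOn (𝓘(ℝ, EG).prod 𝓘(ℝ, Vᗮ)) 𝓘(ℝ, EM) ∞
        (fun z : G × Vᗮ => z.1 • σ z.2) (univ ×ˢ (Subtype.val ⁻¹' Φ.target)) :=
      (contMDiff_smul (I := 𝓘(ℝ, EG)) (I' := 𝓘(ℝ, EM)) (n := ∞)).comp_contMDiffOn
        (contMDiffOn_fst.prodMk (hσ.comp contMDiffOn_snd fun z hz => hz.2))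
    have h10 : ((1, 0) : G × Vᗮ) ∈ (univ ×ˢ (Subtype.val ⁻¹' Φ.target) : Set (G × Vᗮ)) :=
      ⟨mem_univ _, h0⟩
    refine isLocalDiffeomorphAt_of_bijective_mfderiv hs hF h10 ?_
    have hFd : MDifferentiableAt (𝓘(ℝ, EG).prod 𝓘(ℝ, Vᗮ)) 𝓘(ℝ, EM)
        (fun z : G × Vᗮ => z.1 • σ z.2) (1, 0) :=
      (hF.contMDiffAt (hs.mem_nhds h10)).mdifferentiableAt (by simp)
    have hF0 : (fun z : G × Vᗮ => z.1 • σ z.2) (1, 0) = p := by simp [hσ0]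
    have hΛd2 : MDifferentiableAt 𝓘(ℝ, EM) 𝓘(ℝ, H) Λ
      ((fun z : G × Vᗮ => z.1 • σ z.2) (1, 0)) := hF0.symm ▸ hΛd
    have hΛloc2 : IsLocalDiffeomorphAt 𝓘(ℝ, EM) 𝓘(ℝ, H) ∞ Λ
      ((fun z : G × Vᗮ => z.1 • σ z.2) (1, 0)) := hF0.symm ▸ hΛloc
    have hcomp := hΛd2.comp (1, 0) hFd
    -- In the chart, the derivative of `(g, x) ↦ g σ(x)` is `(v, w) ↦ D v + w`.
    have e1 : mfderiv 𝓘(ℝ, EG) 𝓘(ℝ, H) (fun g : G => Λ (g • σ 0)) 1 = D := by rw [hσ0]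
    have e2 : mfderiv 𝓘(ℝ, Vᗮ) 𝓘(ℝ, H) (fun x : Vᗮ => Λ ((1 : G) • σ x)) 0 = Vᗮ.subtypeL := by
      refine HasMFDerivAt.mfderiv (HasMFDerivAt.congr_of_eventuallyEq
        (Vᗮ.subtypeL.hasMFDerivAt (x := 0)) ?_)
      filter_upwards [hto.mem_nhds h0] with x hx
      have h3 : Φ (σ x) = x := Φ.right_inv hx
      have h4 : σ x ∈ Φ.source := Φ.map_target hx
      rw [one_smul, hΦ h4, h3]
      rfl
    have hder : ∀ v : EG × Vᗮ, mfderiv (𝓘(ℝ, EG).prod 𝓘(ℝ, Vᗮ)) 𝓘(ℝ, H)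
        (Λ ∘ fun z : G × Vᗮ => z.1 • σ z.2) (1, 0) v = D v.1 + (v.2 : H) := fun v =>
      (mfderiv_prod_eq_add_apply hcomp).trans (congrArg₂ (fun a b : H => a + b)
        (DFunLike.congr_fun e1 v.1) (DFunLike.congr_fun e2 v.2))
    let T : EG × Vᗮ →L[ℝ] EM := mfderiv (𝓘(ℝ, EG).prod 𝓘(ℝ, Vᗮ)) 𝓘(ℝ, EM)
      (fun z : G × Vᗮ => z.1 • σ z.2) (1, 0)
    let S : EM →L[ℝ] H := mfderiv 𝓘(ℝ, EM) 𝓘(ℝ, H) Λ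
      ((fun z : G × Vᗮ => z.1 • σ z.2) (1, 0))
    have hS : Injective S := injective_mfderiv_of_isLocalDiffeomorphAt hΛloc2
    have hST : ∀ v, S (T v) = D v.1 + (v.2 : H) := fun v =>
      (DFunLike.congr_fun (mfderiv_comp (1, 0) hΛd2 hFd) v).symm.trans (hder v)
    -- The projection to the tangent space `V` of the orbit recovers the first summand.
    have hdec : ∀ v : EG × Vᗮ, V.orthogonalProjectionOnto (D v.1 + (v.2 : H)) = ⟨D v.1, v.1, rfl⟩ :=
      fun v => by
        rw [map_add, Submodule.orthogonalProjectionOnto_apply_of_mem_orthogonal v.2.2, add_zero]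
        exact V.orthogonalProjectionOnto_mem_subspace_eq_self ⟨D v.1, v.1, rfl⟩
    change Bijective T
    constructor
    · intro v w hvw
      have h1 : D v.1 + (v.2 : H) = D w.1 + (w.2 : H) := by rw [← hST, ← hST, hvw]
      have h2 : D v.1 = D w.1 :=
        congrArg Subtype.val ((hdec v).symm.trans ((congrArg _ h1).trans (hdec w)))
      rw [h2] at h1
      exact Prod.ext (hDinj h2) (Subtype.ext (add_left_cancel h1))
    · intro w
      obtain ⟨a, ha⟩ := (V.orthogonalProjectionOnto (S w)).2
      refine ⟨(a, ⟨_, V.sub_starProjection_mem_orthogonal (S w)⟩), hS ?_⟩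
      rw [hST]
      change D a = _ at ha
      rw [ha]
      exact add_sub_cancel _ _

end Slice

section SliceTheorem

variable {EG EM : Type*} [NormedAddCommGroup EG] [NormedSpace ℝ EG]
  [NormedAddCommGroup EM] [NormedSpace ℝ EM]
  {G M : Type*} [Group G] [TopologicalSpace G]
  [ChartedSpace EG G] [LieGroup 𝓘(ℝ, EG) ∞ G]
  [TopologicalSpace M] [ChartedSpace EM M]
  [MulAction G M] [ContMDiffSMul 𝓘(ℝ, EG) 𝓘(ℝ, EM) ∞ G M]

/-- By equivariance under left translations, it is enough to check at `(1, x)` that the map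
`(g, x) ↦ g σ(x)` is a local diffeomorphism. -/
theorem isLocalDiffeomorphAt_smul_of_one {E : Type} [NormedAddCommGroup E] [InnerProductSpace ℝ E]
    {σ : E → M} {x : E} (h : IsLocalDiffeomorphAt (𝓘(ℝ, EG).prod 𝓘(ℝ, E)) 𝓘(ℝ, EM) ∞
      (fun z : G × E => z.1 • σ z.2) (1, x)) (g : G) :
    IsLocalDiffeomorphAt (𝓘(ℝ, EG).prod 𝓘(ℝ, E)) 𝓘(ℝ, EM) ∞
      (fun z : G × E => z.1 • σ z.2) (g, x) := by
  let ℓ : Diffeomorph 𝓘(ℝ, EG) 𝓘(ℝ, EG) G G ∞ := Diffeomorph.smul 𝓘(ℝ, EG) 𝓘(ℝ, EG) ∞ g⁻¹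
  let L := ℓ.prodCongr (Diffeomorph.refl 𝓘(ℝ, E) E ∞)
  have h1 : (fun z : G × E => z.1 • σ z.2) =
      (Diffeomorph.smul 𝓘(ℝ, EG) 𝓘(ℝ, EM) ∞ g : M → M) ∘
        ((fun z : G × E => z.1 • σ z.2) ∘ L) := by
    funext z
    change z.1 • σ z.2 = g • (g⁻¹ * z.1) • σ z.2
    rw [smul_smul, mul_inv_cancel_left]
  have h2 : L (g, x) = (1, x) :=
    Prod.ext (inv_mul_cancel g) rfl
  rw [h1]
  refine IsLocalDiffeomorphAt.comp (hf := IsLocalDiffeomorphAt.comp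
    (hf := Diffeomorph.isLocalDiffeomorph _ (g, x)) (hg := ?_))
    (hg := Diffeomorph.isLocalDiffeomorph _ _)
  rw [h2]
  exact h

end SliceTheorem

section SliceTheorem

variable {EG EM : Type*} [NormedAddCommGroup EG] [NormedSpace ℝ EG]
  [NormedAddCommGroup EM] [NormedSpace ℝ EM]
  {G M : Type*} [Group G] [TopologicalSpace G] [CompactSpace G]
  [ChartedSpace EG G] [LieGroup 𝓘(ℝ, EG) ∞ G]
  [TopologicalSpace M] [T2Space M] [ChartedSpace EM M]
  [MulAction G M] [ContMDiffSMul 𝓘(ℝ, EG) 𝓘(ℝ, EM) ∞ G M]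

/-- By compactness of `G`, the translates of a small enough piece of a germ of a slice meet it only
as prescribed by the stabilizer. -/
theorem eventually_smul_eq_imp {p : M} {E : Type}
    [NormedAddCommGroup E] [InnerProductSpace ℝ E]
    {ρ : MulAction.stabilizer G p →* (E ≃ₗᵢ[ℝ] E)} {σ : E → M} (hσ : σ 0 = p)
    (heq : ∀ᶠ x in 𝓝 (0 : E), ∀ γ : MulAction.stabilizer G p, σ (ρ γ x) = (γ : G) • σ x)
    (hloc : IsLocalDiffeomorphAt (𝓘(ℝ, EG).prod 𝓘(ℝ, E)) 𝓘(ℝ, EM) ∞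
      (fun z : G × E => z.1 • σ z.2) (1, 0)) :
    ∃ r > 0, ∀ x ∈ Metric.ball (0 : E) r, ∀ y ∈ Metric.ball (0 : E) r, ∀ k : G,
      k • σ x = σ y → ∃ γ : MulAction.stabilizer G p, k = γ ∧ y = ρ γ x := by
  have : IsTopologicalGroup G := topologicalGroup_of_lieGroup 𝓘(ℝ, EG) ∞
  have : ContinuousSMul G M := ContMDiffSMul.continuousSMul (I := 𝓘(ℝ, EG)) (I' := 𝓘(ℝ, EM)) ∞
  have hσc : ContinuousAt σ 0 := by
    have h1 : ContinuousAt (fun x : E => (1 : G) • σ x) 0 :=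
      hloc.contMDiffAt.continuousAt.comp (f := fun x : E => ((1 : G), x))
        (continuousAt_const.prodMk continuousAt_id)
    simpa only [one_smul] using h1
  obtain ⟨Φ, h1Φ, hΦ⟩ := hloc
  obtain ⟨A, W, hA, h1A, hW, h0W, hAW⟩ := mem_nhds_prod_iff'.1 (Φ.open_source.mem_nhds h1Φ)
  -- The elements of `G` that are not close to the stabilizer move `p` away from itself.
  have hC : IsClosed {k : G | ∀ γ : MulAction.stabilizer G p, k * (γ : G)⁻¹ ∉ A} := by
    simp only [ofPred_forall]
    exact isClosed_iInter fun γ => hA.isClosed_compl.preimage (continuous_mul_const (γ : G)⁻¹)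
  have h3 : ∀ᶠ z : E × E in 𝓝 (0, 0),
      ∀ k ∈ {k : G | ∀ γ : MulAction.stabilizer G p, k * (γ : G)⁻¹ ∉ A}, k • σ z.1 ≠ σ z.2 := by
    refine hC.isCompact.eventually_forall_of_forall_eventually fun k hk => ?_
    have hkp : k • p ≠ p := fun hkp => hk ⟨k, hkp⟩ (by rwa [mul_inv_cancel])
    have h4 : ContinuousAt (fun w : (E × E) × G => w.2 • σ w.1.1) ((0, 0), k) :=
      continuousAt_snd.smul (ContinuousAt.comp (g := σ) hσc continuousAt_fst.fst)
    have h5 : ContinuousAt (fun w : (E × E) × G => σ w.1.2) ((0, 0), k) :=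
      ContinuousAt.comp (g := σ) hσc continuousAt_fst.snd
    refine (h4.prodMk h5).eventually ((isOpen_ne_fun continuous_fst continuous_snd).mem_nhds
      (x := (k • σ 0, σ 0)) ?_)
    change k • σ 0 ≠ σ 0
    rwa [hσ]
  rw [nhds_prod_eq] at h3
  obtain ⟨W', hW', hWW⟩ := (Filter.eventually_prod_self_iff (r := fun a b =>
    ∀ k ∈ {k : G | ∀ γ : MulAction.stabilizer G p, k * (γ : G)⁻¹ ∉ A}, k • σ a ≠ σ b)).1 h3
  obtain ⟨r, hr, hball⟩ := Metric.eventually_nhds_iff_ball.1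
    ((eventually_mem_set.2 hW').and (heq.and (hW.mem_nhds h0W)))
  refine ⟨r, hr, fun x hx y hy k hk => ?_⟩
  have h4 : ¬ ∀ γ : MulAction.stabilizer G p, k * (γ : G)⁻¹ ∉ A := fun h =>
    hWW _ (hball x hx).1 _ (hball y hy).1 k h hk
  push Not at h4
  obtain ⟨γ, hγ⟩ := h4
  have hγx : ρ γ x ∈ Metric.ball (0 : E) r := by
    rw [mem_ball_zero_iff, LinearIsometryEquiv.norm_map]
    exact mem_ball_zero_iff.1 hx
  have h5 : (k * (γ : G)⁻¹) • σ (ρ γ x) = (1 : G) • σ y := by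
    rw [(hball x hx).2.1, smul_smul, inv_mul_cancel_right, one_smul, hk]
  have h6 := hAW (mk_mem_prod hγ (hball _ hγx).2.2)
  have h7 := hAW (mk_mem_prod h1A (hball y hy).2.2)
  have h8 := Φ.injOn h6 h7 ((hΦ h6).symm.trans (h5.trans (hΦ h7)))
  exact ⟨γ, mul_inv_eq_one.1 (congrArg Prod.fst h8), (congrArg Prod.snd h8).symm⟩

variable [FiniteDimensional ℝ EG] [FiniteDimensional ℝ EM] [T2Space G] [IsManifold 𝓘(ℝ, EM) ∞ M]

/-- The slice theorem: there is a slice disc at every point with finite stabilizer. -/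
theorem exists_sliceDisc (p : M) [Finite (MulAction.stabilizer G p)] :
    ∃ s : SliceDisc (G := G) 𝓘(ℝ, EG) 𝓘(ℝ, EM) (id : M → M), s.pt = p := by
  obtain ⟨E, _, _, _, ρ, σ, hσ, heq, hloc⟩ := exists_local_slice (EG := EG) (EM := EM) (G := G) p
  obtain ⟨r₁, hr₁, hsep⟩ := eventually_smul_eq_imp hσ heq hloc
  have hev : ∀ᶠ x in 𝓝 (0 : E), IsLocalDiffeomorphAt (𝓘(ℝ, EG).prod 𝓘(ℝ, E)) 𝓘(ℝ, EM) ∞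
      (fun z : G × E => z.1 • σ z.2) (1, x) := by
    obtain ⟨Φ, h1Φ, hΦ⟩ := hloc
    have h1 : ContinuousAt (fun x : E => ((1 : G), x)) 0 :=
      continuousAt_const.prodMk continuousAt_id
    filter_upwards [h1.eventually (Φ.open_source.mem_nhds h1Φ)] with x hx
    exact ⟨Φ, hx, hΦ⟩
  obtain ⟨r, hr, hball⟩ := Metric.eventually_nhds_iff_ball.1
    (hev.and (heq.and (Metric.ball_mem_nhds (0 : E) hr₁)))
  have hF : ∀ z : G × disc E r, IsLocalDiffeomorphAt (𝓘(ℝ, EG).prod 𝓘(ℝ, E)) 𝓘(ℝ, EM) ∞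
      (fun z : G × E => z.1 • σ z.2) (Prod.map id Subtype.val z) := fun z =>
    isLocalDiffeomorphAt_smul_of_one (hball z.2 z.2.2).1 z.1
  have hval : ContMDiff (𝓘(ℝ, EG).prod 𝓘(ℝ, E)) (𝓘(ℝ, EG).prod 𝓘(ℝ, E)) ∞
      (Prod.map (id : G → G) (Subtype.val : disc E r → E)) :=
    contMDiff_id.prodMap contMDiff_subtype_val
  refine ⟨{ pt := p
            E := E
            rep := ρ
            radius := r
            radius_pos := hr
            slice := fun x => σ x
            slice_zero := hσ
            slice_equivariant := fun γ x => (hball x x.2).2.1 γ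
            tube_eq_iff := fun g h x y => ?_
            tube_contMDiff := fun z => (hF z).contMDiffAt.comp z (hval z)
            tube_immersion := fun z => ?_
            tube_isOpenMap := ?_ }, rfl⟩
  · constructor
    · intro h1
      have h2 : (h⁻¹ * g) • σ x = σ y := by rw [mul_smul, h1, inv_smul_smul]
      obtain ⟨γ, h3, h4⟩ := hsep x (hball x x.2).2.2 y (hball y y.2).2.2 _ h2
      refine ⟨γ, ?_, Subtype.ext h4⟩
      rw [← h3]
      group
    · rintro ⟨γ, rfl, rfl⟩
      have h1 : σ (ρ γ x) = (γ : G) • σ x := (hball x x.2).2.1 γ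
      change g • σ x = (g * (γ : G)⁻¹) • σ (ρ γ x)
      rw [h1, smul_smul, inv_mul_cancel_right]
  · change Injective (mfderiv _ _ ((fun z : G × E => z.1 • σ z.2) ∘
      (Prod.map (id : G → G) (Subtype.val : disc E r → E))) z)
    rw [mfderiv_comp z ((hF z).contMDiffAt.mdifferentiableAt (by simp))
      ((hval z).mdifferentiableAt (by simp))]
    refine (injective_mfderiv_of_isLocalDiffeomorphAt (hF z)).comp (injective_mfderiv_prodMap_id
      (contMDiff_subtype_val.contMDiffAt.mdifferentiableAt (n := ∞) (by simp)) ?_)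
    exact injective_mfderiv_of_isLocalDiffeomorphAt (isLocalDiffeomorph_opens_val (disc E r) z.2)
  · refine IsOpenMap.of_nhds_le fun z => ?_
    have h1 : IsOpenEmbedding (Prod.map (id : G → G) (Subtype.val : disc E r → E)) :=
      IsOpenEmbedding.id.prodMap (disc E r).isOpenEmbedding'
    change 𝓝 _ ≤ map ((fun z : G × E => z.1 • σ z.2) ∘
      (Prod.map (id : G → G) (Subtype.val : disc E r → E))) (𝓝 z)
    rw [← map_map, h1.map_nhds_eq, (hF z).map_nhds_eq]
    rfl

end SliceTheorem

/-! ### The quotient of the fixed point set and the inertia orbifold -/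

theorem mainTheorem7
    {EG EM : Type*} [NormedAddCommGroup EG] [NormedSpace ℝ EG] [FiniteDimensional ℝ EG]
    [NormedAddCommGroup EM] [NormedSpace ℝ EM] [FiniteDimensional ℝ EM]
    (G M : Type*)
    [Group G] [TopologicalSpace G] [T2Space G] [CompactSpace G]
    [ChartedSpace EG G] [LieGroup 𝓘(ℝ, EG) ∞ G]
    [TopologicalSpace M] [T2Space M] [SecondCountableTopology M]
    [ChartedSpace EM M] [IsManifold 𝓘(ℝ, EM) ∞ M]
    [MulAction G M] [ContMDiffSMul 𝓘(ℝ, EG) 𝓘(ℝ, EM) ∞ G M]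
    (almostFree : ∀ p : M, Finite (MulAction.stabilizer G p)) :
    -- `Ī` is a `G`-invariant embedded submanifold of `G × M`
    IsEmbeddedSubmanifold (𝓘(ℝ, EG).prod 𝓘(ℝ, EM))
      (Function.fixedPoints (inertiaMap G M)) ∧
    (∀ (g : G), ∀ x ∈ Function.fixedPoints (inertiaMap G M),
      g • x ∈ Function.fixedPoints (inertiaMap G M)) ∧
    -- `G\M`, `G\Ī` and `Λ(G\M)` are orbifolds
    (quotientAtlas (G := G) 𝓘(ℝ, EG) 𝓘(ℝ, EM) (id : M → M)).IsOrbifold ∧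
    (quotientAtlas (G := G) 𝓘(ℝ, EG) (𝓘(ℝ, EG).prod 𝓘(ℝ, EM))
      (Subtype.val : fixedLocus G M → ConjProd G M)).IsOrbifold ∧
    (quotientAtlas (G := G) 𝓘(ℝ, EG) 𝓘(ℝ, EM) (id : M → M)).inertia.IsOrbifold ∧
    -- `G\Ī` is diffeomorphic to `Λ(G\M)`
    OrbifoldDiffeomorphic
      (quotientAtlas (G := G) 𝓘(ℝ, EG) (𝓘(ℝ, EG).prod 𝓘(ℝ, EM))
        (Subtype.val : fixedLocus G M → ConjProd G M))
      (quotientAtlas (G := G) 𝓘(ℝ, EG) 𝓘(ℝ, EM) (id : M → M)).inertia := by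
  have : ContinuousSMul G M := ContMDiffSMul.continuousSMul (I := 𝓘(ℝ, EG)) (I' := 𝓘(ℝ, EM)) ∞
  have : IsTopologicalGroup G := topologicalGroup_of_lieGroup 𝓘(ℝ, EG) ∞
  have : SecondCountableTopology G := ChartedSpace.secondCountable_of_sigmaCompact EG G
  have hex : ∀ p : M, ∃ s : SliceDisc (G := G) 𝓘(ℝ, EG) 𝓘(ℝ, EM) (id : M → M), s.pt = p :=
    fun p => have := almostFree p; exists_sliceDisc p
  have : SecondCountableTopology (fixedLocus G M) :=
    TopologicalSpace.Subtype.secondCountableTopology _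
  refine ⟨isEmbeddedSubmanifold_fixedPoints_inertiaMap almostFree hex,
    fun g x hx => (fixedLocus G M).smul_mem g hx,
    SliceDisc.quotientAtlas_isOrbifold IsInducing.id almostFree hex,
    SliceDisc.quotientAtlas_isOrbifold IsInducing.subtypeVal
      (fixedLocus.finite_stabilizer almostFree) fun x => ?_,
    inertia_quotientAtlas_isOrbifold almostFree hex,
    orbifoldDiffeomorphic_fixedLocus_inertia almostFree hex⟩
  obtain ⟨s, g, rfl⟩ := fixedLocus.exists_sliceDisc hex x
  have := almostFree s.pt
  exact ⟨s.inertiaSlice g, rfl⟩
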